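/- Let $\Pr>0$, $\mathrm{Ta}\ge 0$, $Q\ge 0$, $L_1,L_2>0$, $\alpha_i=1/L_i$, and let $\mathrm{Ra}\in\mathbb R$ be the control parameter. Let $L=L_{\mathrm{Ra}}$ be the linearized operator of rotating magnetoconvection in the layer $\mathbb R^2\times(0,1)$: $L\Psi=\beta\Psi$, $\Psi=(\mathbf u,\theta)\neq 0$, $\beta\in\mathbb C$, means that for some $\mathbf b\in H^2$ and $\pi\in H^1$ $$\Delta\mathbf u-\nabla\pi+\mathrm{Ra}\,\theta\mathbf e_3+\sqrt{\mathrm{Ta}}\,(\mathbf u\times\mathbf e_3)+Q\,\partial_{x_2}\mathbf b=\beta\mathbf u,\qquad \tfrac1{\Pr}\Delta\theta+\tfrac1{\Pr}u_3=\beta\theta,\qquad \Delta\mathbf b=-\partial_{x_2}\mathbf u,\qquad \nabla\cdot\mathbf u=\nabla\cdot\mathbf b=0,$$ where $\Psi\in H^2$ is complex-valued, all functions are periodic in $x_1,x_2$ with periods $2\pi L_1,2\pi L_2$, one has $\theta=u_3=b_3=0$ and $\partial_{x_3}u_1=\partial_{x_3}u_2=\partial_{x_3}b_1=\partial_{x_3}b_2=0$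 at $x_3=0,1$, and $\Psi(-x_1,-x_2,x_3)=(-u_1,-u_2,u_3,\theta)(x_1,x_2,x_3)$. Let $I_1=\{(j,k,l): j,k,l\in\mathbb Z,\ j\ge0,\ (j,k)\ne(0,0),\ l\ge1\}$. For $J=(j,k,l)$ put $\alpha_{jk}^2=(j\alpha_1)^2+(k\alpha_2)^2$, $r_J^2=\alpha_{jk}^2+l^2\pi^2$ and, for $J\in I_1$, let $\beta_J^1,\beta_J^2,\beta_J^3$ (depending on $\mathrm{Ra}$; $\Re\beta_J^1\ge\Re\beta_J^2\ge\Re\beta_J^3$, ties ordered arbitrarily) be the roots, with multiplicity, of $a_3\beta^3+a_2\beta^2+a_1\beta+a_0=0$, where $$a_3=\Pr r_J^4,\qquad a_2=\big(r_J^4+2\Pr(r_J^4+Qk^2\alpha_2^2)\big)r_J^2,$$ $$a_1=(r_J^4+Qk^2\alpha_2^2)\big(\Pr Qk^2\alpha_2^2+r_J^4(\Pr+2)\big)+\Pr\mathrm{Ta}\,l^2\pi^2r_J^2-\mathrm{Ra}\,\alpha_{jk}^2r_J^2,$$ $$a_0=r_J^2(r_J^4+Qk^2\alpha_2^2)^2+r_J^4l^2\pi^2\,\mathrm{Ta}-\mathrm{Ra}\,\alpha_{jk}^2(r_J^4+Qk^2\alpha_2^2).$$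 For $J\in I_1$ put $$f(J)=\frac{r_J^2(r_J^4+Qk^2\alpha_2^2)^2+\mathrm{Ta}\,r_J^4l^2\pi^2}{\alpha_{jk}^2(r_J^4+Qk^2\alpha_2^2)},$$ $$g(J)=\frac{2(Qk^2\alpha_2^2+r_J^4)}{\alpha_{jk}^2r_J^2}\Big[(1+\Pr)r_J^4+\Pr Qk^2\alpha_2^2+\frac{\Pr^2\mathrm{Ta}\,r_J^2l^2\pi^2}{(1+\Pr)r_J^4+\Pr Qk^2\alpha_2^2}\Big].$$ Then $\mathrm{Ra}_{c_1}=\min_{I_1}f$ and $\mathrm{Ra}_{c_2}=\min_{I_1}g$ exist; let $\mathrm{Ra}_c=\min\{\mathrm{Ra}_{c_1},\mathrm{Ra}_{c_2}\}$ and $X=\{J\in I_1:\min\{f(J),g(J)\}=\mathrm{Ra}_c\}$. For every $\mathrm{Ra}$, each $\beta_J^s$ ($J\in I_1$, $s=1,2,3$) is an eigenvalue of $L$, and every eigenvalue of $L$ is either one of these or one of the numbers $$-\frac{Qk^2\alpha_2^2+\alpha_{jk}^4}{\alpha_{jk}^2}\ \ (j,k\in\mathbb Z,\ j\ge0,\ (j,k)\neq(0,0)),\qquad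 -l^2\pi^2\pm i\sqrt{\mathrm{Ta}},\quad -\frac{l^2\pi^2}{\Pr}\ \ (l\in\mathbb Z,\ l\ge1),$$ all of which have negative real part. Moreover: (1) If $\mathrm{Ra}_{c_1}<\mathrm{Ra}_{c_2}$, then for every $J\in X$: $\Re\beta_J^1<0$ for $\mathrm{Ra}<\mathrm{Ra}_{c_1}$, and $\beta_J^1$ is real (hence negative) for $\mathrm{Ra}<\mathrm{Ra}_{c_1}$ sufficiently close to $\mathrm{Ra}_{c_1}$; $\beta_J^1=0$ for $\mathrm{Ra}=\mathrm{Ra}_{c_1}$; $\beta_J^1$ is real and positive for all $\mathrm{Ra}>\mathrm{Ra}_{c_1}$. Furthermore $\Re\beta_J^s(\mathrm{Ra}_{c_1})<0$ for all $J\in I_1$, $s\in\{1,2,3\}$ with $(J,s)\notin X\times\{1\}$. (2) If $\mathrm{Ra}_{c_2}<\mathrm{Ra}_{c_1}$, then for every $J\in X$: there is $\delta>0$ such that $\beta_J^1=\overline{\beta_J^2}$ is non-real for $0\le\mathrm{Ra}<\mathrm{Ra}_{c_2}+\delta$; $\Re\beta_J^1$ and $\Re\beta_J^2$ are negative for all $\mathrm{Ra}<\mathrm{Ra}_{c_2}$,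 zero for $\mathrm{Ra}=\mathrm{Ra}_{c_2}$, and positive for $\mathrm{Ra}_{c_2}<\mathrm{Ra}<\mathrm{Ra}_{c_1}$; $\Re\beta_J^1>0$ for all $\mathrm{Ra}>\mathrm{Ra}_{c_2}$; and the crossing is transversal: $\Re\beta_J^1$ is differentiable in $\mathrm{Ra}$ at $\mathrm{Ra}_{c_2}$ with positive derivative. Furthermore $\Re\beta_J^s(\mathrm{Ra}_{c_2})<0$ for all $J\in I_1$, $s\in\{1,2,3\}$ with $(J,s)\notin X\times\{1,2\}$. -/

import Mathlib

open scoped ContDiff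
open MeasureTheory

namespace RMC

noncomputable section

/-- The fixed parameters: Prandtl number `Pr`, Taylor number `Ta`, Chandrasekhar number `Q`, and the
horizontal scales `L1`, `L2` (the horizontal periods are `2 π L1` and `2 π L2`). The Rayleigh
number is the control parameter and is kept separate. -/
structure Params where
  Pr : ℝ
  Ta : ℝ
  Q : ℝ
  L1 : ℝ
  L2 : ℝ

/-! ## Function spaces on the horizontally periodic layer -/

/-- Points `(x₁, x₂, x₃)`, with coordinates numbered `0, 1, 2`. -/
abbrev Pt := Fin 3 → ℝ

/-- One period cell `(0, 2πL₁) × (0, 2πL₂) × (0, 1)` of the layer. -/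
def cell (p : Params) : Set Pt :=
  {x | x 0 ∈ Set.Ioo 0 (2 * Real.pi * p.L1) ∧ x 1 ∈ Set.Ioo 0 (2 * Real.pi * p.L2) ∧
    x 2 ∈ Set.Ioo (0 : ℝ) 1}

/-- Lebesgue measure on the period cell. -/
def cellVol (p : Params) : Measure Pt := (volume : Measure Pt).restrict (cell p)

/-- Periodicity in the two horizontal directions. -/
def HPeriodic (p : Params) (f : Pt → ℂ) : Prop :=
  ∀ (m n : ℤ) (x : Pt),
    f (x + ![2 * m * p.L1 * Real.pi, 2 * n * p.L2 * Real.pi, 0]) = f x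

/-- Classical partial derivative, used for test functions only. -/
def partialD (i : Fin 3) (φ : Pt → ℂ) : Pt → ℂ := fun x => fderiv ℝ φ x (Pi.single i 1)

/-- Test functions: smooth up to the boundary, horizontally periodic. -/
def IsTest (p : Params) (φ : Pt → ℂ) : Prop := ContDiff ℝ ∞ φ ∧ HPeriodic p φ

/-- `g` is the weak partial derivative of `f` in direction `i` on the horizontally periodic layer.
The layer has no boundary in the horizontal directions; for the vertical direction the test
functions have to vanish on the two walls `x₃ = 0, 1`. -/
def HasWeakPartial (p : Params) (i : Fin 3) (f g : Pt → ℂ) : Prop :=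
  ∀ φ : Pt → ℂ, IsTest p φ → (i = 2 → ∀ x : Pt, x 2 = 0 ∨ x 2 = 1 → φ x = 0) →
    ∫ x, f x * partialD i φ x ∂(cellVol p) = - ∫ x, g x * φ x ∂(cellVol p)

/-- For `f` in `H¹` with vertical weak derivative `g`: the trace of `f` on the walls `x₃ = 0, 1`
vanishes, that is, Green's formula has no boundary term even if the test function does not vanish
on the walls. -/
def ZeroTrace (p : Params) (f g : Pt → ℂ) : Prop :=
  ∀ φ : Pt → ℂ, IsTest p φ →
    ∫ x, f x * partialD 2 φ x ∂(cellVol p) = - ∫ x, g x * φ x ∂(cellVol p)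

/-- Horizontally periodic (complex-valued) functions in `H¹`, with their weak gradient.
Functions are determined up to null sets, and their values off the layer play no role. -/
structure H1Fun (p : Params) where
  toFun : Pt → ℂ
  grad : Fin 3 → Pt → ℂ
  periodic : HPeriodic p toFun
  memLp : MemLp toFun 2 (cellVol p)
  grad_memLp : ∀ i, MemLp (grad i) 2 (cellVol p)
  grad_weak : ∀ i, HasWeakPartial p i toFun (grad i)

/-- Horizontally periodic (complex-valued) functions in `H²`, with their weak first and second
derivatives. -/
structure H2Fun (p : Params) extends H1Fun p where
  hess : Fin 3 → Fin 3 → Pt → ℂ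
  hess_memLp : ∀ i j, MemLp (hess i j) 2 (cellVol p)
  hess_weak : ∀ i j, HasWeakPartial p i (grad j) (hess i j)

/-- The Laplacian of an `H²` function. -/
def H2Fun.lap {p : Params} (f : H2Fun p) : Pt → ℂ := fun x => ∑ i, f.hess i i x

/-- Boundary condition `f = 0` at `x₃ = 0, 1`. -/
def H2Fun.Dirichlet {p : Params} (f : H2Fun p) : Prop := ZeroTrace p f.toFun (f.grad 2)

/-- Boundary condition `∂f/∂x₃ = 0` at `x₃ = 0, 1`. -/
def H2Fun.Neumann {p : Params} (f : H2Fun p) : Prop := ZeroTrace p (f.grad 2) (f.hess 2 2)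

/-- Boundary conditions at `x₃ = 0, 1` for a vector field `v` (velocity or magnetic field):
`v₃ = 0` and `∂v₁/∂x₃ = ∂v₂/∂x₃ = 0`. -/
def FreeBdry {p : Params} (v : Fin 3 → H2Fun p) : Prop :=
  (v 0).Neumann ∧ (v 1).Neumann ∧ (v 2).Dirichlet

/-- `∇ · v = 0`. -/
def DivFree {p : Params} (v : Fin 3 → H2Fun p) : Prop :=
  ∀ᵐ x ∂(cellVol p), ∑ i, (v i).grad i x = 0

/-- The reflection `(x₁, x₂, x₃) ↦ (-x₁, -x₂, x₃)`. -/
def hreflect (x : Pt) : Pt := ![-x 0, -x 1, x 2]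

/-- The domain `H₁` (complexified) of the linearized operator: `H²` states `Ψ = (u, θ)` that are
horizontally periodic, divergence free, satisfy the boundary conditions, and have the symmetry
`Ψ(-x₁, -x₂, x₃) = (-u₁, -u₂, u₃, θ)`. The symmetry forces `u₁ = u₂ = 0` on the axis
`x₁ = x₂ = 0`. -/
structure State (p : Params) where
  u : Fin 3 → H2Fun p
  θ : H2Fun p
  divFree : DivFree u
  bdry_u : FreeBdry u
  bdry_θ : θ.Dirichlet
  odd_u0 : ∀ x, (u 0).toFun (hreflect x) = -(u 0).toFun x
  odd_u1 : ∀ x, (u 1).toFun (hreflect x) = -(u 1).toFun x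
  even_u2 : ∀ x, (u 2).toFun (hreflect x) = (u 2).toFun x
  even_θ : ∀ x, θ.toFun (hreflect x) = θ.toFun x

/-- `Ψ` is not the zero element (functions being identified up to null sets). -/
def State.Nonzero {p : Params} (Ψ : State p) : Prop :=
  ¬ ((∀ i, (Ψ.u i).toFun =ᵐ[cellVol p] 0) ∧ Ψ.θ.toFun =ᵐ[cellVol p] 0)

/-- The three components of `u × e₃ = (u₂, -u₁, 0)`. -/
def crossE3 {p : Params} (u : Fin 3 → H2Fun p) : Fin 3 → Pt → ℂ :=
  ![(u 1).toFun, fun x => -(u 0).toFun x, fun _ => 0]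

/-- The three components of `θ e₃`. -/
def thetaE3 {p : Params} (θ : H2Fun p) : Fin 3 → Pt → ℂ :=
  ![fun _ => 0, fun _ => 0, θ.toFun]

/-- `L Ψ = β Ψ`, written out with the pressure `π` (which realizes the Leray projection) and the
induced magnetic field `b` (which solves `Δ b = -∂u/∂x₂`):
`Δu - ∇π + Ra θ e₃ + √Ta (u × e₃) + Q ∂b/∂x₂ = β u`, `Δθ / Pr + u₃ / Pr = β θ`,
`Δb = -∂u/∂x₂`, `∇ · b = 0`. -/
def IsEigenvector (p : Params) (Ra : ℝ) (β : ℂ) (Ψ : State p) : Prop :=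
  Ψ.Nonzero ∧ ∃ (b : Fin 3 → H2Fun p) (π : H1Fun p),
    FreeBdry b ∧ DivFree b ∧
    (∀ i, ∀ᵐ x ∂(cellVol p), (b i).lap x = -(Ψ.u i).grad 1 x) ∧
    (∀ i, ∀ᵐ x ∂(cellVol p),
      (Ψ.u i).lap x - π.grad i x + Ra * thetaE3 Ψ.θ i x + √p.Ta * crossE3 Ψ.u i x
        + p.Q * (b i).grad 1 x = β * (Ψ.u i).toFun x) ∧
    (∀ᵐ x ∂(cellVol p),
      1 / (p.Pr : ℂ) * Ψ.θ.lap x + (Ψ.u 2).toFun x / p.Pr = β * Ψ.θ.toFun x)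

/-- `β` is an eigenvalue of the linearized operator `L` at Rayleigh number `Ra`. -/
def IsEigenvalue (p : Params) (Ra : ℝ) (β : ℂ) : Prop := ∃ Ψ : State p, IsEigenvector p Ra β Ψ

/-! ## Indices, characteristic equation and critical Rayleigh numbers -/

/-- Mode indices `J = (j, k, l)`. -/
abbrev Idx := ℤ × ℤ × ℕ

/-- The index set `I₁`. -/
def I1 : Set Idx := {J | 0 ≤ J.1 ∧ (J.1, J.2.1) ≠ (0, 0) ∧ 1 ≤ J.2.2}

/-- `α_{jk}² = (j α₁)² + (k α₂)²` with `α_i = 1 / L_i`. -/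
def alphaSq (p : Params) (J : Idx) : ℝ := (J.1 * (1 / p.L1)) ^ 2 + (J.2.1 * (1 / p.L2)) ^ 2

/-- `l² π²`. -/
def vertSq (J : Idx) : ℝ := (J.2.2 : ℝ) ^ 2 * Real.pi ^ 2

/-- `r_J² = α_{jk}² + l² π²`. -/
def rSq (p : Params) (J : Idx) : ℝ := alphaSq p J + vertSq J

/-- `Q k² α₂²`. -/
def magK (p : Params) (J : Idx) : ℝ := p.Q * (J.2.1 : ℝ) ^ 2 * (1 / p.L2) ^ 2

def a3 (p : Params) (J : Idx) : ℝ := p.Pr * rSq p J ^ 2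

def a2 (p : Params) (J : Idx) : ℝ :=
  (rSq p J ^ 2 + 2 * p.Pr * (rSq p J ^ 2 + magK p J)) * rSq p J

def a1 (p : Params) (Ra : ℝ) (J : Idx) : ℝ :=
  (rSq p J ^ 2 + magK p J) * (p.Pr * magK p J + rSq p J ^ 2 * (p.Pr + 2))
    + p.Pr * p.Ta * vertSq J * rSq p J - Ra * alphaSq p J * rSq p J

def a0 (p : Params) (Ra : ℝ) (J : Idx) : ℝ :=
  rSq p J * (rSq p J ^ 2 + magK p J) ^ 2 + rSq p J ^ 2 * vertSq J * p.Ta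
    - Ra * alphaSq p J * (rSq p J ^ 2 + magK p J)

/-- `β 0, β 1, β 2` are the three roots, with multiplicity, of the characteristic equation
`a₃ β³ + a₂ β² + a₁ β + a₀ = 0` of the mode `J`, in the order of decreasing real parts. -/
def IsOrderedRoots (p : Params) (Ra : ℝ) (J : Idx) (β : Fin 3 → ℂ) : Prop :=
  (∀ z : ℂ, (a3 p J : ℂ) * z ^ 3 + (a2 p J : ℂ) * z ^ 2 + (a1 p Ra J : ℂ) * z + (a0 p Ra J : ℂ)
    = (a3 p J : ℂ) * ((z - β 0) * (z - β 1) * (z - β 2))) ∧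
  (β 1).re ≤ (β 0).re ∧ (β 2).re ≤ (β 1).re

/-- The values of the eigenvalues that carry the remaining indices:
`J = (j, k, 0)` with `j ≥ 0`, `(j, k) ≠ (0, 0)`, and `J = (0, 0, l)` with `l ≥ 1`.
They do not depend on the Rayleigh number. -/
def passiveValues (p : Params) : Set ℂ :=
  {z | ∃ j k : ℤ, 0 ≤ j ∧ (j, k) ≠ (0, 0) ∧
    z = ((-((magK p (j, k, 0) + alphaSq p (j, k, 0) ^ 2) / alphaSq p (j, k, 0)) : ℝ) : ℂ)} ∪
  {z | ∃ l : ℕ, 1 ≤ l ∧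
    (z = -((l : ℂ) ^ 2 * (Real.pi : ℂ) ^ 2) + Complex.I * (√p.Ta : ℝ) ∨
     z = -((l : ℂ) ^ 2 * (Real.pi : ℂ) ^ 2) - Complex.I * (√p.Ta : ℝ) ∨
     z = -((l : ℂ) ^ 2 * (Real.pi : ℂ) ^ 2 / (p.Pr : ℂ)))}

/-- The Rayleigh number at which the mode `J` has a zero eigenvalue. -/
def fRa (p : Params) (J : Idx) : ℝ :=
  (rSq p J * (rSq p J ^ 2 + magK p J) ^ 2 + p.Ta * rSq p J ^ 2 * vertSq J) /
    (alphaSq p J * (rSq p J ^ 2 + magK p J))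

/-- The Rayleigh number attached to a pair of purely imaginary eigenvalues of the mode `J`. -/
def gRa (p : Params) (J : Idx) : ℝ :=
  2 * (magK p J + rSq p J ^ 2) / (alphaSq p J * rSq p J) *
    ((1 + p.Pr) * rSq p J ^ 2 + p.Pr * magK p J
      + p.Pr ^ 2 * p.Ta * rSq p J * vertSq J / ((1 + p.Pr) * rSq p J ^ 2 + p.Pr * magK p J))

/-- `Ra_{c1} = min_{J ∈ I₁} f(J)`. -/
def Rac1 (p : Params) : ℝ := sInf (fRa p '' I1)

/-- `Ra_{c2} = min_{J ∈ I₁} g(J)`. -/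
def Rac2 (p : Params) : ℝ := sInf (gRa p '' I1)

/-- `Ra_c = min {Ra_{c1}, Ra_{c2}}`. -/
def Rac (p : Params) : ℝ := min (Rac1 p) (Rac2 p)

/-- The critical index set `X`. -/
def critX (p : Params) : Set Idx := {J | J ∈ I1 ∧ min (fRa p J) (gRa p J) = Rac p}

end

end RMC

open RMC

/-!
The operator `L` has constant coefficients, so it acts separately on the Fourier modes
`exp (i (j α₁ x₁ + k α₂ x₂))` times `cos (l π x₃)` (for `u₁, u₂`) or `sin (l π x₃)` (for `u₃, θ`), and
everything reduces to linear algebra for each mode and to the location of the roots of a real cubic.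

**Spectrum.** Inserting a trigonometric ansatz into the equations and eliminating the magnetic field
gives a linear system for the amplitudes of `u₁, u₂, u₃, π, θ` whose determinant is, up to the factor
`r_J²`, the characteristic polynomial of the mode (`charPoly_eq_det`). A kernel vector of the matrix
therefore yields an explicit smooth eigenfunction (`isEigenvalue_of_det_eq_zero`). Conversely, pairing
the weak equations with trigonometric test functions shows that the Fourier coefficients of any
eigenfunction solve the same system (`mode_equations`). Unless the eigenvalue is a root of one of the
characteristic polynomials or one of the passive values, which belong to the modes with `l = 0` or
`(j, k) = (0, 0)`, all coefficients vanish; the mean of `(u₁, u₂)`, which would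
contribute the eigenvalues `± i √Ta`, vanishes by the parity condition. Completeness of the trigonometric
system (`ae_eq_zero_of_trigCos`, `ae_eq_zero_of_trigSin`), a consequence of the Stone–Weierstrass
theorem, then shows that the eigenfunction is zero.

**Stability.** With the damping rates `c` of the velocity and `d` of the temperature, a rotation
parameter `w` and a multiple `ρ` of the Rayleigh number, the characteristic equation becomes
`(z + d) ((z + c)² + w) = ρ (z + c)`. Its constant coefficient is `c (rhoF - ρ)`, and its Hurwitz
determinant `b₁ b₂ - b₀` is `(c + d) (rhoG - ρ)`, where `rhoF` and `rhoG` are multiples of `f(J)` and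
`g(J)`, with the factor that relates `ρ` to `Ra`. The Routh–Hurwitz criterion gives stability below
both thresholds; at the smaller of them a real root passes through `0` if it is `rhoF`, and a
conjugate pair meets the imaginary axis if it is `rhoG`. Since `f` and `g` dominate `r_J⁴`, their minima are attained.

If `rhoG < rhoF`, then `c < d`, and `ρ` is the function `branch` of the sum of the conjugate pair.
This function is increasing, which shows that the pair persists for all `ρ` from `0` to beyond `rhoG`
(`exists_conj_pair`) and that it crosses the imaginary axis with positive speed
(`exists_hasDerivAt_re`).
-/

namespace RMC

open Filter Topology

/-! ### Real cubics and the Routh–Hurwitz criterion -/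

lemma cubic_vieta {b0 b1 b2 : ℝ} {β : Fin 3 → ℂ}
    (h : ∀ z : ℂ, z ^ 3 + b2 * z ^ 2 + b1 * z + b0 = (z - β 0) * (z - β 1) * (z - β 2)) :
    (b2 : ℂ) = -(β 0 + β 1 + β 2) ∧ (b1 : ℂ) = β 0 * β 1 + β 0 * β 2 + β 1 * β 2 ∧
      (b0 : ℂ) = -(β 0 * β 1 * β 2) := by
  have h0 := h 0
  have h1 := h 1
  have h2 := h (-1)
  refine ⟨?_, ?_, ?_⟩
  · linear_combination (1 / 2) * h1 + (1 / 2) * h2 - h0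
  · linear_combination (1 / 2) * h1 - (1 / 2) * h2
  · linear_combination h0

/-- The ordered roots of a monic real cubic are either all real, or they are a real number `x` and
a conjugate pair `u ± iv`, `v ≠ 0`; in both cases the coefficients are expressed through real
quantities. If `x = u` the real root may stand between the two conjugate ones. -/
lemma cubic_roots_cases {b0 b1 b2 : ℝ} {β : Fin 3 → ℂ}
    (h : ∀ z : ℂ, z ^ 3 + b2 * z ^ 2 + b1 * z + b0 = (z - β 0) * (z - β 1) * (z - β 2))
    (h10 : (β 1).re ≤ (β 0).re) (h21 : (β 2).re ≤ (β 1).re) :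
    ((∀ s, (β s).im = 0) ∧ b2 = -((β 0).re + (β 1).re + (β 2).re) ∧
      b1 = (β 0).re * (β 1).re + (β 0).re * (β 2).re + (β 1).re * (β 2).re ∧
      b0 = -((β 0).re * (β 1).re * (β 2).re)) ∨
    ∃ x u v : ℝ, v ≠ 0 ∧ b2 = -(x + 2 * u) ∧ b1 = u ^ 2 + v ^ 2 + 2 * x * u ∧
      b0 = -(x * (u ^ 2 + v ^ 2)) ∧
      (((β 0).im = 0 ∧ (β 0).re = x ∧ (β 1).re = u ∧ (β 2).re = u) ∨
       (β 1 = (starRingEnd ℂ) (β 0) ∧ (β 0).im ≠ 0 ∧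
          (β 0).re = u ∧ (β 1).re = u ∧ (β 2).re = x) ∨
       (x = u ∧ (β 0).re = u ∧ (β 1).re = u ∧ (β 2).re = u)) := by
  obtain ⟨e2, e1, e0⟩ := cubic_vieta h
  have root : ∀ z : ℂ, (z - β 0) * (z - β 1) * (z - β 2) = 0 →
      ((starRingEnd ℂ) z - β 0) * ((starRingEnd ℂ) z - β 1) * ((starRingEnd ℂ) z - β 2) = 0 := by
    intro z hz
    rw [← h] at hz ⊢
    have := congrArg (starRingEnd ℂ) hz
    simpa using this
  have hcase : (∀ s, (β s).im = 0) ∨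
      ((β 0).im = 0 ∧ (β 2) = (starRingEnd ℂ) (β 1) ∧ (β 1).im ≠ 0) ∨
      ((β 2).im = 0 ∧ (β 1) = (starRingEnd ℂ) (β 0) ∧ (β 0).im ≠ 0) ∨
      ((β 1).im = 0 ∧ (β 2) = (starRingEnd ℂ) (β 0) ∧ (β 0).im ≠ 0) := by
    have him : (β 0).im + (β 1).im + (β 2).im = 0 := by
      have := congrArg Complex.im e2
      simp only [Complex.ofReal_im, Complex.neg_im, Complex.add_im] at this
      linarith
    by_cases i0 : (β 0).im = 0
    · by_cases i1 : (β 1).im = 0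
      · left
        intro s
        fin_cases s
        · exact i0
        · exact i1
        · simp only [Fin.reduceFinMk]; linarith
      · right; left
        refine ⟨i0, ?_, i1⟩
        have := root (β 1) (by simp)
        rcases mul_eq_zero.1 this with h' | h'
        · rcases mul_eq_zero.1 h' with h' | h'
          · have := congrArg Complex.im h'
            simp at this
            exact absurd (by linarith) i1
          · have := congrArg Complex.im h'
            simp at this
            exact absurd (by linarith) i1
        · exact (sub_eq_zero.1 h').symm
    · have := root (β 0) (by simp)
      rcases mul_eq_zero.1 this with h' | h'
      · rcases mul_eq_zero.1 h' with h' | h'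
        · have := congrArg Complex.im h'
          simp at this
          exact absurd (by linarith) i0
        · right; right; left
          have h3 := sub_eq_zero.1 h'
          refine ⟨?_, h3.symm, i0⟩
          rw [← h3, Complex.conj_im] at him
          linarith
      · right; right; right
        have h3 := sub_eq_zero.1 h'
        refine ⟨?_, h3.symm, i0⟩
        rw [← h3, Complex.conj_im] at him
        linarith
  have r2 := congrArg Complex.re e2
  have r1 := congrArg Complex.re e1
  have r0 := congrArg Complex.re e0
  simp only [Complex.ofReal_re, Complex.neg_re, Complex.add_re, Complex.mul_re,
    Complex.mul_im] at r2 r1 r0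
  rcases hcase with hr | ⟨hi, hc, hn⟩ | ⟨hi, hc, hn⟩ | ⟨hi, hc, hn⟩
  · left
    simp only [hr, mul_zero, sub_zero] at r2 r1 r0
    exact ⟨hr, r2, r1, r0⟩
  · right
    simp only [hc, hi, Complex.conj_re, Complex.conj_im] at r2 r1 r0
    refine ⟨(β 0).re, (β 1).re, (β 1).im, hn, ?_, ?_, ?_, Or.inl ⟨hi, rfl, rfl, by simp [hc]⟩⟩
    · linarith
    · linarith
    · linarith
  · right
    simp only [hc, hi, Complex.conj_re, Complex.conj_im] at r2 r1 r0
    refine ⟨(β 2).re, (β 0).re, (β 0).im, hn, ?_, ?_, ?_,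
      Or.inr (Or.inl ⟨hc, hn, rfl, by simp [hc], rfl⟩)⟩
    · linarith
    · linarith
    · linarith
  · right
    have hre : (β 1).re = (β 0).re := by
      rw [hc, Complex.conj_re] at h21
      linarith
    simp only [hc, hi, Complex.conj_re, Complex.conj_im] at r2 r1 r0
    refine ⟨(β 1).re, (β 0).re, (β 0).im, hn, ?_, ?_, ?_,
      Or.inr (Or.inr ⟨hre, rfl, hre, by simp [hc]⟩)⟩
    · linarith
    · linarith
    · linarith

/-- `β 0, β 1, β 2` are the roots, by decreasing real parts, of the monic real cubic
`z³ + b₂ z² + b₁ z + b₀`. -/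
def MonicRoots (b2 b1 b0 : ℝ) (β : Fin 3 → ℂ) : Prop :=
  (∀ z : ℂ, z ^ 3 + b2 * z ^ 2 + b1 * z + b0 = (z - β 0) * (z - β 1) * (z - β 2)) ∧
    (β 1).re ≤ (β 0).re ∧ (β 2).re ≤ (β 1).re

namespace MonicRoots

variable {b2 b1 b0 : ℝ} {β : Fin 3 → ℂ}

/-- The Routh–Hurwitz criterion (sufficiency). -/
lemma re_neg (h : MonicRoots b2 b1 b0 β) (h2 : 0 < b2) (h0 : 0 < b0) (hH : b0 < b1 * b2) (s) :
    (β s).re < 0 := by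
  obtain ⟨h, h10, h21⟩ := h
  suffices (β 0).re < 0 by
    fin_cases s <;> simp only [Fin.reduceFinMk, Fin.zero_eta, Fin.isValue, Fin.mk_one] <;> linarith
  have hb1 : 0 < b1 := by
    by_contra! hb
    nlinarith
  have noroot : ∀ x : ℝ, x ^ 3 + b2 * x ^ 2 + b1 * x + b0 = 0 → x < 0 := by
    intro x hx
    by_contra! hx0
    nlinarith [pow_nonneg hx0 3, pow_nonneg hx0 2, mul_nonneg hb1.le hx0,
      mul_nonneg h2.le (pow_nonneg hx0 2)]
  rcases cubic_roots_cases h h10 h21 with ⟨hr, e2, e1, e0⟩ | ⟨x, u, v, hv, e2, e1, e0, hc⟩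
  · apply noroot
    rw [e2, e1, e0]; ring
  · have hx : x < 0 := noroot x (by rw [e2, e1, e0]; ring)
    have hu : u < 0 := by
      by_contra! hu
      have : b1 * b2 - b0 = -2 * u * ((x + u) ^ 2 + v ^ 2) := by rw [e2, e1, e0]; ring
      nlinarith [mul_nonneg hu (add_nonneg (sq_nonneg (x + u)) (sq_nonneg v))]
    rcases hc with hc | hc | hc
    · linarith [hc.2.1]
    · linarith [hc.2.2.1]
    · linarith [hc.2.1]

/-- The marginal case `b₀ = 0`: the leading root is a simple root `0`. -/
lemma zero_root (h : MonicRoots b2 b1 b0 β) (h2 : 0 < b2) (h1 : 0 < b1) (h0 : b0 = 0) :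
    β 0 = 0 ∧ (β 1).re < 0 ∧ (β 2).re < 0 := by
  obtain ⟨h, h10, h21⟩ := h
  rcases cubic_roots_cases h h10 h21 with ⟨hr, e2, e1, e0⟩ | ⟨x, u, v, hv, e2, e1, e0, hc⟩
  · have hz : (β 0).re * (β 1).re * (β 2).re = 0 := by linarith
    have h0' : (β 0).re = 0 := by
      rcases mul_eq_zero.1 hz with hz | hz
      · rcases mul_eq_zero.1 hz with hz | hz
        · exact hz
        · rw [hz] at e2 e1 h10 h21; nlinarith
      · rw [hz] at e2 e1 h21; nlinarith
    refine ⟨Complex.ext h0' (hr 0), ?_⟩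
    rw [h0'] at e1 e2 h10
    have : (β 1).re < 0 := by
      rcases h10.lt_or_eq with h | h
      · exact h
      · rw [h] at e1; nlinarith
    exact ⟨this, by linarith⟩
  · have hv2 : 0 < u ^ 2 + v ^ 2 := by positivity
    have hx : x = 0 := by
      have : x * (u ^ 2 + v ^ 2) = 0 := by linarith
      exact (mul_eq_zero.1 this).resolve_right hv2.ne'
    subst hx
    rcases hc with hc | hc | hc
    · exact ⟨Complex.ext hc.2.1 hc.1, by linarith [hc.2.2.1], by linarith [hc.2.2.2]⟩
    · exfalso; linarith [hc.2.2.2.1, hc.2.2.2.2]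
    · exfalso; linarith [hc.1]

lemma pos_real (h : MonicRoots b2 b1 b0 β) (h2 : 0 < b2) (h0 : b0 < 0) :
    (β 0).im = 0 ∧ 0 < (β 0).re := by
  obtain ⟨h, h10, h21⟩ := h
  rcases cubic_roots_cases h h10 h21 with ⟨hr, e2, e1, e0⟩ | ⟨x, u, v, hv, e2, e1, e0, hc⟩
  · refine ⟨hr 0, ?_⟩
    by_contra! hn
    nlinarith [mul_nonneg (neg_nonneg.2 (h10.trans hn)) (neg_nonneg.2 (h21.trans (h10.trans hn))),
      mul_nonneg (neg_nonneg.2 hn) (mul_nonneg (neg_nonneg.2 (h10.trans hn))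
        (neg_nonneg.2 (h21.trans (h10.trans hn))))]
  · have hv2 : 0 < u ^ 2 + v ^ 2 := by positivity
    have hx : 0 < x := by
      by_contra! hx
      nlinarith
    rcases hc with hc | hc | hc
    · exact ⟨hc.1, hc.2.1 ▸ hx⟩
    · exfalso; linarith [hc.2.2.2.1, hc.2.2.2.2]
    · exfalso; linarith [hc.1]

/-- If the cubic is negative at `-ε` and `3 ε < b₂`, the leading root is real: the real root `x` that
accompanies a conjugate pair `u ± iv` satisfies `-ε < x`, and `u ≥ x` would give the sum of the roots
a value above `-3 ε > -b₂`. -/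
lemma real_of_neg_value (h : MonicRoots b2 b1 b0 β)
    {ε : ℝ} (hεb : 3 * ε < b2)
    (hval : (-ε) ^ 3 + b2 * (-ε) ^ 2 + b1 * (-ε) + b0 < 0) : (β 0).im = 0 := by
  obtain ⟨h, h10, h21⟩ := h
  rcases cubic_roots_cases h h10 h21 with ⟨hr, e2, e1, e0⟩ | ⟨x, u, v, hv, e2, e1, e0, hc⟩
  · exact hr 0
  · have hpos : 0 < (-ε - u) ^ 2 + v ^ 2 := by positivity
    have hx : -ε < x := by
      by_contra! hx
      have : (-ε) ^ 3 + b2 * (-ε) ^ 2 + b1 * (-ε) + b0 = (-ε - x) * ((-ε - u) ^ 2 + v ^ 2) := by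
        rw [e2, e1, e0]; ring
      rw [this] at hval
      nlinarith [mul_nonneg (sub_nonneg.2 hx) hpos.le]
    rcases hc with hc | hc | hc
    · exact hc.1
    · exfalso; linarith [hc.2.2.2.1, hc.2.2.2.2]
    · exfalso; linarith [hc.1]

/-- The marginal case `b₀ = b₁ b₂`: a conjugate pair lies on the imaginary axis. -/
lemma re_eq_zero (h : MonicRoots b2 b1 b0 β) (h2 : 0 < b2) (h0 : 0 < b0) (hH : b0 = b1 * b2) :
    (β 0).re = 0 ∧ (β 1).re = 0 ∧ (β 2).re < 0 := by
  obtain ⟨h, h10, h21⟩ := h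
  have hb1 : 0 < b1 := by
    by_contra! hb
    nlinarith
  rcases cubic_roots_cases h h10 h21 with ⟨hr, e2, e1, e0⟩ | ⟨x, u, v, hv, e2, e1, e0, hc⟩
  · -- three real roots would have to be negative, and then `b₀ < b₁ b₂`
    exfalso
    have hx : (β 0).re < 0 := by
      by_contra! hx0
      have : (β 0).re ^ 3 + b2 * (β 0).re ^ 2 + b1 * (β 0).re + b0 = 0 := by
        rw [e2, e1, e0]; ring
      nlinarith [pow_nonneg hx0 3, pow_nonneg hx0 2, mul_nonneg hb1.le hx0,
        mul_nonneg h2.le (pow_nonneg hx0 2)]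
    have : b1 * b2 - b0 = -(((β 0).re + (β 1).re) * ((β 0).re + (β 2).re) *
        ((β 1).re + (β 2).re)) := by
      rw [e2, e1, e0]; ring
    have : 0 < -((β 0).re + (β 1).re) * -((β 0).re + (β 2).re) * -((β 1).re + (β 2).re) := by
      apply mul_pos (mul_pos _ _) <;> linarith
    linarith
  · have hv2 : 0 < (x + u) ^ 2 + v ^ 2 := by positivity
    have hu : u = 0 := by
      have : u * ((x + u) ^ 2 + v ^ 2) = 0 := by rw [e2, e1, e0] at hH; linarith
      exact (mul_eq_zero.1 this).resolve_right hv2.ne'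
    subst hu
    rcases hc with hc | hc | hc
    · exfalso; linarith [hc.2.1, hc.2.2.1]
    · exact ⟨hc.2.2.1, hc.2.2.2.1, by linarith [hc.2.2.2.2]⟩
    · exfalso; linarith [hc.1]

lemma re_pos (h : MonicRoots b2 b1 b0 β) (hH : b1 * b2 < b0) : 0 < (β 0).re := by
  obtain ⟨h, h10, h21⟩ := h
  rcases cubic_roots_cases h h10 h21 with ⟨hr, e2, e1, e0⟩ | ⟨x, u, v, hv, e2, e1, e0, hc⟩
  · by_contra! hn
    have : b1 * b2 - b0 = -(((β 0).re + (β 1).re) * ((β 0).re + (β 2).re) *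
        ((β 1).re + (β 2).re)) := by
      rw [e2, e1, e0]; ring
    have : 0 ≤ -((β 0).re + (β 1).re) * -((β 0).re + (β 2).re) * -((β 1).re + (β 2).re) := by
      apply mul_nonneg (mul_nonneg _ _) <;> linarith
    linarith
  · have hu : 0 < u := by
      by_contra! hu
      have : b1 * b2 - b0 = -2 * u * ((x + u) ^ 2 + v ^ 2) := by rw [e2, e1, e0]; ring
      nlinarith [mul_nonneg (neg_nonneg.2 hu) (add_nonneg (sq_nonneg (x + u)) (sq_nonneg v))]
    rcases hc with hc | hc | hc
    · linarith [hc.2.2.1]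
    · linarith [hc.2.2.1]
    · linarith [hc.2.1]

lemma re_one_pos (h : MonicRoots b2 b1 b0 β) (h2 : 0 < b2) (h0 : 0 < b0) (hH : b1 * b2 < b0) :
    0 < (β 1).re := by
  have hpos := h.re_pos hH
  obtain ⟨h, h10, h21⟩ := h
  rcases cubic_roots_cases h h10 h21 with ⟨hr, e2, e1, e0⟩ | ⟨x, u, v, hv, e2, e1, e0, hc⟩
  · by_contra! hn
    nlinarith [mul_nonneg hpos.le (mul_nonneg (neg_nonneg.2 hn) (neg_nonneg.2 (h21.trans hn)))]
  · have hu : 0 < u := by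
      by_contra! hu
      have : b1 * b2 - b0 = -2 * u * ((x + u) ^ 2 + v ^ 2) := by rw [e2, e1, e0]; ring
      nlinarith [mul_nonneg (neg_nonneg.2 hu) (add_nonneg (sq_nonneg (x + u)) (sq_nonneg v))]
    rcases hc with hc | hc | hc
    · linarith [hc.2.2.1]
    · linarith [hc.2.2.2.1]
    · linarith [hc.2.2.1]

end MonicRoots

/-! ### The normalized characteristic equation -/

/-- The characteristic equation of one mode in normalized form,
`(z + d) ((z + c)² + w) = ρ (z + c)`, where `c` is the damping rate of the velocity, `d` that of
the temperature, `w` comes from the rotation, and `ρ` is proportional to the Rayleigh number. -/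
def ModeRoots (c d w ρ : ℝ) (β : Fin 3 → ℂ) : Prop :=
  MonicRoots (d + 2 * c) (c ^ 2 + w + 2 * c * d - ρ) (d * (c ^ 2 + w) - ρ * c) β

/-- The value of `ρ` at which the mode has the eigenvalue `0`. -/
noncomputable def rhoF (c d w : ℝ) : ℝ := d * (c ^ 2 + w) / c

/-- The value of `ρ` at which `b₁ b₂ = b₀`, so that the mode has a pair of opposite eigenvalues. -/
noncomputable def rhoG (c d w : ℝ) : ℝ := 2 * c * ((c + d) ^ 2 + w) / (c + d)

section

variable {c d w ρ : ℝ} {β : Fin 3 → ℂ}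

lemma b0_eq (hc : 0 < c) : d * (c ^ 2 + w) - ρ * c = c * (rhoF c d w - ρ) := by
  unfold rhoF; field_simp

lemma b1b2_sub_b0_eq (hc : 0 < c) (hd : 0 < d) :
    (c ^ 2 + w + 2 * c * d - ρ) * (d + 2 * c) - (d * (c ^ 2 + w) - ρ * c) =
      (c + d) * (rhoG c d w - ρ) := by
  have : c + d ≠ 0 := by positivity
  unfold rhoG; field_simp; ring

namespace ModeRoots

lemma re_neg (h : ModeRoots c d w ρ β) (hc : 0 < c) (hd : 0 < d)
    (hF : ρ < rhoF c d w) (hG : ρ < rhoG c d w) (s) : (β s).re < 0 := by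
  have h0 := b0_eq (d := d) (w := w) (ρ := ρ) hc
  have h1 := b1b2_sub_b0_eq (w := w) (ρ := ρ) hc hd
  have p0 := mul_pos hc (sub_pos.2 hF)
  have p1 := mul_pos (add_pos hc hd) (sub_pos.2 hG)
  exact MonicRoots.re_neg h (by linarith) (by linarith) (by linarith) s

lemma zero_root (h : ModeRoots c d w ρ β) (hc : 0 < c) (hd : 0 < d)
    (hF : ρ = rhoF c d w) (hG : ρ < rhoG c d w) : β 0 = 0 ∧ (β 1).re < 0 ∧ (β 2).re < 0 := by
  have h0 := b0_eq (d := d) (w := w) (ρ := ρ) hc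
  have h1 := b1b2_sub_b0_eq (w := w) (ρ := ρ) hc hd
  have p1 := mul_pos (add_pos hc hd) (sub_pos.2 hG)
  rw [hF, sub_self, mul_zero, ← hF] at h0
  refine MonicRoots.zero_root h (by linarith) ?_ h0
  rw [h0] at h1
  exact pos_of_mul_pos_left (b := d + 2 * c) (by linarith) (by linarith)

lemma pos_real (h : ModeRoots c d w ρ β) (hc : 0 < c) (hd : 0 < d)
    (hF : rhoF c d w < ρ) : (β 0).im = 0 ∧ 0 < (β 0).re := by
  have h0 := b0_eq (d := d) (w := w) (ρ := ρ) hc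
  have p0 := mul_pos hc (sub_pos.2 hF)
  exact MonicRoots.pos_real h (by linarith) (by linarith)

lemma re_eq_zero (h : ModeRoots c d w ρ β) (hc : 0 < c) (hd : 0 < d)
    (hF : ρ < rhoF c d w) (hG : ρ = rhoG c d w) :
    (β 0).re = 0 ∧ (β 1).re = 0 ∧ (β 2).re < 0 := by
  have h0 := b0_eq (d := d) (w := w) (ρ := ρ) hc
  have h1 := b1b2_sub_b0_eq (w := w) (ρ := ρ) hc hd
  have p0 := mul_pos hc (sub_pos.2 hF)
  rw [hG, sub_self, mul_zero, ← hG] at h1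
  exact MonicRoots.re_eq_zero h (by linarith) (by linarith) (by linarith)

lemma re_pos (h : ModeRoots c d w ρ β) (hc : 0 < c) (hd : 0 < d)
    (hG : rhoG c d w < ρ) : 0 < (β 0).re := by
  have h1 := b1b2_sub_b0_eq (w := w) (ρ := ρ) hc hd
  have p1 := mul_pos (add_pos hc hd) (sub_pos.2 hG)
  exact MonicRoots.re_pos h (by linarith)

lemma re_one_pos (h : ModeRoots c d w ρ β) (hc : 0 < c) (hd : 0 < d)
    (hF : ρ < rhoF c d w) (hG : rhoG c d w < ρ) : 0 < (β 1).re := by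
  have h0 := b0_eq (d := d) (w := w) (ρ := ρ) hc
  have h1 := b1b2_sub_b0_eq (w := w) (ρ := ρ) hc hd
  have p0 := mul_pos hc (sub_pos.2 hF)
  have p1 := mul_pos (add_pos hc hd) (sub_pos.2 hG)
  exact MonicRoots.re_one_pos h (by linarith) (by linarith) (by linarith)

end ModeRoots

/-- Just below `rhoF` the leading eigenvalue is real. -/
lemma exists_real_below_rhoF (hc : 0 < c) (hd : 0 < d)
    (hFG : rhoF c d w < rhoG c d w) :
    ∃ δ > 0, ∀ ρ β, ModeRoots c d w ρ β → rhoF c d w - δ < ρ → ρ < rhoF c d w →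
      (β 0).im = 0 := by
  set ρ₀ := rhoF c d w with hρ₀
  have h0 : d * (c ^ 2 + w) - ρ₀ * c = 0 := by
    rw [b0_eq hc, ← hρ₀, sub_self, mul_zero]
  have h1 := b1b2_sub_b0_eq (w := w) (ρ := ρ₀) hc hd
  have p1 := mul_pos (add_pos hc hd) (sub_pos.2 hFG)
  have hb1 : 0 < c ^ 2 + w + 2 * c * d - ρ₀ :=
    pos_of_mul_pos_left (b := d + 2 * c) (by linarith) (by linarith)
  -- at `ρ₀` the cubic is `z (z² + b₂ z + b₁)`, which is negative at `-ε` for small `ε > 0`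
  obtain ⟨ε, hε, hε2, hε1⟩ : ∃ ε > 0, 3 * ε < d + 2 * c ∧
      (d + 2 * c) * ε < c ^ 2 + w + 2 * c * d - ρ₀ := by
    refine ⟨min ((d + 2 * c) / 4) ((c ^ 2 + w + 2 * c * d - ρ₀) / (2 * (d + 2 * c))), ?_, ?_, ?_⟩
    · positivity
    · have := min_le_left ((d + 2 * c) / 4) ((c ^ 2 + w + 2 * c * d - ρ₀) / (2 * (d + 2 * c)))
      have : 0 < d + 2 * c := by positivity
      linarith
    · calc _ ≤ (d + 2 * c) * ((c ^ 2 + w + 2 * c * d - ρ₀) / (2 * (d + 2 * c))) := by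
            gcongr; exact min_le_right _ _
        _ = (c ^ 2 + w + 2 * c * d - ρ₀) / 2 := by field_simp
        _ < _ := by linarith
  have hneg : (-ε) ^ 3 + (d + 2 * c) * (-ε) ^ 2 + (c ^ 2 + w + 2 * c * d - ρ₀) * (-ε) < 0 := by
    have : 0 < ε * ((c ^ 2 + w + 2 * c * d - ρ₀) - (d + 2 * c) * ε + ε ^ 2) := by
      apply mul_pos hε; nlinarith
    nlinarith
  have hcont : Tendsto (fun ρ : ℝ => (-ε) ^ 3 + (d + 2 * c) * (-ε) ^ 2 +
      (c ^ 2 + w + 2 * c * d - ρ) * (-ε) + (d * (c ^ 2 + w) - ρ * c)) (𝓝 ρ₀)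
      (𝓝 ((-ε) ^ 3 + (d + 2 * c) * (-ε) ^ 2 +
      (c ^ 2 + w + 2 * c * d - ρ₀) * (-ε) + (d * (c ^ 2 + w) - ρ₀ * c))) :=
    Continuous.tendsto (by fun_prop) ρ₀
  have hev := hcont.eventually (gt_mem_nhds (by rw [h0, add_zero]; exact hneg))
  obtain ⟨δ, hδ, hball⟩ := Metric.eventually_nhds_iff.1 hev
  refine ⟨δ, hδ, fun ρ β h hlo hhi => MonicRoots.real_of_neg_value h hε2 (hball ?_)⟩
  rw [Real.dist_eq, abs_lt]
  constructor <;> linarith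

/-- The parameter `ρ` as a function of `s = 2 (u + c)`, where `u` is the real part of the conjugate
pair; here `e = d - c`. -/
noncomputable def branch (e w s : ℝ) : ℝ := s * (w / (e + s) + (e + s))

lemma branch_sub {e w s t : ℝ} (hs : 0 < e + s) (ht : 0 < e + t) :
    branch e w s - branch e w t = (s - t) * (e * w / ((e + s) * (e + t)) + e + s + t) := by
  unfold branch; field_simp; ring

lemma branch_lt {e w s t : ℝ} (he : 0 < e) (hw : 0 < w) (ht : 0 ≤ t) (hts : t < s) :
    branch e w t < branch e w s := by
  have := branch_sub (e := e) (w := w) (s := s) (t := t) (by linarith) (by linarith)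
  have h2 : 0 < (s - t) * (e * w / ((e + s) * (e + t)) + e + s + t) := by
    have := sub_pos.2 hts
    have : 0 < s := by linarith
    positivity
  linarith

lemma branch_two_c (hc : 0 < c) (hd : 0 < d) : branch (d - c) w (2 * c) = rhoG c d w := by
  have : c + d ≠ 0 := by positivity
  have h2 : d - c + 2 * c = c + d := by ring
  unfold branch rhoG
  rw [h2]; field_simp; ring

lemma lt_of_rhoG_lt_rhoF (hc : 0 < c) (hd : 0 < d) (hw : 0 ≤ w) (hGF : rhoG c d w < rhoF c d w) :
    c < d ∧ c ^ 2 * (c + d) < w * (d - c) := by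
  have key : rhoF c d w - rhoG c d w =
      (d + 2 * c) * (w * (d - c) - c ^ 2 * (c + d)) / (c * (c + d)) := by
    have : c + d ≠ 0 := by positivity
    unfold rhoF rhoG; field_simp; ring
  have h2 : c ^ 2 * (c + d) < w * (d - c) := by
    by_contra! hcon
    have : (d + 2 * c) * (w * (d - c) - c ^ 2 * (c + d)) / (c * (c + d)) ≤ 0 := by
      apply div_nonpos_of_nonpos_of_nonneg _ (by positivity)
      apply mul_nonpos_of_nonneg_of_nonpos (by positivity) (by linarith)
    linarith
  refine ⟨?_, h2⟩
  by_contra! hcon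
  have : 0 < c ^ 2 * (c + d) := by positivity
  nlinarith [mul_nonneg hw (sub_nonneg.2 hcon)]

/-- Let `s` be `2 c` plus the sum of two eigenvalues: those of the conjugate pair if there is one, and
the two largest if all are real. For `c < d` and `ρ ≥ 0`, `s` is nonnegative and tied to `ρ` by
`branch`. If all eigenvalues are real, the AM–GM inequality bounds `s` from below; otherwise the pair
comes first. -/
lemma ModeRoots.branch_cases (h : ModeRoots c d w ρ β) (hcd : c < d) (hw : 0 < w) (hρ : 0 ≤ ρ) :
    ∃ s, 0 ≤ s ∧ ρ = branch (d - c) w s ∧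
      (4 * ((d - c) * w) ≤ s ^ 2 * (d - c + s) ∨
        (β 1 = (starRingEnd ℂ) (β 0) ∧ (β 0).im ≠ 0 ∧ s = 2 * ((β 0).re + c))) := by
  obtain ⟨h, h10, h21⟩ := h
  have he : 0 < d - c := sub_pos.2 hcd
  have hew : 0 < (d - c) * w := mul_pos he hw
  -- `τ` is the remaining root and `q` the product of the two leading ones, shifted by `c`
  have main : ∀ τ s q : ℝ, τ + s = -(d - c) → q + τ * s = w - ρ → q * τ = -((d - c) * w) →
      τ < 0 → 0 ≤ s ∧ ρ = branch (d - c) w s ∧ q * (d - c + s) = (d - c) * w := by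
    intro τ s q e2 e1 e0 hτ
    have hτ' : τ = -(d - c + s) := by linarith
    have hes : 0 < d - c + s := by linarith
    have hq : q * (d - c + s) = (d - c) * w := by rw [hτ'] at e0; linarith
    have hrel : ρ * (d - c + s) = s * (w + (d - c + s) ^ 2) := by
      have : ρ = w - q + (d - c + s) * s := by rw [hτ'] at e1; linarith
      rw [this]
      linear_combination -hq
    refine ⟨?_, ?_, hq⟩
    · have h1 : 0 ≤ s * (w + (d - c + s) ^ 2) := hrel ▸ mul_nonneg hρ hes.le
      exact nonneg_of_mul_nonneg_left h1 (by positivity)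
    · unfold branch; field_simp; linarith
  rcases cubic_roots_cases h h10 h21 with ⟨hr, e2, e1, e0⟩ | ⟨x, u, v, hv, e2, e1, e0, hcase⟩
  · have e0' : ((β 0).re + c) * ((β 1).re + c) * ((β 2).re + c) = -((d - c) * w) := by
      linear_combination e0 - c * e1 + c ^ 2 * e2
    have hτ : (β 2).re + c < 0 := by
      by_contra! hn
      have : 0 ≤ ((β 0).re + c) * ((β 1).re + c) * ((β 2).re + c) :=
        mul_nonneg (mul_nonneg (by linarith) (by linarith)) hn
      linarith
    obtain ⟨hs, hb, hq⟩ := main ((β 2).re + c) ((β 0).re + c + ((β 1).re + c))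
      (((β 0).re + c) * ((β 1).re + c)) (by linear_combination e2)
      (by linear_combination -e1 + 2 * c * e2) e0' hτ
    refine ⟨_, hs, hb, Or.inl ?_⟩
    rw [← hq, ← mul_assoc]
    apply mul_le_mul_of_nonneg_right _ (by linarith)
    nlinarith [sq_nonneg ((β 0).re - (β 1).re)]
  · have hq0 : 0 < (u + c) ^ 2 + v ^ 2 := by positivity
    have e0' : ((u + c) ^ 2 + v ^ 2) * (x + c) = -((d - c) * w) := by
      linear_combination e0 - c * e1 + c ^ 2 * e2
    have hτ : x + c < 0 := by
      by_contra! hn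
      nlinarith [mul_nonneg hq0.le hn]
    obtain ⟨hs, hb, hq⟩ := main (x + c) (2 * (u + c)) ((u + c) ^ 2 + v ^ 2)
      (by linear_combination e2) (by linear_combination -e1 + 2 * c * e2) e0' hτ
    rcases hcase with h' | h' | h'
    · exfalso; linarith [h'.2.1, h'.2.2.1]
    · exact ⟨_, hs, hb, Or.inr ⟨h'.1, h'.2.1, by rw [h'.2.2.1]⟩⟩
    · exfalso; linarith [h'.1]

/-- If `rhoG < rhoF` then the two leading eigenvalues form a nonreal conjugate pair up to and
beyond `rhoG`: as `branch` is increasing, `s` stays below the bound that real roots would satisfy. -/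
lemma exists_conj_pair (hc : 0 < c) (hd : 0 < d) (hw : 0 ≤ w) (hGF : rhoG c d w < rhoF c d w) :
    ∃ δ > 0, ∀ ρ β, ModeRoots c d w ρ β → 0 ≤ ρ → ρ < rhoG c d w + δ →
      β 1 = (starRingEnd ℂ) (β 0) ∧ (β 0).im ≠ 0 ∧ 0 ≤ 2 * ((β 0).re + c) ∧
        ρ = branch (d - c) w (2 * ((β 0).re + c)) := by
  obtain ⟨hcd, hwc⟩ := lt_of_rhoG_lt_rhoF hc hd hw hGF
  have he : 0 < d - c := sub_pos.2 hcd
  have hw' : 0 < w := by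
    refine hw.lt_of_ne ?_
    rintro rfl
    have : 0 < c ^ 2 * (c + d) := by positivity
    linarith
  -- the AM–GM bound fails at `s = 2c`, the value that belongs to `rhoG`, hence also at some `s₁ > 2c`
  obtain ⟨s₁, hs₁, hlt⟩ : ∃ s₁ > 2 * c, s₁ ^ 2 * (d - c + s₁) < 4 * ((d - c) * w) := by
    have hcont : Tendsto (fun s : ℝ => s ^ 2 * (d - c + s)) (𝓝[>] (2 * c))
        (𝓝 ((2 * c) ^ 2 * (d - c + 2 * c))) :=
      (Continuous.tendsto (by fun_prop) _).mono_left nhdsWithin_le_nhds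
    have h2c : (2 * c) ^ 2 * (d - c + 2 * c) < 4 * ((d - c) * w) := by
      calc _ = 4 * (c ^ 2 * (c + d)) := by ring
        _ < _ := by linarith
    have hev := hcont.eventually (gt_mem_nhds h2c)
    obtain ⟨s, h1, h2⟩ := (hev.and self_mem_nhdsWithin).exists
    exact ⟨s, h2, h1⟩
  refine ⟨branch (d - c) w s₁ - rhoG c d w, ?_, fun ρ β h hρ hlt' => ?_⟩
  · rw [← branch_two_c hc hd]
    exact sub_pos.2 (branch_lt he hw' (by linarith) hs₁)
  · obtain ⟨s, hs, hb, hreal | ⟨h1, h2, h3⟩⟩ := h.branch_cases hcd hw' hρ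
    · exfalso
      have hss : s₁ < s := by
        by_contra! hle
        have : s ^ 2 * (d - c + s) ≤ s₁ ^ 2 * (d - c + s₁) := by gcongr
        linarith
      have := branch_lt he hw' (by linarith) hss
      linarith
    · subst h3
      exact ⟨h1, h2, hs, hb⟩

/-- The conjugate pair crosses the imaginary axis transversally. As `branch` has positive slope, the
difference quotient of the real part is the inverse of a difference quotient of `branch`. -/
lemma exists_hasDerivAt_re (hc : 0 < c) (hd : 0 < d) (hw : 0 ≤ w)
    (hGF : rhoG c d w < rhoF c d w) {β : ℝ → Fin 3 → ℂ} (hβ : ∀ ρ, ModeRoots c d w ρ (β ρ)) :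
    ∃ σ > 0, HasDerivAt (fun ρ => (β ρ 0).re) σ (rhoG c d w) := by
  obtain ⟨δ, hδ, hpair⟩ := exists_conj_pair hc hd hw hGF
  obtain ⟨hcd, hwc⟩ := lt_of_rhoG_lt_rhoF hc hd hw hGF
  have he : 0 < d - c := sub_pos.2 hcd
  set ρ₀ := rhoG c d w with hρ₀
  have hρ₀pos : 0 < ρ₀ := by rw [hρ₀]; unfold rhoG; positivity
  have hre₀ : (β ρ₀ 0).re = 0 := ((hβ ρ₀).re_eq_zero hc hd hGF rfl).1
  -- the slope of `branch` between `2c` and `s`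
  set K : ℝ → ℝ := fun s => (d - c) * w / ((d - c + s) * (d - c + 2 * c)) + (d - c) + s + 2 * c
    with hK
  have hKpos : ∀ s, 0 ≤ s → d - c ≤ K s := by
    intro s hs
    have : 0 ≤ (d - c) * w / ((d - c + s) * (d - c + 2 * c)) := by positivity
    simp only [hK]; linarith
  have hrel : ∀ᶠ ρ in 𝓝 ρ₀, 0 ≤ 2 * ((β ρ 0).re + c) ∧
      ρ - ρ₀ = 2 * (β ρ 0).re * K (2 * ((β ρ 0).re + c)) := by
    filter_upwards [lt_mem_nhds hρ₀pos, gt_mem_nhds (show ρ₀ < ρ₀ + δ by linarith)] with ρ h1 h2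
    obtain ⟨-, -, hs, hb⟩ := hpair ρ (β ρ) (hβ ρ) h1.le h2
    refine ⟨hs, ?_⟩
    have hsub := branch_sub (e := d - c) (w := w) (s := 2 * ((β ρ 0).re + c)) (t := 2 * c)
      (by linarith) (by linarith)
    rw [← hb, branch_two_c hc hd, ← hρ₀] at hsub
    rw [hsub]
    simp only [hK]; ring
  have hcont : Tendsto (fun ρ => (β ρ 0).re) (𝓝 ρ₀) (𝓝 0) := by
    have hlin : Tendsto (fun ρ => |ρ - ρ₀| / (d - c)) (𝓝 ρ₀) (𝓝 0) := by
      have : Continuous (fun ρ => |ρ - ρ₀| / (d - c)) := by fun_prop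
      simpa using this.tendsto ρ₀
    refine squeeze_zero_norm' ?_ hlin
    filter_upwards [hrel] with ρ ⟨hs, hr⟩
    rw [Real.norm_eq_abs, le_div_iff₀ he, hr, abs_mul, abs_mul, abs_two]
    have h1 := hKpos _ hs
    rw [abs_of_nonneg (a := K _) (by linarith)]
    nlinarith [abs_nonneg (β ρ 0).re, mul_le_mul_of_nonneg_left h1 (abs_nonneg (β ρ 0).re)]
  have hKcont : Tendsto (fun ρ => (2 * K (2 * ((β ρ 0).re + c)))⁻¹) (𝓝 ρ₀)
      (𝓝 (2 * K (2 * (0 + c)))⁻¹) := by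
    have hKat : ContinuousAt (fun u : ℝ => (2 * K (2 * (u + c)))⁻¹) 0 := by
      have h1 : d - c + 2 * (0 + c) ≠ 0 := by positivity
      have h2 : d - c + 2 * c ≠ 0 := by positivity
      have h3 : 2 * K (2 * (0 + c)) ≠ 0 := by
        have := hKpos (2 * (0 + c)) (by positivity)
        intro h; linarith
      simp only [hK] at h3 ⊢
      fun_prop (disch := first | exact h3 | exact mul_ne_zero h1 h2)
    exact hKat.tendsto.comp hcont
  have hK0 := hKpos (2 * (0 + c)) (by positivity)
  refine ⟨(2 * K (2 * (0 + c)))⁻¹, by positivity, ?_⟩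
  rw [hasDerivAt_iff_tendsto_slope]
  refine (hKcont.mono_left nhdsWithin_le_nhds).congr' ?_
  filter_upwards [hrel.filter_mono nhdsWithin_le_nhds, self_mem_nhdsWithin] with ρ ⟨hs, hr⟩ hne
  have h1 := hKpos _ hs
  have h2 : ρ - ρ₀ ≠ 0 := sub_ne_zero.2 hne
  have h3 : K (2 * ((β ρ 0).re + c)) ≠ 0 := by linarith
  have h4 : (β ρ 0).re ≠ 0 := by
    intro h; rw [h] at hr; simp at hr; exact h2 (by linarith)
  rw [slope_def_field, hre₀, hr, sub_zero]
  field_simp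

end

/-! ### Positivity of the mode parameters -/

lemma alphaSq_pos {p : Params} (hL1 : 0 < p.L1) (hL2 : 0 < p.L2) {J : Idx}
    (h : (J.1, J.2.1) ≠ (0, 0)) : 0 < alphaSq p J := by
  unfold alphaSq
  by_cases hj : J.1 = 0
  · have hk : J.2.1 ≠ 0 := fun hk => h (by rw [hj, hk])
    have : (J.2.1 : ℝ) ≠ 0 := Int.cast_ne_zero.2 hk
    positivity
  · have : (J.1 : ℝ) ≠ 0 := Int.cast_ne_zero.2 hj
    positivity

lemma vertSq_nonneg (J : Idx) : 0 ≤ vertSq J := by unfold vertSq; positivity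

lemma vertSq_pos {J : Idx} (h : 1 ≤ J.2.2) : 0 < vertSq J := by
  have : (0 : ℝ) < J.2.2 := by exact_mod_cast h
  unfold vertSq; positivity

lemma magK_nonneg {p : Params} (hQ : 0 ≤ p.Q) (J : Idx) : 0 ≤ magK p J := by
  unfold magK; positivity

/-! ### The modes in normalized form -/

/-- The damping rate of the velocity in the mode `J` (viscosity and magnetic tension). -/
noncomputable def dampV (p : Params) (J : Idx) : ℝ := (rSq p J ^ 2 + magK p J) / rSq p J

/-- The damping rate of the temperature in the mode `J`. -/
noncomputable def dampT (p : Params) (J : Idx) : ℝ := rSq p J / p.Pr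

/-- The contribution of the rotation in the mode `J`. -/
noncomputable def rotW (p : Params) (J : Idx) : ℝ := p.Ta * vertSq J / rSq p J

/-- The factor between the Rayleigh number and the parameter `ρ` of `ModeRoots`. -/
noncomputable def raScale (p : Params) (J : Idx) : ℝ := alphaSq p J / (p.Pr * rSq p J)

section

variable {p : Params} {J : Idx}

lemma rSq_pos (hL1 : 0 < p.L1) (hL2 : 0 < p.L2) (hJ : J ∈ I1) : 0 < rSq p J :=
  add_pos (alphaSq_pos hL1 hL2 hJ.2.1) (vertSq_pos hJ.2.2)

/-- Division by `a₃` brings the characteristic equation into normalized form. -/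
lemma modeRoots_of_isOrderedRoots (hPr : 0 < p.Pr) (hR : 0 < rSq p J)
    {Ra : ℝ} {β : Fin 3 → ℂ} (h : IsOrderedRoots p Ra J β) :
    ModeRoots (dampV p J) (dampT p J) (rotW p J) (Ra * raScale p J) β := by
  obtain ⟨h, h10, h21⟩ := h
  refine ⟨fun z => ?_, h10, h21⟩
  have ha3 : a3 p J ≠ 0 := by unfold a3; positivity
  have e2 : dampT p J + 2 * dampV p J = a2 p J / a3 p J := by
    unfold dampT dampV a2 a3; field_simp
  have e1 : dampV p J ^ 2 + rotW p J + 2 * dampV p J * dampT p J - Ra * raScale p J =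
      a1 p Ra J / a3 p J := by
    unfold dampT dampV rotW raScale a1 a3; field_simp; ring
  have e0 : dampT p J * (dampV p J ^ 2 + rotW p J) - Ra * raScale p J * dampV p J =
      a0 p Ra J / a3 p J := by
    unfold dampT dampV rotW raScale a0 a3; field_simp
  have ha3' : (a3 p J : ℂ) ≠ 0 := Complex.ofReal_ne_zero.2 ha3
  rw [e2, e1, e0]
  apply mul_left_cancel₀ ha3'
  rw [← h]
  push_cast
  field_simp

lemma fRa_mul_raScale (hPr : 0 < p.Pr) (hA : 0 < alphaSq p J) (hR : 0 < rSq p J)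
    (hM : 0 ≤ magK p J) :
    fRa p J * raScale p J = rhoF (dampV p J) (dampT p J) (rotW p J) := by
  unfold fRa raScale rhoF dampT dampV rotW
  field_simp

lemma gRa_mul_raScale (hPr : 0 < p.Pr) (hA : 0 < alphaSq p J) (hR : 0 < rSq p J)
    (hM : 0 ≤ magK p J) :
    gRa p J * raScale p J = rhoG (dampV p J) (dampT p J) (rotW p J) := by
  have h1 : (1 + p.Pr) * rSq p J ^ 2 + p.Pr * magK p J ≠ 0 := by positivity
  have h2 : (rSq p J ^ 2 + magK p J) / rSq p J + rSq p J / p.Pr =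
      ((1 + p.Pr) * rSq p J ^ 2 + p.Pr * magK p J) / (p.Pr * rSq p J) := by
    field_simp; ring
  unfold gRa raScale rhoG dampT dampV rotW
  rw [h2]
  field_simp
  ring

end

/-! ### Existence of the critical Rayleigh numbers -/

section

variable {p : Params}

lemma finite_rSq_le (hL1 : 0 < p.L1) (hL2 : 0 < p.L2) (C : ℝ) :
    {J : Idx | rSq p J ≤ C}.Finite := by
  obtain ⟨N, hN⟩ := exists_nat_ge (C * (p.L1 ^ 2 + p.L2 ^ 2 + 1))
  refine ((Set.finite_Icc (-(N : ℤ)) N).prod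
    ((Set.finite_Icc (-(N : ℤ)) N).prod (Set.finite_Iic N))).subset ?_
  rintro ⟨j, k, l⟩ (hJ : rSq p (j, k, l) ≤ C)
  simp only [rSq, alphaSq, vertSq] at hJ
  have hl0 : 0 ≤ (l : ℝ) ^ 2 * Real.pi ^ 2 := by positivity
  have hj0 : 0 ≤ ((j : ℝ) * (1 / p.L1)) ^ 2 := by positivity
  have hk0 : 0 ≤ ((k : ℝ) * (1 / p.L2)) ^ 2 := by positivity
  have hC : 0 ≤ C := by linarith
  have int_le : ∀ m : ℤ, (m : ℝ) ^ 2 ≤ C * (p.L1 ^ 2 + p.L2 ^ 2 + 1) →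
      m ∈ Set.Icc (-(N : ℤ)) N := by
    intro m hm
    have h1 : m ^ 2 ≤ (N : ℤ) := by exact_mod_cast hm.trans hN
    constructor <;> nlinarith
  refine ⟨int_le j ?_, int_le k ?_, ?_⟩
  · have : ((j : ℝ) * (1 / p.L1)) ^ 2 * p.L1 ^ 2 ≤ C * p.L1 ^ 2 := by gcongr; linarith
    have e : ((j : ℝ) * (1 / p.L1)) ^ 2 * p.L1 ^ 2 = (j : ℝ) ^ 2 := by field_simp
    nlinarith [mul_nonneg hC (sq_nonneg p.L2)]
  · have : ((k : ℝ) * (1 / p.L2)) ^ 2 * p.L2 ^ 2 ≤ C * p.L2 ^ 2 := by gcongr; linarith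
    have e : ((k : ℝ) * (1 / p.L2)) ^ 2 * p.L2 ^ 2 = (k : ℝ) ^ 2 := by field_simp
    nlinarith [mul_nonneg hC (sq_nonneg p.L1)]
  · have hpi : 1 ≤ Real.pi ^ 2 := by nlinarith [Real.pi_gt_three]
    have h1 : (l : ℝ) ^ 2 ≤ N := by
      refine le_trans ?_ hN
      nlinarith [mul_nonneg hC (sq_nonneg p.L1), mul_nonneg hC (sq_nonneg p.L2),
        mul_le_mul_of_nonneg_left hpi (sq_nonneg (l : ℝ))]
    have h2 : l ^ 2 ≤ N := by exact_mod_cast h1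
    exact Set.mem_Iic.2 (by nlinarith)

/-- A function on the modes that dominates `r_J⁴` has a minimum, since only finitely many modes lie
below a given bound. -/
lemma isLeast_sInf_of_rSq_le (hL1 : 0 < p.L1) (hL2 : 0 < p.L2) {h : Idx → ℝ}
    (hh : ∀ J ∈ I1, rSq p J ^ 2 ≤ h J) : IsLeast (h '' I1) (sInf (h '' I1)) := by
  have hJ₀ : ((1, 0, 1) : Idx) ∈ I1 := ⟨by norm_num, by simp, le_rfl⟩
  have hfin : {J : Idx | J ∈ I1 ∧ h J ≤ h (1, 0, 1)}.Finite := by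
    refine (finite_rSq_le hL1 hL2 (h (1, 0, 1) + 1)).subset ?_
    rintro J ⟨hJ, hle⟩
    have := hh J hJ
    change rSq p J ≤ h (1, 0, 1) + 1
    nlinarith [sq_nonneg (rSq p J - 1)]
  obtain ⟨J₁, ⟨hJ₁, -⟩, hmin⟩ := Set.exists_min_image _ h hfin ⟨(1, 0, 1), hJ₀, le_rfl⟩
  have hleast : IsLeast (h '' I1) (h J₁) := by
    refine ⟨⟨J₁, hJ₁, rfl⟩, ?_⟩
    rintro _ ⟨J, hJ, rfl⟩
    rcases le_total (h J) (h (1, 0, 1)) with hle | hle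
    · exact hmin J ⟨hJ, hle⟩
    · exact (hmin _ ⟨hJ₀, le_rfl⟩).trans hle
  rwa [hleast.csInf_eq]

lemma isLeast_Rac1 (hTa : 0 ≤ p.Ta) (hQ : 0 ≤ p.Q) (hL1 : 0 < p.L1) (hL2 : 0 < p.L2) :
    IsLeast (fRa p '' I1) (Rac1 p) := by
  refine isLeast_sInf_of_rSq_le hL1 hL2 fun J hJ => ?_
  have hA := alphaSq_pos hL1 hL2 hJ.2.1
  have hR := rSq_pos hL1 hL2 hJ
  have hM := magK_nonneg hQ J
  have hV := vertSq_nonneg J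
  have hAR : alphaSq p J ≤ rSq p J := by unfold rSq; linarith
  unfold fRa
  rw [le_div_iff₀ (by positivity)]
  calc rSq p J ^ 2 * (alphaSq p J * (rSq p J ^ 2 + magK p J))
      ≤ (rSq p J ^ 2 + magK p J) * (rSq p J * (rSq p J ^ 2 + magK p J)) := by
        gcongr; linarith
    _ = rSq p J * (rSq p J ^ 2 + magK p J) ^ 2 + 0 := by ring
    _ ≤ _ := by gcongr; positivity

lemma isLeast_Rac2 (hPr : 0 < p.Pr) (hTa : 0 ≤ p.Ta) (hQ : 0 ≤ p.Q) (hL1 : 0 < p.L1)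
    (hL2 : 0 < p.L2) : IsLeast (gRa p '' I1) (Rac2 p) := by
  refine isLeast_sInf_of_rSq_le hL1 hL2 fun J hJ => ?_
  have hA := alphaSq_pos hL1 hL2 hJ.2.1
  have hR := rSq_pos hL1 hL2 hJ
  have hM := magK_nonneg hQ J
  have hV := vertSq_nonneg J
  have hAR : alphaSq p J ≤ rSq p J := by unfold rSq; linarith
  unfold gRa
  have h1 : 1 ≤ 2 * (magK p J + rSq p J ^ 2) / (alphaSq p J * rSq p J) := by
    rw [le_div_iff₀ (by positivity)]
    nlinarith
  have h2 : 0 ≤ p.Pr ^ 2 * p.Ta * rSq p J * vertSq J /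
      ((1 + p.Pr) * rSq p J ^ 2 + p.Pr * magK p J) := by positivity
  calc rSq p J ^ 2 = 1 * rSq p J ^ 2 := (one_mul _).symm
    _ ≤ _ := by
      gcongr
      nlinarith [mul_nonneg hPr.le (sq_nonneg (rSq p J)), mul_nonneg hPr.le hM]

end

/-! ### The passive eigenvalues -/

lemma passiveValues_re_neg {p : Params} (hPr : 0 < p.Pr) (hQ : 0 ≤ p.Q)
    (hL1 : 0 < p.L1) (hL2 : 0 < p.L2) {z : ℂ} (hz : z ∈ passiveValues p) : z.re < 0 := by
  rcases hz with ⟨j, k, -, hjk, rfl⟩ | ⟨l, hl, hz⟩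
  · have hA : 0 < alphaSq p (j, k, 0) := alphaSq_pos hL1 hL2 hjk
    have hM := magK_nonneg hQ (j, k, 0)
    rw [Complex.ofReal_re, neg_lt_zero]
    positivity
  · have hl' : (0 : ℝ) < l := by exact_mod_cast hl
    have hpos : 0 < (l : ℝ) ^ 2 * Real.pi ^ 2 := by positivity
    have hcast : (l : ℂ) ^ 2 * (Real.pi : ℂ) ^ 2 = (((l : ℝ) ^ 2 * Real.pi ^ 2 : ℝ) : ℂ) := by
      push_cast; rfl
    rw [hcast] at hz
    rcases hz with rfl | rfl | rfl
    · simp [-Complex.ofReal_mul, -Complex.ofReal_pow, hpos]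
    · simp [-Complex.ofReal_mul, -Complex.ofReal_pow, hpos]
    · rw [← Complex.ofReal_div, ← Complex.ofReal_neg, Complex.ofReal_re, neg_lt_zero]
      positivity

/-! ### Stability of the modes -/

section

variable {p : Params} {J : Idx} {Ra : ℝ} {β : Fin 3 → ℂ}

/-- What the argument needs to know about the mode `J`: positivity, and the normalized form. -/
structure ModeFacts (p : Params) (J : Idx) : Prop where
  c_pos : 0 < dampV p J
  d_pos : 0 < dampT p J
  w_nonneg : 0 ≤ rotW p J
  s_pos : 0 < raScale p J
  f_eq : fRa p J * raScale p J = rhoF (dampV p J) (dampT p J) (rotW p J)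
  g_eq : gRa p J * raScale p J = rhoG (dampV p J) (dampT p J) (rotW p J)

lemma modeFacts (hPr : 0 < p.Pr) (hTa : 0 ≤ p.Ta) (hQ : 0 ≤ p.Q)
    (hL1 : 0 < p.L1) (hL2 : 0 < p.L2) (hJ : J ∈ I1) : ModeFacts p J := by
  have hA := alphaSq_pos hL1 hL2 hJ.2.1
  have hR := rSq_pos hL1 hL2 hJ
  have hM := magK_nonneg hQ J
  have hV := vertSq_nonneg J
  exact ⟨by unfold dampV; positivity, by unfold dampT; positivity, by unfold rotW; positivity,
    by unfold raScale; positivity, fRa_mul_raScale hPr hA hR hM, gRa_mul_raScale hPr hA hR hM⟩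

namespace ModeFacts

lemma lt_rhoF (h : ModeFacts p J) :
    Ra * raScale p J < rhoF (dampV p J) (dampT p J) (rotW p J) ↔ Ra < fRa p J := by
  rw [← h.f_eq]; exact mul_lt_mul_iff_left₀ h.s_pos

lemma rhoF_lt (h : ModeFacts p J) :
    rhoF (dampV p J) (dampT p J) (rotW p J) < Ra * raScale p J ↔ fRa p J < Ra := by
  rw [← h.f_eq]; exact mul_lt_mul_iff_left₀ h.s_pos

lemma lt_rhoG (h : ModeFacts p J) :
    Ra * raScale p J < rhoG (dampV p J) (dampT p J) (rotW p J) ↔ Ra < gRa p J := by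
  rw [← h.g_eq]; exact mul_lt_mul_iff_left₀ h.s_pos

lemma rhoG_lt (h : ModeFacts p J) :
    rhoG (dampV p J) (dampT p J) (rotW p J) < Ra * raScale p J ↔ gRa p J < Ra := by
  rw [← h.g_eq]; exact mul_lt_mul_iff_left₀ h.s_pos

end ModeFacts

/-- Below both thresholds a mode is stable. -/
lemma ModeFacts.re_neg (hm : ModeFacts p J)
    (h : ModeRoots (dampV p J) (dampT p J) (rotW p J) (Ra * raScale p J) β)
    (hf : Ra < fRa p J) (hg : Ra < gRa p J) (s) : (β s).re < 0 :=
  ModeRoots.re_neg h hm.c_pos hm.d_pos (hm.lt_rhoF.2 hf) (hm.lt_rhoG.2 hg) s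

end

/-- If `Rac1 < Rac2`, a simple real eigenvalue crosses the imaginary axis first. -/
lemma stability_real {p : Params} (hPr : 0 < p.Pr) (hTa : 0 ≤ p.Ta) (hQ : 0 ≤ p.Q)
    (hL1 : 0 < p.L1) (hL2 : 0 < p.L2) {β : ℝ → Idx → Fin 3 → ℂ}
    (hβ : ∀ Ra : ℝ, ∀ J ∈ I1, IsOrderedRoots p Ra J (β Ra J)) (hlt : Rac1 p < Rac2 p) :
    (∀ J ∈ critX p,
        (∀ Ra : ℝ, Ra < Rac1 p → (β Ra J 0).re < 0) ∧
        (∃ δ > 0, ∀ Ra : ℝ, Rac1 p - δ < Ra → Ra < Rac1 p → (β Ra J 0).im = 0) ∧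
        β (Rac1 p) J 0 = 0 ∧
        (∀ Ra : ℝ, Rac1 p < Ra → (β Ra J 0).im = 0 ∧ 0 < (β Ra J 0).re)) ∧
      (∀ J ∈ I1, ∀ s : Fin 3, ¬ (J ∈ critX p ∧ s = 0) → (β (Rac1 p) J s).re < 0) := by
  have hf : ∀ J ∈ I1, Rac1 p ≤ fRa p J := fun J hJ =>
    (isLeast_Rac1 hTa hQ hL1 hL2).2 ⟨J, hJ, rfl⟩
  have hg : ∀ J ∈ I1, Rac1 p < gRa p J := fun J hJ =>
    hlt.trans_le ((isLeast_Rac2 hPr hTa hQ hL1 hL2).2 ⟨J, hJ, rfl⟩)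
  have hRac : Rac p = Rac1 p := min_eq_left hlt.le
  have hm : ∀ J ∈ I1, ModeFacts p J := fun J hJ => modeFacts hPr hTa hQ hL1 hL2 hJ
  have hM : ∀ Ra : ℝ, ∀ J ∈ I1,
      ModeRoots (dampV p J) (dampT p J) (rotW p J) (Ra * raScale p J) (β Ra J) :=
    fun Ra J hJ => modeRoots_of_isOrderedRoots hPr (rSq_pos hL1 hL2 hJ) (hβ Ra J hJ)
  have hcrit : ∀ J, J ∈ critX p ↔ J ∈ I1 ∧ fRa p J = Rac1 p := by
    intro J
    refine and_congr_right fun hJ => ?_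
    rw [hRac]
    have h1 := hf J hJ
    have h2 := hg J hJ
    rcases le_total (fRa p J) (gRa p J) with h | h
    · rw [min_eq_left h]
    · rw [min_eq_right h]
      constructor <;> intro h' <;> linarith
  have hzero : ∀ J ∈ I1, fRa p J = Rac1 p →
      β (Rac1 p) J 0 = 0 ∧ (β (Rac1 p) J 1).re < 0 ∧ (β (Rac1 p) J 2).re < 0 := by
    intro J hJ hfJ
    have hmJ := hm J hJ
    exact (hM _ J hJ).zero_root hmJ.c_pos hmJ.d_pos (by rw [← hfJ, hmJ.f_eq])
      (hmJ.lt_rhoG.2 (hg J hJ))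
  refine ⟨fun J hX => ?_, fun J hJ s hs => ?_⟩
  · obtain ⟨hJ, hfJ⟩ := (hcrit J).1 hX
    have hmJ := hm J hJ
    refine ⟨fun Ra hRa => ModeFacts.re_neg hmJ (hM Ra J hJ) (hfJ ▸ hRa)
      (hRa.trans (hg J hJ)) 0, ?_, (hzero J hJ hfJ).1, fun Ra hRa => ?_⟩
    · obtain ⟨δ, hδ, h⟩ := exists_real_below_rhoF (w := rotW p J) hmJ.c_pos hmJ.d_pos (by
        rw [← hmJ.f_eq]; exact hmJ.lt_rhoG.2 (hfJ ▸ hg J hJ))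
      refine ⟨δ / raScale p J, div_pos hδ hmJ.s_pos, fun Ra h1 h2 => h _ _ (hM Ra J hJ) ?_ ?_⟩
      · rw [← hmJ.f_eq, hfJ]
        have := mul_lt_mul_of_pos_right h1 hmJ.s_pos
        rwa [sub_mul, div_mul_cancel₀ _ hmJ.s_pos.ne'] at this
      · exact hmJ.lt_rhoF.2 (hfJ ▸ h2)
    · exact (hM Ra J hJ).pos_real hmJ.c_pos hmJ.d_pos (hmJ.rhoF_lt.2 (hfJ ▸ hRa))
  · have hmJ := hm J hJ
    by_cases hX : J ∈ critX p
    · have hz := hzero J hJ ((hcrit J).1 hX).2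
      fin_cases s
      · exact absurd ⟨hX, rfl⟩ hs
      · exact hz.2.1
      · exact hz.2.2
    · refine ModeFacts.re_neg hmJ (hM _ J hJ) ?_ (hg J hJ) s
      exact (hf J hJ).lt_of_ne fun h => hX ((hcrit J).2 ⟨hJ, h.symm⟩)

/-- If `Rac2 < Rac1`, nonreal conjugate pairs cross the imaginary axis first. -/
lemma stability_complex {p : Params} (hPr : 0 < p.Pr) (hTa : 0 ≤ p.Ta) (hQ : 0 ≤ p.Q)
    (hL1 : 0 < p.L1) (hL2 : 0 < p.L2) {β : ℝ → Idx → Fin 3 → ℂ}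
    (hβ : ∀ Ra : ℝ, ∀ J ∈ I1, IsOrderedRoots p Ra J (β Ra J)) (hlt : Rac2 p < Rac1 p) :
    (∀ J ∈ critX p,
        (∃ δ > 0, ∀ Ra : ℝ, 0 ≤ Ra → Ra < Rac2 p + δ →
          β Ra J 1 = (starRingEnd ℂ) (β Ra J 0) ∧ (β Ra J 0).im ≠ 0) ∧
        (∀ Ra : ℝ, Ra < Rac2 p → (β Ra J 0).re < 0 ∧ (β Ra J 1).re < 0) ∧
        ((β (Rac2 p) J 0).re = 0 ∧ (β (Rac2 p) J 1).re = 0) ∧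
        (∀ Ra : ℝ, Rac2 p < Ra → 0 < (β Ra J 0).re) ∧
        (∀ Ra : ℝ, Rac2 p < Ra → Ra < Rac1 p → 0 < (β Ra J 1).re) ∧
        (∃ σ' > 0, HasDerivAt (fun Ra : ℝ => (β Ra J 0).re) σ' (Rac2 p))) ∧
      (∀ J ∈ I1, ∀ s : Fin 3, ¬ (J ∈ critX p ∧ (s = 0 ∨ s = 1)) →
        (β (Rac2 p) J s).re < 0) := by
  have hf : ∀ J ∈ I1, Rac1 p ≤ fRa p J := fun J hJ =>
    (isLeast_Rac1 hTa hQ hL1 hL2).2 ⟨J, hJ, rfl⟩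
  have hg : ∀ J ∈ I1, Rac2 p ≤ gRa p J := fun J hJ =>
    (isLeast_Rac2 hPr hTa hQ hL1 hL2).2 ⟨J, hJ, rfl⟩
  have hRac : Rac p = Rac2 p := min_eq_right hlt.le
  have hm : ∀ J ∈ I1, ModeFacts p J := fun J hJ => modeFacts hPr hTa hQ hL1 hL2 hJ
  have hM : ∀ Ra : ℝ, ∀ J ∈ I1,
      ModeRoots (dampV p J) (dampT p J) (rotW p J) (Ra * raScale p J) (β Ra J) :=
    fun Ra J hJ => modeRoots_of_isOrderedRoots hPr (rSq_pos hL1 hL2 hJ) (hβ Ra J hJ)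
  have hcrit : ∀ J, J ∈ critX p ↔ J ∈ I1 ∧ gRa p J = Rac2 p := by
    intro J
    refine and_congr_right fun hJ => ?_
    rw [hRac]
    have h1 := hf J hJ
    have h2 := hg J hJ
    rcases le_total (fRa p J) (gRa p J) with h | h
    · rw [min_eq_left h]
      constructor <;> intro h' <;> linarith
    · rw [min_eq_right h]
  have hzero : ∀ J ∈ I1, gRa p J = Rac2 p →
      (β (Rac2 p) J 0).re = 0 ∧ (β (Rac2 p) J 1).re = 0 ∧ (β (Rac2 p) J 2).re < 0 := by
    intro J hJ hgJ
    have hmJ := hm J hJ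
    exact (hM _ J hJ).re_eq_zero hmJ.c_pos hmJ.d_pos (hmJ.lt_rhoF.2 (hlt.trans_le (hf J hJ)))
      (by rw [← hgJ, hmJ.g_eq])
  refine ⟨fun J hX => ?_, fun J hJ s hs => ?_⟩
  · obtain ⟨hJ, hgJ⟩ := (hcrit J).1 hX
    have hmJ := hm J hJ
    have hs := hmJ.s_pos
    have hGF : rhoG (dampV p J) (dampT p J) (rotW p J) <
        rhoF (dampV p J) (dampT p J) (rotW p J) := by
      rw [← hmJ.g_eq]; exact hmJ.lt_rhoF.2 (hgJ ▸ hlt.trans_le (hf J hJ))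
    have hneg : ∀ Ra : ℝ, Ra < Rac2 p → ∀ s, (β Ra J s).re < 0 := fun Ra hRa s =>
      ModeFacts.re_neg hmJ (hM Ra J hJ) ((hRa.trans hlt).trans_le (hf J hJ)) (hgJ ▸ hRa) s
    refine ⟨?_, fun Ra hRa => ⟨hneg Ra hRa 0, hneg Ra hRa 1⟩,
      ⟨(hzero J hJ hgJ).1, (hzero J hJ hgJ).2.1⟩, fun Ra hRa => ?_, fun Ra hRa hRa' => ?_, ?_⟩
    · obtain ⟨δ, hδ, h⟩ := exists_conj_pair hmJ.c_pos hmJ.d_pos hmJ.w_nonneg hGF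
      refine ⟨δ / raScale p J, div_pos hδ hs, fun Ra h0 h2 => ?_⟩
      obtain ⟨h3, h4, -⟩ := h _ _ (hM Ra J hJ) (mul_nonneg h0 hs.le) (by
        rw [← hmJ.g_eq, hgJ]
        have := mul_lt_mul_of_pos_right h2 hs
        rwa [add_mul, div_mul_cancel₀ _ hs.ne'] at this)
      exact ⟨h3, h4⟩
    · exact (hM Ra J hJ).re_pos hmJ.c_pos hmJ.d_pos (hmJ.rhoG_lt.2 (hgJ ▸ hRa))
    · exact (hM Ra J hJ).re_one_pos hmJ.c_pos hmJ.d_pos (hmJ.lt_rhoF.2 (hRa'.trans_le (hf J hJ)))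
        (hmJ.rhoG_lt.2 (hgJ ▸ hRa))
    · obtain ⟨σ, hσ, hder⟩ := exists_hasDerivAt_re (β := fun ρ => β (ρ / raScale p J) J)
        hmJ.c_pos hmJ.d_pos hmJ.w_nonneg hGF (fun ρ => by
          have := hM (ρ / raScale p J) J hJ
          rwa [div_mul_cancel₀ _ hs.ne'] at this)
      refine ⟨σ * raScale p J, mul_pos hσ hs, ?_⟩
      rw [← hmJ.g_eq, hgJ] at hder
      have hlin : HasDerivAt (fun Ra : ℝ => Ra * raScale p J) (raScale p J) (Rac2 p) := by
        simpa using (hasDerivAt_id (Rac2 p)).mul_const (raScale p J)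
      have := hder.comp (Rac2 p) hlin
      refine this.congr_of_eventuallyEq (Eventually.of_forall fun Ra => ?_)
      simp [hs.ne']
  · have hmJ := hm J hJ
    by_cases hX : J ∈ critX p
    · have hz := hzero J hJ ((hcrit J).1 hX).2
      fin_cases s
      · exact absurd ⟨hX, Or.inl rfl⟩ hs
      · exact absurd ⟨hX, Or.inr rfl⟩ hs
      · exact hz.2.2
    · refine ModeFacts.re_neg hmJ (hM _ J hJ) (hlt.trans_le (hf J hJ)) ?_ s
      exact (hg J hJ).lt_of_ne fun h => hX ((hcrit J).2 ⟨hJ, h.symm⟩)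

/-! ### Integration by parts on the period cell -/

section

variable {p : Params}

/-- The upper corner of the period cell. -/
noncomputable def corner (p : Params) : Pt := ![2 * Real.pi * p.L1, 2 * Real.pi * p.L2, 1]

lemma cell_eq_pi (p : Params) :
    cell p = Set.pi Set.univ fun i => Set.Ioo ((0 : Pt) i) (corner p i) := by
  ext x
  simp [cell, corner, Fin.forall_fin_succ]

lemma corner_nonneg (hL1 : 0 < p.L1) (hL2 : 0 < p.L2) : 0 ≤ corner p := by
  intro i
  have := Real.pi_pos
  fin_cases i <;> simp [corner] <;> positivity

lemma isOpen_cell (p : Params) : IsOpen (cell p) := by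
  rw [cell_eq_pi]
  exact isOpen_set_pi Set.finite_univ fun _ _ => isOpen_Ioo

lemma cell_subset_Icc (p : Params) : cell p ⊆ Set.Icc 0 (corner p) := by
  rw [cell_eq_pi]
  exact fun x hx => ⟨fun i => (hx i trivial).1.le, fun i => (hx i trivial).2.le⟩

lemma cellVol_eq (p : Params) : cellVol p = volume.restrict (Set.Icc 0 (corner p)) := by
  unfold cellVol
  rw [cell_eq_pi]
  exact Measure.restrict_congr_set (Measure.univ_pi_Ioo_ae_eq_Icc)

instance (p : Params) : IsFiniteMeasure (cellVol p) := by
  rw [cellVol_eq]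
  exact ⟨by simpa using isCompact_Icc.measure_lt_top⟩

lemma memLp_of_continuous {f : Pt → ℂ} (hf : Continuous f) (q : ENNReal) :
    MemLp f q (cellVol p) := by
  obtain ⟨C, hC⟩ := (isCompact_Icc (a := (0 : Pt)) (b := corner p)).exists_bound_of_continuousOn
    hf.continuousOn
  refine MemLp.of_bound hf.aestronglyMeasurable C ?_
  rw [cellVol_eq]
  filter_upwards [ae_restrict_mem measurableSet_Icc] with x hx using hC x hx

lemma integrable_of_continuous {f : Pt → ℂ} (hf : Continuous f) : Integrable f (cellVol p) :=
  memLp_one_iff_integrable.1 (memLp_of_continuous hf 1)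

lemma contDiff_partialD {f : Pt → ℂ} (hf : ContDiff ℝ ∞ f) (i : Fin 3) :
    ContDiff ℝ ∞ (partialD i f) :=
  (hf.fderiv_right (m := ∞) (by simp)).clm_apply contDiff_const

lemma hPeriodic_partialD {f : Pt → ℂ} (hf : HPeriodic p f) (i : Fin 3) :
    HPeriodic p (partialD i f) := by
  intro m n x
  have h : f = fun x => f (x + ![2 * m * p.L1 * Real.pi, 2 * n * p.L2 * Real.pi, 0]) :=
    funext fun x => (hf m n x).symm
  unfold partialD
  conv_rhs => rw [h]
  rw [fderiv_comp_add_right]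

/-- The integral of a derivative over the cell vanishes if the boundary terms cancel (horizontal
directions) or vanish (vertical direction). -/
lemma integral_partialD_eq_zero (hL1 : 0 < p.L1) (hL2 : 0 < p.L2) {F : Pt → ℂ}
    (hF : ContDiff ℝ ∞ F) (hper : HPeriodic p F) (i : Fin 3)
    (hwall : i = 2 → ∀ x : Pt, x 2 = 0 ∨ x 2 = 1 → F x = 0) :
    ∫ x, partialD i F x ∂(cellVol p) = 0 := by
  have hdiff : Differentiable ℝ F := hF.differentiable (by simp)
  have key := integral_divergence_of_hasFDerivAt_off_countable' (0 : Pt) (corner p)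
    (corner_nonneg hL1 hL2) (fun j => if j = i then F else 0)
    (fun j => if j = i then fderiv ℝ F else 0) ∅ Set.countable_empty
    (fun j => by
      split_ifs
      · exact hF.continuous.continuousOn
      · exact continuousOn_const)
    (fun x _ j => by
      split_ifs
      · exact (hdiff x).hasFDerivAt
      · exact hasFDerivAt_const 0 x)
    (by
      refine ContinuousOn.integrableOn_compact isCompact_Icc (Continuous.continuousOn ?_)
      refine continuous_finsetSum _ fun j _ => ?_
      split_ifs
      · exact (contDiff_partialD hF j).continuous
      · exact continuous_const)
  have hlhs : ∀ x : Pt, ∑ j, (if j = i then fderiv ℝ F else 0) x (Pi.single j 1) =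
      partialD i F x := by
    intro x
    rw [Finset.sum_eq_single i]
    · simp [partialD]
    · intro j _ hj; simp [hj]
    · simp
  rw [cellVol_eq, ← integral_congr_ae (Eventually.of_forall hlhs), key]
  refine Finset.sum_eq_zero fun j _ => ?_
  by_cases hj : j = i
  · subst hj
    simp only [if_true]
    rw [sub_eq_zero]
    congr 1
    ext y
    rw [Pi.zero_apply]
    fin_cases j
    · have := hper 1 0 ((0 : Fin 3).insertNth (0 : ℝ) y)
      simp only [Fin.zero_eta]
      rw [← this]
      congr 1
      ext j
      fin_cases j <;> simp [corner]
      · ring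
      · rfl
    · have := hper 0 1 ((1 : Fin 3).insertNth (0 : ℝ) y)
      simp only [Fin.mk_one]
      rw [← this]
      congr 1
      ext j
      fin_cases j <;> simp [corner, Fin.insertNth, Fin.succAboveCases]
      ring
    · rw [hwall rfl _ (Or.inr (by simp [corner])), hwall rfl _ (Or.inl (by simp))]
  · simp [hj]

lemma HPeriodic.mul {f g : Pt → ℂ} (hf : HPeriodic p f) (hg : HPeriodic p g) :
    HPeriodic p (fun x => f x * g x) := fun m n x => by
  simp only [hf m n x, hg m n x]

lemma partialD_mul {f g : Pt → ℂ} (hf : ContDiff ℝ ∞ f) (hg : ContDiff ℝ ∞ g) (i : Fin 3) (x : Pt) :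
    partialD i (fun x => f x * g x) x = f x * partialD i g x + partialD i f x * g x := by
  unfold partialD
  rw [fderiv_fun_mul (hf.differentiable (by simp) x) (hg.differentiable (by simp) x)]
  simp [mul_comm]

lemma integral_mul_partialD (hL1 : 0 < p.L1) (hL2 : 0 < p.L2) {f φ : Pt → ℂ}
    (hf : IsTest p f) (hφ : IsTest p φ) (i : Fin 3)
    (hwall : i = 2 → ∀ x : Pt, x 2 = 0 ∨ x 2 = 1 → f x * φ x = 0) :
    ∫ x, f x * partialD i φ x ∂(cellVol p) = -∫ x, partialD i f x * φ x ∂(cellVol p) := by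
  have h := integral_partialD_eq_zero hL1 hL2 (hf.1.mul hφ.1) (hf.2.mul hφ.2) i hwall
  rw [integral_congr_ae (Eventually.of_forall (partialD_mul hf.1 hφ.1 i)), integral_add] at h
  · exact eq_neg_of_add_eq_zero_left h
  · exact integrable_of_continuous (hf.1.continuous.mul (contDiff_partialD hφ.1 i).continuous)
  · exact integrable_of_continuous ((contDiff_partialD hf.1 i).continuous.mul hφ.1.continuous)

lemma IsTest.partialD {f : Pt → ℂ} (hf : IsTest p f) (i : Fin 3) : IsTest p (partialD i f) :=
  ⟨contDiff_partialD hf.1 i, hPeriodic_partialD hf.2 i⟩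

/-- A smooth periodic function as an element of `H²`, with its classical derivatives. -/
noncomputable def H2Fun.ofSmooth (hL1 : 0 < p.L1) (hL2 : 0 < p.L2) (f : Pt → ℂ)
    (hf : IsTest p f) : H2Fun p where
  toFun := f
  grad i := RMC.partialD i f
  periodic := hf.2
  memLp := memLp_of_continuous hf.1.continuous 2
  grad_memLp i := memLp_of_continuous (hf.partialD i).1.continuous 2
  grad_weak i φ hφ hw := integral_mul_partialD hL1 hL2 hf hφ i
    fun hi x hx => by rw [hw hi x hx, mul_zero]
  hess i j := RMC.partialD i (RMC.partialD j f)
  hess_memLp i j := memLp_of_continuous ((hf.partialD j).partialD i).1.continuous 2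
  hess_weak i j φ hφ hw := integral_mul_partialD hL1 hL2 (hf.partialD j) hφ i
    fun hi x hx => by rw [hw hi x hx, mul_zero]

lemma H2Fun.ofSmooth_dirichlet (hL1 : 0 < p.L1) (hL2 : 0 < p.L2) {f : Pt → ℂ} (hf : IsTest p f)
    (h : ∀ x : Pt, x 2 = 0 ∨ x 2 = 1 → f x = 0) : (H2Fun.ofSmooth hL1 hL2 f hf).Dirichlet :=
  fun _ hφ => integral_mul_partialD hL1 hL2 hf hφ 2 fun _ x hx => by rw [h x hx, zero_mul]

lemma H2Fun.ofSmooth_neumann (hL1 : 0 < p.L1) (hL2 : 0 < p.L2) {f : Pt → ℂ} (hf : IsTest p f)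
    (h : ∀ x : Pt, x 2 = 0 ∨ x 2 = 1 → RMC.partialD 2 f x = 0) :
    (H2Fun.ofSmooth hL1 hL2 f hf).Neumann :=
  fun _ hφ => integral_mul_partialD hL1 hL2 (hf.partialD 2) hφ 2
    fun _ x hx => by rw [h x hx, zero_mul]

end

/-! ### Functions with separated variables -/

/-- The product of a horizontal plane wave profile `H (κ₁ x₁ + κ₂ x₂)` and a vertical profile
`V (x₃)`. -/
def sep (κ₁ κ₂ : ℝ) (H V : ℝ → ℂ) : Pt → ℂ := fun x => H (κ₁ * x 0 + κ₂ * x 1) * V (x 2)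

section

variable {κ₁ κ₂ : ℝ} {H V : ℝ → ℂ}

lemma contDiff_sep (hH : ContDiff ℝ ∞ H) (hV : ContDiff ℝ ∞ V) :
    ContDiff ℝ ∞ (sep κ₁ κ₂ H V) := by
  unfold sep
  fun_prop

lemma hPeriodic_sep {p : Params} (h1 : p.L1 ≠ 0) (h2 : p.L2 ≠ 0)
    (hH : Function.Periodic H (2 * Real.pi)) (j k : ℤ) :
    HPeriodic p (sep (j * (1 / p.L1)) (k * (1 / p.L2)) H V) := by
  intro m n x
  have hshift : (j * (1 / p.L1)) * (x 0 + 2 * m * p.L1 * Real.pi) +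
      (k * (1 / p.L2)) * (x 1 + 2 * n * p.L2 * Real.pi) =
      (j * (1 / p.L1)) * x 0 + (k * (1 / p.L2)) * x 1 + (j * m + k * n : ℤ) * (2 * Real.pi) := by
    push_cast; field_simp; ring
  simp only [sep, Pi.add_apply, Matrix.cons_val_zero, Matrix.cons_val_one, Matrix.cons_val]
  rw [hshift, hH.int_mul, add_zero]

lemma partialD_eq_of_hasDerivAt {f : Pt → ℂ} {x : Pt} {i : Fin 3} {d : ℂ}
    (hf : DifferentiableAt ℝ f x)
    (h : HasDerivAt (fun t : ℝ => f (x + t • (Pi.single i 1 : Pt))) d 0) : partialD i f x = d := by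
  have h' : HasLineDerivAt ℝ f d x (Pi.single i 1) := h
  rw [partialD, ← hf.lineDeriv_eq_fderiv, h'.lineDeriv]

lemma partialD_sep_zero {H' : ℝ → ℂ} (hH : ∀ t, HasDerivAt H (H' t) t)
    (hV : Differentiable ℝ V) :
    partialD 0 (sep κ₁ κ₂ H V) = fun x => κ₁ * sep κ₁ κ₂ H' V x := by
  have hH1 : Differentiable ℝ H := fun t => (hH t).differentiableAt
  ext x
  refine partialD_eq_of_hasDerivAt (by unfold sep; fun_prop) ?_
  have hin : HasDerivAt (fun t : ℝ => κ₁ * (x 0 + t) + κ₂ * x 1) κ₁ 0 := by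
    simpa using (((hasDerivAt_id (0 : ℝ)).const_add (x 0)).const_mul κ₁).add_const (κ₂ * x 1)
  have h1 := HasDerivAt.scomp (0 : ℝ) (h := fun t : ℝ => κ₁ * (x 0 + t) + κ₂ * x 1)
    (by simpa using hH (κ₁ * (x 0 + 0) + κ₂ * x 1)) hin
  have h2 := h1.mul_const (V (x 2))
  have e : (fun t : ℝ => sep κ₁ κ₂ H V (x + t • (Pi.single 0 1 : Pt))) =
      fun t => H (κ₁ * (x 0 + t) + κ₂ * x 1) * V (x 2) := by
    ext t; simp [sep]
  rw [e]
  exact h2.congr_deriv (by simp [sep, mul_assoc])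

lemma partialD_sep_one {H' : ℝ → ℂ} (hH : ∀ t, HasDerivAt H (H' t) t)
    (hV : Differentiable ℝ V) :
    partialD 1 (sep κ₁ κ₂ H V) = fun x => κ₂ * sep κ₁ κ₂ H' V x := by
  have hH1 : Differentiable ℝ H := fun t => (hH t).differentiableAt
  ext x
  refine partialD_eq_of_hasDerivAt (by unfold sep; fun_prop) ?_
  have hin : HasDerivAt (fun t : ℝ => κ₁ * x 0 + κ₂ * (x 1 + t)) κ₂ 0 := by
    simpa using (((hasDerivAt_id (0 : ℝ)).const_add (x 1)).const_mul κ₂).const_add (κ₁ * x 0)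
  have h1 := HasDerivAt.scomp (0 : ℝ) (h := fun t : ℝ => κ₁ * x 0 + κ₂ * (x 1 + t))
    (by simpa using hH (κ₁ * x 0 + κ₂ * (x 1 + 0))) hin
  have h2 := h1.mul_const (V (x 2))
  have e : (fun t : ℝ => sep κ₁ κ₂ H V (x + t • (Pi.single 1 1 : Pt))) =
      fun t => H (κ₁ * x 0 + κ₂ * (x 1 + t)) * V (x 2) := by
    ext t; simp [sep]
  rw [e]
  exact h2.congr_deriv (by simp [sep, mul_assoc])

lemma partialD_sep_two {V' : ℝ → ℂ} (hH : Differentiable ℝ H)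
    (hV : ∀ t, HasDerivAt V (V' t) t) :
    partialD 2 (sep κ₁ κ₂ H V) = fun x => sep κ₁ κ₂ H V' x := by
  have hV1 : Differentiable ℝ V := fun t => (hV t).differentiableAt
  ext x
  refine partialD_eq_of_hasDerivAt (by unfold sep; fun_prop) ?_
  have hin : HasDerivAt (fun t : ℝ => x 2 + t) 1 0 := by
    simpa using (hasDerivAt_id (0 : ℝ)).const_add (x 2)
  have h1 := HasDerivAt.scomp (0 : ℝ) (h := fun t : ℝ => x 2 + t)
    (by simpa using hV (x 2 + 0)) hin
  have h2 := h1.const_mul (H (κ₁ * x 0 + κ₂ * x 1))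
  have e : (fun t : ℝ => sep κ₁ κ₂ H V (x + t • (Pi.single 2 1 : Pt))) =
      fun t => H (κ₁ * x 0 + κ₂ * x 1) * V (x 2 + t) := by
    ext t; simp [sep]
  rw [e]
  exact h2.congr_deriv (by simp [sep])

end

/-! ### Trigonometric profiles -/

/-- `cos (ν t)` as a complex-valued function of a real variable. -/
noncomputable def cosP (ν : ℝ) : ℝ → ℂ := fun t => (Real.cos (ν * t) : ℂ)

/-- `sin (ν t)` as a complex-valued function of a real variable. -/
noncomputable def sinP (ν : ℝ) : ℝ → ℂ := fun t => (Real.sin (ν * t) : ℂ)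

/-- `exp (i t)` as a function of a real variable. -/
noncomputable def expP : ℝ → ℂ := fun t => Complex.exp (t * Complex.I)

lemma contDiff_cosP (ν : ℝ) : ContDiff ℝ ∞ (cosP ν) :=
  Complex.ofRealCLM.contDiff.comp (Real.contDiff_cos.comp (contDiff_const.mul contDiff_id))

lemma contDiff_sinP (ν : ℝ) : ContDiff ℝ ∞ (sinP ν) :=
  Complex.ofRealCLM.contDiff.comp (Real.contDiff_sin.comp (contDiff_const.mul contDiff_id))

lemma contDiff_expP : ContDiff ℝ ∞ expP :=
  (Complex.ofRealCLM.contDiff.mul contDiff_const).cexp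

lemma hasDerivAt_cosP (ν t : ℝ) : HasDerivAt (cosP ν) (-(ν * sinP ν t)) t := by
  have h := (((hasDerivAt_id t).const_mul ν).cos).ofReal_comp
  exact h.congr_deriv (by simp [sinP, mul_comm])

lemma hasDerivAt_sinP (ν t : ℝ) : HasDerivAt (sinP ν) (ν * cosP ν t) t := by
  have h := (((hasDerivAt_id t).const_mul ν).sin).ofReal_comp
  exact h.congr_deriv (by simp [cosP, mul_comm])

lemma hasDerivAt_expP (t : ℝ) : HasDerivAt expP (Complex.I * expP t) t := by
  have h := (((hasDerivAt_id t).ofReal_comp).mul_const Complex.I).cexp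
  exact h.congr_deriv (by simp [expP, mul_comm])

lemma periodic_cosP : Function.Periodic (cosP 1) (2 * Real.pi) := fun t => by
  simp [cosP]

lemma periodic_sinP : Function.Periodic (sinP 1) (2 * Real.pi) := fun t => by
  simp [sinP]

lemma periodic_expP : Function.Periodic expP (2 * Real.pi) := fun t => by
  unfold expP
  push_cast
  rw [add_mul]
  exact Complex.exp_periodic _

/-! ### The linear system of a single mode -/

/-- The matrix of the system satisfied by the amplitudes `(u₁, u₂, u₃, π, θ)` of a mode with
horizontal wave numbers `κ₁, κ₂` and vertical wave number `ν`. Here `r = κ₁² + κ₂² + ν²`, `g` is the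
damping rate of the velocity, and `b` the eigenvalue; the rows are the three momentum equations,
incompressibility, and the heat equation. -/
def modeMatrix (P T Ra κ₁ κ₂ ν g r b : ℂ) : Matrix (Fin 5) (Fin 5) ℂ :=
  !![-g - b, T, 0, κ₁, 0;
     -T, -g - b, 0, κ₂, 0;
     0, 0, -g - b, ν, Ra;
     κ₁, κ₂, ν, 0, 0;
     0, 0, 1, 0, -r - P * b]

lemma det_modeMatrix (P T Ra κ₁ κ₂ ν g r b : ℂ) :
    (modeMatrix P T Ra κ₁ κ₂ ν g r b).det =
      (P * b + r) * ((b + g) ^ 2 * (κ₁ ^ 2 + κ₂ ^ 2 + ν ^ 2) + T ^ 2 * ν ^ 2) -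
        Ra * (κ₁ ^ 2 + κ₂ ^ 2) * (b + g) := by
  simp [modeMatrix, Matrix.det_succ_row_zero, Fin.sum_univ_succ, Fin.succAbove]
  ring

lemma modeMatrix_mulVec_eq_zero_iff (P T Ra κ₁ κ₂ ν g r b : ℂ) (v : Fin 5 → ℂ) :
    (modeMatrix P T Ra κ₁ κ₂ ν g r b).mulVec v = 0 ↔
      (-g - b) * v 0 + T * v 1 + κ₁ * v 3 = 0 ∧ -T * v 0 + (-g - b) * v 1 + κ₂ * v 3 = 0 ∧
      (-g - b) * v 2 + ν * v 3 + Ra * v 4 = 0 ∧ κ₁ * v 0 + κ₂ * v 1 + ν * v 2 = 0 ∧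
      v 2 + (-r - P * b) * v 4 = 0 := by
  rw [funext_iff]
  simp [Fin.forall_fin_succ, modeMatrix, Matrix.mulVec, dotProduct, Fin.sum_univ_succ, add_assoc]

/-- The horizontal wave numbers `j α₁`, `k α₂` of a mode. -/
noncomputable def wave (p : Params) (J : Idx) : Fin 2 → ℝ :=
  ![J.1 * (1 / p.L1), J.2.1 * (1 / p.L2)]

/-- The system matrix of the mode `J`. -/
noncomputable def matrixOf (p : Params) (Ra : ℝ) (J : Idx) (b : ℂ) : Matrix (Fin 5) (Fin 5) ℂ :=
  modeMatrix p.Pr (√p.Ta : ℝ) Ra (wave p J 0) (wave p J 1) (J.2.2 * Real.pi : ℝ) (dampV p J : ℝ)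
    (rSq p J : ℝ) b

lemma alphaSq_eq_wave (p : Params) (J : Idx) :
    alphaSq p J = wave p J 0 ^ 2 + wave p J 1 ^ 2 := rfl

lemma magK_eq_wave (p : Params) (J : Idx) : magK p J = p.Q * wave p J 1 ^ 2 := by
  simp [magK, wave]; ring

lemma vertSq_eq (J : Idx) : vertSq J = (J.2.2 * Real.pi) ^ 2 := by unfold vertSq; ring

lemma rSq_eq_wave (p : Params) (J : Idx) :
    rSq p J = wave p J 0 ^ 2 + wave p J 1 ^ 2 + (J.2.2 * Real.pi) ^ 2 := by
  rw [rSq, alphaSq_eq_wave, vertSq_eq]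

/-- The characteristic polynomial of the mode `J` is, up to the factor `r_J²`, the determinant of
its system matrix. -/
lemma charPoly_eq_det {p : Params} (hTa : 0 ≤ p.Ta) {J : Idx} (hR : rSq p J ≠ 0) (Ra : ℝ) (z : ℂ) :
    (a3 p J : ℂ) * z ^ 3 + (a2 p J : ℂ) * z ^ 2 + (a1 p Ra J : ℂ) * z + (a0 p Ra J : ℂ) =
      rSq p J * (matrixOf p Ra J z).det := by
  have hA : ((wave p J 0 : ℝ) : ℂ) ^ 2 + ((wave p J 1 : ℝ) : ℂ) ^ 2 = (alphaSq p J : ℂ) := by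
    rw [alphaSq_eq_wave]; push_cast; rfl
  have hV : ((J.2.2 * Real.pi : ℝ) : ℂ) ^ 2 = (vertSq J : ℂ) := by
    rw [vertSq_eq]; push_cast; rfl
  have hT : ((√p.Ta : ℝ) : ℂ) ^ 2 = (p.Ta : ℂ) := by
    rw [← Complex.ofReal_pow, Real.sq_sqrt hTa]
  have hr : (alphaSq p J : ℂ) + (vertSq J : ℂ) = (rSq p J : ℂ) := by
    rw [rSq]; push_cast; rfl
  have hR' : (rSq p J : ℂ) ≠ 0 := Complex.ofReal_ne_zero.2 hR
  rw [matrixOf, det_modeMatrix, hA, hV, hT, hr]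
  unfold a3 a2 a1 a0 dampV
  push_cast
  field_simp
  ring

/-! ### The modes are eigenfunctions -/

section

variable {p : Params}

lemma differentiable_cosP (ν : ℝ) : Differentiable ℝ (cosP ν) :=
  (contDiff_cosP ν).differentiable (by simp)

lemma differentiable_sinP (ν : ℝ) : Differentiable ℝ (sinP ν) :=
  (contDiff_sinP ν).differentiable (by simp)

lemma partialD_const_mul (i : Fin 3) (a : ℂ) (f : Pt → ℂ) :
    partialD i (fun x => a * f x) = fun x => a * partialD i f x := by
  ext x
  simp only [partialD, ← smul_eq_mul]
  rw [show (fun x => a • f x) = a • f from rfl, fderiv_const_smul_field]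
  simp

variable (κ₁ κ₂ ν : ℝ)

lemma partialD_zero_cos {V : ℝ → ℂ} (hV : Differentiable ℝ V) :
    partialD 0 (sep κ₁ κ₂ (cosP 1) V) = fun x => -κ₁ * sep κ₁ κ₂ (sinP 1) V x := by
  rw [partialD_sep_zero (hasDerivAt_cosP 1) hV]
  ext x; simp [sep]

lemma partialD_zero_sin {V : ℝ → ℂ} (hV : Differentiable ℝ V) :
    partialD 0 (sep κ₁ κ₂ (sinP 1) V) = fun x => κ₁ * sep κ₁ κ₂ (cosP 1) V x := by
  rw [partialD_sep_zero (hasDerivAt_sinP 1) hV]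
  ext x; simp [sep]

lemma partialD_one_cos {V : ℝ → ℂ} (hV : Differentiable ℝ V) :
    partialD 1 (sep κ₁ κ₂ (cosP 1) V) = fun x => -κ₂ * sep κ₁ κ₂ (sinP 1) V x := by
  rw [partialD_sep_one (hasDerivAt_cosP 1) hV]
  ext x; simp [sep]

lemma partialD_one_sin {V : ℝ → ℂ} (hV : Differentiable ℝ V) :
    partialD 1 (sep κ₁ κ₂ (sinP 1) V) = fun x => κ₂ * sep κ₁ κ₂ (cosP 1) V x := by
  rw [partialD_sep_one (hasDerivAt_sinP 1) hV]
  ext x; simp [sep]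

lemma partialD_two_cos {H : ℝ → ℂ} (hH : Differentiable ℝ H) :
    partialD 2 (sep κ₁ κ₂ H (cosP ν)) = fun x => -ν * sep κ₁ κ₂ H (sinP ν) x := by
  rw [partialD_sep_two hH (hasDerivAt_cosP ν)]
  ext x; simp [sep]; ring

lemma partialD_two_sin {H : ℝ → ℂ} (hH : Differentiable ℝ H) :
    partialD 2 (sep κ₁ κ₂ H (sinP ν)) = fun x => ν * sep κ₁ κ₂ H (cosP ν) x := by
  rw [partialD_sep_two hH (hasDerivAt_sinP ν)]
  ext x; simp [sep]; ring

variable {κ₁ κ₂ ν}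

/-- `H` is one of the functions `cos (ν t)`, `sin (ν t)`. -/
def IsTrig (ν : ℝ) (H : ℝ → ℂ) : Prop := H = cosP ν ∨ H = sinP ν

lemma isTrig_cos (ν : ℝ) : IsTrig ν (cosP ν) := Or.inl rfl

lemma isTrig_sin (ν : ℝ) : IsTrig ν (sinP ν) := Or.inr rfl

lemma IsTrig.contDiff {H : ℝ → ℂ} (h : IsTrig ν H) : ContDiff ℝ ∞ H := by
  rcases h with rfl | rfl
  exacts [contDiff_cosP ν, contDiff_sinP ν]

lemma IsTrig.periodic {H : ℝ → ℂ} (h : IsTrig 1 H) : Function.Periodic H (2 * Real.pi) := by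
  rcases h with rfl | rfl
  exacts [periodic_cosP, periodic_sinP]

lemma isTest_mode (hL1 : 0 < p.L1) (hL2 : 0 < p.L2) (J : Idx) (a : ℂ) {H V : ℝ → ℂ}
    (hH : IsTrig 1 H) (hV : IsTrig ν V) :
    IsTest p (fun x => a * sep (wave p J 0) (wave p J 1) H V x) := by
  refine ⟨contDiff_const.mul (contDiff_sep hH.contDiff hV.contDiff), fun m n x => ?_⟩
  have := hPeriodic_sep (V := V) hL1.ne' hL2.ne' hH.periodic J.1 J.2.1 m n x
  exact congrArg (a * ·) this

/-- The field `a H(κ · x) V(x₃)` as an element of `H²`. -/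
noncomputable def modeFun (hL1 : 0 < p.L1) (hL2 : 0 < p.L2) (J : Idx) (a : ℂ) {H V : ℝ → ℂ}
    (hH : IsTrig 1 H) (hV : IsTrig ν V) : H2Fun p :=
  H2Fun.ofSmooth hL1 hL2 _ (isTest_mode hL1 hL2 J a hH hV)

lemma lap_modeFun (hL1 : 0 < p.L1) (hL2 : 0 < p.L2) (J : Idx) (a : ℂ) {H V : ℝ → ℂ}
    (hH : IsTrig 1 H) (hV : IsTrig ν V) (x : Pt) :
    (modeFun hL1 hL2 J a hH hV).lap x =
      -((wave p J 0 ^ 2 + wave p J 1 ^ 2 + ν ^ 2 : ℝ) : ℂ) *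
        (a * sep (wave p J 0) (wave p J 1) H V x) := by
  have hHd : Differentiable ℝ H := hH.contDiff.differentiable (by simp)
  have hVd : Differentiable ℝ V := hV.contDiff.differentiable (by simp)
  have h0 : partialD 0 (partialD 0 (sep (wave p J 0) (wave p J 1) H V)) x =
      -(wave p J 0 ^ 2 * sep (wave p J 0) (wave p J 1) H V x) := by
    rcases hH with rfl | rfl
    · rw [partialD_zero_cos _ _ hVd, partialD_const_mul, partialD_zero_sin _ _ hVd]; ring
    · rw [partialD_zero_sin _ _ hVd, partialD_const_mul, partialD_zero_cos _ _ hVd]; ring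
  have h1 : partialD 1 (partialD 1 (sep (wave p J 0) (wave p J 1) H V)) x =
      -(wave p J 1 ^ 2 * sep (wave p J 0) (wave p J 1) H V x) := by
    rcases hH with rfl | rfl
    · rw [partialD_one_cos _ _ hVd, partialD_const_mul, partialD_one_sin _ _ hVd]; ring
    · rw [partialD_one_sin _ _ hVd, partialD_const_mul, partialD_one_cos _ _ hVd]; ring
  have h2 : partialD 2 (partialD 2 (sep (wave p J 0) (wave p J 1) H V)) x =
      -(ν ^ 2 * sep (wave p J 0) (wave p J 1) H V x) := by
    rcases hV with rfl | rfl
    · rw [partialD_two_cos _ _ _ hHd, partialD_const_mul, partialD_two_sin _ _ _ hHd]; ring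
    · rw [partialD_two_sin _ _ _ hHd, partialD_const_mul, partialD_two_cos _ _ _ hHd]; ring
  simp only [H2Fun.lap, modeFun, H2Fun.ofSmooth, Fin.sum_univ_three, partialD_const_mul, h0, h1, h2]
  push_cast
  ring

lemma sinP_wall (l : ℕ) {t : ℝ} (ht : t = 0 ∨ t = 1) : sinP (l * Real.pi) t = 0 := by
  rcases ht with rfl | rfl
  · simp [sinP]
  · rw [sinP, mul_one, Real.sin_nat_mul_pi, Complex.ofReal_zero]

lemma modeFun_dirichlet (hL1 : 0 < p.L1) (hL2 : 0 < p.L2) (J : Idx) (a : ℂ) {H : ℝ → ℂ}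
    (hH : IsTrig 1 H) (l : ℕ) :
    (modeFun hL1 hL2 J a hH (isTrig_sin (l * Real.pi))).Dirichlet :=
  H2Fun.ofSmooth_dirichlet hL1 hL2 _ fun x hx => by simp [sep, sinP_wall l hx]

lemma modeFun_neumann (hL1 : 0 < p.L1) (hL2 : 0 < p.L2) (J : Idx) (a : ℂ) {H : ℝ → ℂ}
    (hH : IsTrig 1 H) (l : ℕ) :
    (modeFun hL1 hL2 J a hH (isTrig_cos (l * Real.pi))).Neumann :=
  H2Fun.ofSmooth_neumann hL1 hL2 _ fun x hx => by
    rw [partialD_const_mul, partialD_two_cos _ _ _ (hH.contDiff.differentiable (by simp))]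
    simp [sep, sinP_wall l hx]

/-- Some point of the cell is no zero of any of the trigonometric factors of the mode `J`. -/
lemma exists_mem_cell_trig_ne_zero (hL1 : 0 < p.L1) (hL2 : 0 < p.L2) {J : Idx} (hJ : J ∈ I1) :
    ∃ x ∈ cell p, ∀ H V : ℝ → ℂ, IsTrig 1 H → IsTrig (J.2.2 * Real.pi) V →
      sep (wave p J 0) (wave p J 1) H V x ≠ 0 := by
  obtain ⟨j, k, l⟩ := J
  obtain ⟨-, hjk, hl⟩ := hJ
  simp only at hjk hl
  have hl0 : (1 : ℝ) ≤ l := by exact_mod_cast hl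
  have hpi := Real.pi_gt_three
  -- one of the directions `(1, 1)`, `(1, 2)` is not orthogonal to `(j, k)`
  obtain ⟨c, hc1, hc2, hc⟩ : ∃ c : ℝ, 1 ≤ c ∧ c ≤ 2 ∧ (j : ℝ) + k * c ≠ 0 := by
    by_cases h : (j : ℝ) + k * 1 = 0
    · refine ⟨2, by norm_num, le_rfl, fun h2 => hjk ?_⟩
      have hk : (k : ℝ) = 0 := by linarith
      have hj : (j : ℝ) = 0 := by linarith
      rw [Int.cast_eq_zero.1 hk, Int.cast_eq_zero.1 hj]
    · exact ⟨1, le_rfl, by norm_num, h⟩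
  set ε : ℝ := 1 / (|(j : ℝ) + k * c| + 1) with hε
  have hden : 0 < |(j : ℝ) + k * c| + 1 := by positivity
  have hε0 : 0 < ε := by positivity
  have hε1 : ε ≤ 1 := by
    rw [hε, div_le_one hden]; linarith [abs_nonneg ((j : ℝ) + k * c)]
  have hξ : |((j : ℝ) + k * c) * ε| < 1 := by
    rw [abs_mul, abs_of_pos hε0, hε, mul_one_div, div_lt_one hden]; linarith
  set ξ : ℝ := ((j : ℝ) + k * c) * ε with hξdef
  have hξ0 : ξ ≠ 0 := mul_ne_zero hc hε0.ne'
  obtain ⟨hξ1, hξ2⟩ := abs_lt.1 hξ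
  have hcos : Real.cos ξ ≠ 0 := (Real.cos_pos_of_mem_Ioo ⟨by linarith, by linarith⟩).ne'
  have hsin : Real.sin ξ ≠ 0 := fun h =>
    hξ0 ((Real.sin_eq_zero_iff_of_lt_of_lt (by linarith) (by linarith)).1 h)
  have hvert : (l : ℝ) * Real.pi * (1 / (3 * l)) = Real.pi / 3 := by field_simp
  refine ⟨![ε * p.L1, c * ε * p.L2, 1 / (3 * l)], ⟨⟨?_, ?_⟩, ⟨?_, ?_⟩, ⟨?_, ?_⟩⟩, ?_⟩
  · simp only [Matrix.cons_val_zero]; positivity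
  · simp only [Matrix.cons_val_zero]; gcongr; linarith
  · simp only [Matrix.cons_val_one, Matrix.cons_val_zero]; positivity
  · simp only [Matrix.cons_val_one, Matrix.cons_val_zero]
    refine mul_lt_mul_of_pos_right ?_ hL2
    nlinarith
  · simp only [Matrix.cons_val]; positivity
  · simp only [Matrix.cons_val]; rw [div_lt_one (by positivity)]; linarith
  · intro H V hH hV
    have harg : wave p (j, k, l) 0 * (ε * p.L1) + wave p (j, k, l) 1 * (c * ε * p.L2) = ξ := by
      simp only [wave, Matrix.cons_val_zero, Matrix.cons_val_one, hξdef]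
      field_simp
    simp only [sep, Matrix.cons_val_zero, Matrix.cons_val_one, Matrix.cons_val, harg]
    refine mul_ne_zero ?_ ?_
    · rcases hH with rfl | rfl
      · rw [cosP, one_mul]; exact Complex.ofReal_ne_zero.2 hcos
      · rw [sinP, one_mul]; exact Complex.ofReal_ne_zero.2 hsin
    · rcases hV with rfl | rfl
      · rw [cosP, hvert, Real.cos_pi_div_three]; norm_num
      · rw [sinP, hvert, Real.sin_pi_div_three]; norm_num

lemma eq_zero_of_modeFun_ae_eq_zero (hL1 : 0 < p.L1) (hL2 : 0 < p.L2) {J : Idx} (hJ : J ∈ I1)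
    {a : ℂ} {H V : ℝ → ℂ} (hH : IsTrig 1 H) (hV : IsTrig (J.2.2 * Real.pi) V)
    (h : (modeFun hL1 hL2 J a hH hV).toFun =ᵐ[cellVol p] 0) : a = 0 := by
  obtain ⟨x, hx, hne⟩ := exists_mem_cell_trig_ne_zero hL1 hL2 hJ
  have heq := Measure.eqOn_open_of_ae_eq (μ := volume) h (isOpen_cell p)
    (isTest_mode hL1 hL2 J a hH hV).1.continuous.continuousOn continuousOn_const
  exact (mul_eq_zero.1 (heq hx)).resolve_right (hne H V hH hV)

lemma modeFun_grad_zero_cos (hL1 : 0 < p.L1) (hL2 : 0 < p.L2) (J : Idx) (a : ℂ) {V : ℝ → ℂ}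
    (hV : IsTrig ν V) (x : Pt) :
    (modeFun hL1 hL2 J a (isTrig_cos 1) hV).grad 0 x =
      a * (-wave p J 0 * sep (wave p J 0) (wave p J 1) (sinP 1) V x) := by
  change partialD 0 (fun x => a * sep _ _ _ _ x) x = _
  rw [partialD_const_mul, partialD_zero_cos _ _ (hV.contDiff.differentiable (by simp))]

lemma modeFun_grad_zero_sin (hL1 : 0 < p.L1) (hL2 : 0 < p.L2) (J : Idx) (a : ℂ) {V : ℝ → ℂ}
    (hV : IsTrig ν V) (x : Pt) :
    (modeFun hL1 hL2 J a (isTrig_sin 1) hV).grad 0 x =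
      a * (wave p J 0 * sep (wave p J 0) (wave p J 1) (cosP 1) V x) := by
  change partialD 0 (fun x => a * sep _ _ _ _ x) x = _
  rw [partialD_const_mul, partialD_zero_sin _ _ (hV.contDiff.differentiable (by simp))]

lemma modeFun_grad_one_cos (hL1 : 0 < p.L1) (hL2 : 0 < p.L2) (J : Idx) (a : ℂ) {V : ℝ → ℂ}
    (hV : IsTrig ν V) (x : Pt) :
    (modeFun hL1 hL2 J a (isTrig_cos 1) hV).grad 1 x =
      a * (-wave p J 1 * sep (wave p J 0) (wave p J 1) (sinP 1) V x) := by
  change partialD 1 (fun x => a * sep _ _ _ _ x) x = _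
  rw [partialD_const_mul, partialD_one_cos _ _ (hV.contDiff.differentiable (by simp))]

lemma modeFun_grad_one_sin (hL1 : 0 < p.L1) (hL2 : 0 < p.L2) (J : Idx) (a : ℂ) {V : ℝ → ℂ}
    (hV : IsTrig ν V) (x : Pt) :
    (modeFun hL1 hL2 J a (isTrig_sin 1) hV).grad 1 x =
      a * (wave p J 1 * sep (wave p J 0) (wave p J 1) (cosP 1) V x) := by
  change partialD 1 (fun x => a * sep _ _ _ _ x) x = _
  rw [partialD_const_mul, partialD_one_sin _ _ (hV.contDiff.differentiable (by simp))]

lemma modeFun_grad_two_cos (hL1 : 0 < p.L1) (hL2 : 0 < p.L2) (J : Idx) (a : ℂ) {H : ℝ → ℂ}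
    (hH : IsTrig 1 H) (x : Pt) :
    (modeFun hL1 hL2 J a hH (isTrig_cos ν)).grad 2 x =
      a * (-ν * sep (wave p J 0) (wave p J 1) H (sinP ν) x) := by
  change partialD 2 (fun x => a * sep _ _ _ _ x) x = _
  rw [partialD_const_mul, partialD_two_cos _ _ _ (hH.contDiff.differentiable (by simp))]

lemma modeFun_grad_two_sin (hL1 : 0 < p.L1) (hL2 : 0 < p.L2) (J : Idx) (a : ℂ) {H : ℝ → ℂ}
    (hH : IsTrig 1 H) (x : Pt) :
    (modeFun hL1 hL2 J a hH (isTrig_sin ν)).grad 2 x =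
      a * (ν * sep (wave p J 0) (wave p J 1) H (cosP ν) x) := by
  change partialD 2 (fun x => a * sep _ _ _ _ x) x = _
  rw [partialD_const_mul, partialD_two_sin _ _ _ (hH.contDiff.differentiable (by simp))]

lemma sep_cos_hreflect (V : ℝ → ℂ) (x : Pt) :
    sep κ₁ κ₂ (cosP 1) V (hreflect x) = sep κ₁ κ₂ (cosP 1) V x := by
  have h : κ₁ * -x 0 + κ₂ * -x 1 = -(κ₁ * x 0 + κ₂ * x 1) := by ring
  simp only [sep, hreflect, cosP, Matrix.cons_val_zero, Matrix.cons_val_one, Matrix.cons_val, h,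
    one_mul, Real.cos_neg]

lemma sep_sin_hreflect (V : ℝ → ℂ) (x : Pt) :
    sep κ₁ κ₂ (sinP 1) V (hreflect x) = -sep κ₁ κ₂ (sinP 1) V x := by
  have h : κ₁ * -x 0 + κ₂ * -x 1 = -(κ₁ * x 0 + κ₂ * x 1) := by ring
  simp only [sep, hreflect, sinP, Matrix.cons_val_zero, Matrix.cons_val_one, Matrix.cons_val, h,
    one_mul, Real.sin_neg, Complex.ofReal_neg, neg_mul]

lemma modeFun_toFun (hL1 : 0 < p.L1) (hL2 : 0 < p.L2) (J : Idx) (a : ℂ) {H V : ℝ → ℂ}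
    (hH : IsTrig 1 H) (hV : IsTrig ν V) (x : Pt) :
    (modeFun hL1 hL2 J a hH hV).toFun x = a * sep (wave p J 0) (wave p J 1) H V x := rfl

/-- The velocity with amplitudes `a 0, a 1, a 2` and the horizontal dependence
`sin, sin, cos` in the mode `J`. -/
noncomputable def modeVelocity (hL1 : 0 < p.L1) (hL2 : 0 < p.L2) (J : Idx) (a : Fin 5 → ℂ) :
    Fin 3 → H2Fun p :=
  ![modeFun hL1 hL2 J (a 0) (isTrig_sin 1)
      (isTrig_cos (J.2.2 * Real.pi)),
    modeFun hL1 hL2 J (a 1) (isTrig_sin 1)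
      (isTrig_cos (J.2.2 * Real.pi)),
    modeFun hL1 hL2 J (a 2) (isTrig_cos 1)
      (isTrig_sin (J.2.2 * Real.pi))]

/-- The magnetic field induced by `modeVelocity`: the solution of `Δb = -∂₂u`. -/
noncomputable def modeField (hL1 : 0 < p.L1) (hL2 : 0 < p.L2) (J : Idx) (a : Fin 5 → ℂ) :
    Fin 3 → H2Fun p :=
  ![modeFun hL1 hL2 J (wave p J 1 * a 0 / rSq p J) (isTrig_cos 1)
      (isTrig_cos (J.2.2 * Real.pi)),
    modeFun hL1 hL2 J (wave p J 1 * a 1 / rSq p J) (isTrig_cos 1)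
      (isTrig_cos (J.2.2 * Real.pi)),
    modeFun hL1 hL2 J (-(wave p J 1 * a 2 / rSq p J)) (isTrig_sin 1)
      (isTrig_sin (J.2.2 * Real.pi))]

/-- Every root of the characteristic equation of a mode is an eigenvalue: a kernel vector of the
system matrix consists of the amplitudes of an eigenfunction. -/
lemma isEigenvalue_of_det_eq_zero (hPr : 0 < p.Pr) (hL1 : 0 < p.L1) (hL2 : 0 < p.L2)
    {J : Idx} (hJ : J ∈ I1) {Ra : ℝ} {b : ℂ} (hdet : (matrixOf p Ra J b).det = 0) :
    IsEigenvalue p Ra b := by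
  obtain ⟨a, ha, hMa⟩ := Matrix.exists_mulVec_eq_zero_iff.2 hdet
  rw [matrixOf, modeMatrix_mulVec_eq_zero_iff] at hMa
  obtain ⟨e0, e1, e2, ediv, eθ⟩ := hMa
  have hR := rSq_pos hL1 hL2 hJ
  have hR' : (rSq p J : ℂ) ≠ 0 := Complex.ofReal_ne_zero.2 hR.ne'
  have hPr' : (p.Pr : ℂ) ≠ 0 := Complex.ofReal_ne_zero.2 hPr.ne'
  have hdamp : ((dampV p J : ℝ) : ℂ) = rSq p J + p.Q * (wave p J 1 : ℂ) ^ 2 / rSq p J := by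
    rw [dampV, magK_eq_wave]; push_cast; field_simp
  have hlapR := rSq_eq_wave p J
  refine ⟨⟨modeVelocity hL1 hL2 J a,
    modeFun hL1 hL2 J (a 4) (isTrig_cos 1)
      (isTrig_sin (J.2.2 * Real.pi)), ?_, ?_, ?_,
      ?_, ?_, ?_, ?_⟩, ?_, modeField hL1 hL2 J a,
    (modeFun hL1 hL2 J (a 3) (isTrig_cos 1)
      (isTrig_cos (J.2.2 * Real.pi))).toH1Fun, ?_, ?_, ?_, ?_, ?_⟩
  · refine Eventually.of_forall fun x => ?_
    simp only [Fin.sum_univ_three, modeVelocity, Matrix.cons_val_zero, Matrix.cons_val_one,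
      Matrix.cons_val, modeFun_grad_zero_sin, modeFun_grad_one_sin, modeFun_grad_two_sin]
    linear_combination sep (wave p J 0) (wave p J 1) (cosP 1) (cosP (J.2.2 * Real.pi)) x * ediv
  · exact ⟨modeFun_neumann hL1 hL2 J _ (isTrig_sin 1) _, modeFun_neumann hL1 hL2 J _ (isTrig_sin 1) _,
      modeFun_dirichlet hL1 hL2 J _ (isTrig_cos 1) _⟩
  · exact modeFun_dirichlet hL1 hL2 J _ (isTrig_cos 1) _
  · intro x
    simp only [modeVelocity, Matrix.cons_val_zero, modeFun_toFun, sep_sin_hreflect]; ring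
  · intro x
    simp only [modeVelocity, Matrix.cons_val_one, Matrix.cons_val_zero, modeFun_toFun,
      sep_sin_hreflect]; ring
  · intro x
    simp only [modeVelocity, Matrix.cons_val, modeFun_toFun, sep_cos_hreflect]
  · intro x
    simp only [modeFun_toFun, sep_cos_hreflect]
  · rintro ⟨hu, hθ⟩
    -- if velocity and temperature vanish, so does the pressure, since the wave vector does not
    have h0 : a 0 = 0 := eq_zero_of_modeFun_ae_eq_zero hL1 hL2 hJ (isTrig_sin 1) (isTrig_cos _) (hu 0)
    have h1 : a 1 = 0 := eq_zero_of_modeFun_ae_eq_zero hL1 hL2 hJ (isTrig_sin 1) (isTrig_cos _) (hu 1)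
    have h2 : a 2 = 0 := eq_zero_of_modeFun_ae_eq_zero hL1 hL2 hJ (isTrig_cos 1) (isTrig_sin _) (hu 2)
    have h4 : a 4 = 0 := eq_zero_of_modeFun_ae_eq_zero hL1 hL2 hJ (isTrig_cos 1) (isTrig_sin _) hθ
    have h3 : a 3 = 0 := by
      rw [h2, h4] at e2
      have hν : ((J.2.2 * Real.pi : ℝ) : ℂ) ≠ 0 := by
        have : (0 : ℝ) < J.2.2 := by exact_mod_cast hJ.2.2
        exact Complex.ofReal_ne_zero.2 (by positivity)
      rw [mul_zero, mul_zero, zero_add, add_zero] at e2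
      exact (mul_eq_zero.1 e2).resolve_left hν
    apply ha
    ext i
    fin_cases i <;> assumption
  · exact ⟨modeFun_neumann hL1 hL2 J _ (isTrig_cos 1) _, modeFun_neumann hL1 hL2 J _ (isTrig_cos 1) _,
      modeFun_dirichlet hL1 hL2 J _ (isTrig_sin 1) _⟩
  · refine Eventually.of_forall fun x => ?_
    simp only [Fin.sum_univ_three, modeField, Matrix.cons_val_zero, Matrix.cons_val_one,
      Matrix.cons_val, modeFun_grad_zero_cos, modeFun_grad_one_cos, modeFun_grad_two_sin]
    linear_combination -(wave p J 1 / rSq p J *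
      sep (wave p J 0) (wave p J 1) (sinP 1) (cosP (J.2.2 * Real.pi)) x) * ediv
  · intro i
    refine Eventually.of_forall fun x => ?_
    fin_cases i
    · simp only [modeField, modeVelocity, Fin.zero_eta, Matrix.cons_val_zero, lap_modeFun, ← hlapR,
        modeFun_grad_one_sin]
      field_simp
    · simp only [modeField, modeVelocity, Fin.mk_one, Matrix.cons_val_one, Matrix.cons_val_zero,
        lap_modeFun, ← hlapR, modeFun_grad_one_sin]
      field_simp
    · simp only [modeField, modeVelocity, Fin.reduceFinMk, Matrix.cons_val, lap_modeFun, ← hlapR,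
        modeFun_grad_one_cos]
      field_simp
  · intro i
    refine Eventually.of_forall fun x => ?_
    fin_cases i
    · simp only [modeField, modeVelocity, Fin.zero_eta, Matrix.cons_val_zero, lap_modeFun, ← hlapR,
        modeFun_grad_one_cos, modeFun_grad_zero_cos, thetaE3, crossE3, Matrix.cons_val_one,
        modeFun_toFun]
      rw [hdamp] at e0
      linear_combination
        sep (wave p J 0) (wave p J 1) (sinP 1) (cosP (J.2.2 * Real.pi)) x * e0
    · simp only [modeField, modeVelocity, Fin.mk_one, Matrix.cons_val_zero, lap_modeFun, ← hlapR,
        modeFun_grad_one_cos, thetaE3, crossE3, Matrix.cons_val_one,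
        modeFun_toFun]
      rw [hdamp] at e1
      linear_combination
        sep (wave p J 0) (wave p J 1) (sinP 1) (cosP (J.2.2 * Real.pi)) x * e1
    · simp only [modeField, modeVelocity, Fin.reduceFinMk, Matrix.cons_val, lap_modeFun, ← hlapR,
        modeFun_grad_one_sin, modeFun_grad_two_cos, thetaE3, crossE3, modeFun_toFun]
      rw [hdamp] at e2
      linear_combination
        sep (wave p J 0) (wave p J 1) (cosP 1) (sinP (J.2.2 * Real.pi)) x * e2
  · refine Eventually.of_forall fun x => ?_
    simp only [modeVelocity, Matrix.cons_val, lap_modeFun, ← hlapR, modeFun_toFun]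
    field_simp
    linear_combination
      sep (wave p J 0) (wave p J 1) (cosP 1) (sinP (J.2.2 * Real.pi)) x * eθ

end

/-! ### Completeness of the trigonometric functions -/

/-- The function `exp (i (m x₁ / L₁ + n x₂ / L₂)) cos (l π x₃)`. -/
noncomputable def trigCos (p : Params) (m n l : ℤ) : Pt → ℂ :=
  sep (m * (1 / p.L1)) (n * (1 / p.L2)) expP (cosP (l * Real.pi))

/-- The function `exp (i (m x₁ / L₁ + n x₂ / L₂)) sin (l π x₃)`. -/
noncomputable def trigSin (p : Params) (m n l : ℤ) : Pt → ℂ :=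
  sep (m * (1 / p.L1)) (n * (1 / p.L2)) expP (sinP (l * Real.pi))

section

variable {p : Params}

lemma isTest_trigCos (hL1 : 0 < p.L1) (hL2 : 0 < p.L2) (m n l : ℤ) : IsTest p (trigCos p m n l) :=
  ⟨contDiff_sep contDiff_expP (contDiff_cosP _), hPeriodic_sep hL1.ne' hL2.ne' periodic_expP m n⟩

lemma isTest_trigSin (hL1 : 0 < p.L1) (hL2 : 0 < p.L2) (m n l : ℤ) : IsTest p (trigSin p m n l) :=
  ⟨contDiff_sep contDiff_expP (contDiff_sinP _), hPeriodic_sep hL1.ne' hL2.ne' periodic_expP m n⟩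

lemma continuous_trigCos (p : Params) (m n l : ℤ) : Continuous (trigCos p m n l) :=
  (contDiff_sep contDiff_expP (contDiff_cosP _)).continuous

lemma expP_add (s t : ℝ) : expP (s + t) = expP s * expP t := by
  simp only [expP]
  rw [← Complex.exp_add]
  push_cast
  ring_nf

lemma trigCos_mul (p : Params) (a b c m n l : ℤ) (x : Pt) :
    trigCos p a b c x * trigCos p m n l x =
      (1 / 2) * trigCos p (a + m) (b + n) (l + c) x +
        (1 / 2) * trigCos p (a + m) (b + n) (l - c) x := by
  have harg : ((a + m : ℤ) : ℝ) * (1 / p.L1) * x 0 + ((b + n : ℤ) : ℝ) * (1 / p.L2) * x 1 =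
      (a * (1 / p.L1) * x 0 + b * (1 / p.L2) * x 1) +
        (m * (1 / p.L1) * x 0 + n * (1 / p.L2) * x 1) := by
    push_cast; ring
  have h1 : ((l + c : ℤ) : ℝ) * Real.pi * x 2 = l * Real.pi * x 2 + c * Real.pi * x 2 := by
    push_cast; ring
  have h2 : ((l - c : ℤ) : ℝ) * Real.pi * x 2 = l * Real.pi * x 2 - c * Real.pi * x 2 := by
    push_cast; ring
  simp only [trigCos, sep, cosP, harg, h1, h2, expP_add, Real.cos_add, Real.cos_sub]
  push_cast
  ring

lemma sinP_mul_trigCos (p : Params) (m n l : ℤ) (x : Pt) :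
    sinP Real.pi (x 2) * trigCos p m n l x =
      (1 / 2) * trigSin p m n (l + 1) x - (1 / 2) * trigSin p m n (l - 1) x := by
  have h1 : ((l + 1 : ℤ) : ℝ) * Real.pi * x 2 = l * Real.pi * x 2 + Real.pi * x 2 := by
    push_cast; ring
  have h2 : ((l - 1 : ℤ) : ℝ) * Real.pi * x 2 = l * Real.pi * x 2 - Real.pi * x 2 := by
    push_cast; ring
  simp only [trigCos, trigSin, sep, cosP, sinP, h1, h2, Real.sin_add, Real.sin_sub]
  push_cast
  ring

/-- All Fourier coefficients of `f` with respect to the functions `trigCos` vanish. -/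
def FourierZero (p : Params) (f : Pt → ℂ) : Prop :=
  Integrable f (cellVol p) ∧ ∀ m n l : ℤ, ∫ x, f x * trigCos p m n l x ∂(cellVol p) = 0

lemma ae_mem_cell (p : Params) : ∀ᵐ x ∂(cellVol p), x ∈ cell p :=
  ae_restrict_mem (isOpen_cell p).measurableSet

lemma integrable_mul_continuous {f g : Pt → ℂ} (hf : Integrable f (cellVol p))
    (hg : Continuous g) : Integrable (fun x => f x * g x) (cellVol p) := by
  obtain ⟨C, hC⟩ := (isCompact_Icc (a := (0 : Pt)) (b := corner p)).exists_bound_of_continuousOn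
    hg.continuousOn
  refine hf.mul_bdd (c := C) hg.aestronglyMeasurable ?_
  filter_upwards [ae_mem_cell p] with x hx using hC x (cell_subset_Icc p hx)

namespace FourierZero

lemma congr {f g : Pt → ℂ} (hf : FourierZero p f) (h : ∀ x ∈ cell p, f x = g x) :
    FourierZero p g := by
  have hae : f =ᵐ[cellVol p] g := by filter_upwards [ae_mem_cell p] with x hx using h x hx
  refine ⟨hf.1.congr hae, fun m n l => ?_⟩
  rw [← hf.2 m n l]
  refine integral_congr_ae ?_
  filter_upwards [hae] with x hx
  rw [hx]

lemma add {f g : Pt → ℂ} (hf : FourierZero p f) (hg : FourierZero p g) :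
    FourierZero p (fun x => f x + g x) := by
  refine ⟨hf.1.add hg.1, fun m n l => ?_⟩
  simp only [add_mul]
  rw [integral_add (integrable_mul_continuous hf.1 (continuous_trigCos ..))
    (integrable_mul_continuous hg.1 (continuous_trigCos ..)), hf.2, hg.2, add_zero]

lemma mul_const {f : Pt → ℂ} (hf : FourierZero p f) (a : ℂ) :
    FourierZero p (fun x => f x * a) := by
  refine ⟨hf.1.mul_const a, fun m n l => ?_⟩
  have h : ∀ x, f x * a * trigCos p m n l x = a * (f x * trigCos p m n l x) := fun x => by ring
  simp only [h]
  rw [integral_const_mul, hf.2, mul_zero]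

lemma mul_trigCos {f : Pt → ℂ} (hf : FourierZero p f) (a b c : ℤ) :
    FourierZero p (fun x => f x * trigCos p a b c x) := by
  refine ⟨integrable_mul_continuous hf.1 (continuous_trigCos ..), fun m n l => ?_⟩
  have h : ∀ x, f x * trigCos p a b c x * trigCos p m n l x =
      (1 / 2) * (f x * trigCos p (a + m) (b + n) (l + c) x) +
        (1 / 2) * (f x * trigCos p (a + m) (b + n) (l - c) x) := fun x => by
    rw [mul_assoc, trigCos_mul]; ring
  simp only [h]
  rw [integral_add, integral_const_mul, integral_const_mul, hf.2, hf.2, mul_zero, add_zero]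
  · exact (integrable_mul_continuous hf.1 (continuous_trigCos ..)).const_mul _
  · exact (integrable_mul_continuous hf.1 (continuous_trigCos ..)).const_mul _

end FourierZero

/-- The map to `ℂ³` which, on the closed cell, identifies exactly the points that the functions
`trigCos` do not separate. -/
noncomputable def wrap (p : Params) (x : Pt) : Fin 3 → ℂ :=
  ![trigCos p 1 0 0 x, trigCos p 0 1 0 x, trigCos p 0 0 1 x]

lemma wrap_zero (x : Pt) : wrap p x 0 = expP (1 / p.L1 * x 0) := by
  simp [wrap, trigCos, sep, cosP]

lemma wrap_one (x : Pt) : wrap p x 1 = expP (1 / p.L2 * x 1) := by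
  simp [wrap, trigCos, sep, cosP]

lemma wrap_two (x : Pt) : wrap p x 2 = (Real.cos (Real.pi * x 2) : ℂ) := by
  simp [wrap, trigCos, sep, cosP, expP]

lemma continuous_wrap (p : Params) : Continuous (wrap p) := by
  refine continuous_pi fun i => ?_
  fin_cases i <;> exact continuous_trigCos ..

lemma expP_injOn {s t : ℝ} (hs : s ∈ Set.Ioo 0 (2 * Real.pi)) (ht : t ∈ Set.Icc 0 (2 * Real.pi))
    (h : expP s = expP t) : s = t := by
  obtain ⟨n, hn⟩ := Complex.exp_eq_exp_iff_exists_int.1 h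
  have h1 : s = t + n * (2 * Real.pi) := by
    have h2 := congrArg Complex.im hn
    simpa using h2
  have hpi := Real.pi_pos
  have hlt : n < 1 := by
    by_contra! hcon
    have : (1 : ℝ) ≤ n := by exact_mod_cast hcon
    nlinarith [hs.2, ht.1]
  have hgt : -1 < n := by
    by_contra! hcon
    have : (n : ℝ) ≤ -1 := by exact_mod_cast hcon
    nlinarith [hs.1, ht.2]
  have : n = 0 := by omega
  rw [h1, this]; simp

/-- `wrap` identifies a point of the open cell with no other point of the closed cell. -/
lemma wrap_injOn (hL1 : 0 < p.L1) (hL2 : 0 < p.L2) {x y : Pt} (hx : x ∈ cell p)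
    (hy : y ∈ Set.Icc 0 (corner p)) (h : wrap p x = wrap p y) : x = y := by
  have hy0 := hy.1 0
  have hy0' := hy.2 0
  have hy1 := hy.1 1
  have hy1' := hy.2 1
  have hy2 := hy.1 2
  have hy2' := hy.2 2
  simp only [corner, Pi.zero_apply, Matrix.cons_val_zero, Matrix.cons_val_one, Matrix.cons_val]
    at hy0 hy0' hy1 hy1' hy2 hy2'
  have scale : ∀ L t : ℝ, 0 < L → (1 / L * t < 2 * Real.pi ↔ t < 2 * Real.pi * L) := by
    intro L t hL
    rw [one_div_mul_eq_div, div_lt_iff₀ hL]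
  have scale' : ∀ L t : ℝ, 0 < L → t ≤ 2 * Real.pi * L → 1 / L * t ≤ 2 * Real.pi := by
    intro L t hL
    rw [one_div_mul_eq_div, div_le_iff₀ hL]
    exact id
  have e0 := congrFun h 0
  have e1 := congrFun h 1
  have e2 := congrFun h 2
  rw [wrap_zero, wrap_zero] at e0
  rw [wrap_one, wrap_one] at e1
  rw [wrap_two, wrap_two] at e2
  have h0 := expP_injOn ⟨mul_pos (by positivity) hx.1.1, (scale _ _ hL1).2 hx.1.2⟩
    ⟨mul_nonneg (by positivity) hy0, scale' _ _ hL1 hy0'⟩ e0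
  have h1 := expP_injOn ⟨mul_pos (by positivity) hx.2.1.1, (scale _ _ hL2).2 hx.2.1.2⟩
    ⟨mul_nonneg (by positivity) hy1, scale' _ _ hL2 hy1'⟩ e1
  have hpi := Real.pi_pos
  have h2 : Real.pi * x 2 = Real.pi * y 2 :=
    Real.injOn_cos ⟨mul_nonneg hpi.le hx.2.2.1.le, by nlinarith [hx.2.2.2]⟩
      ⟨mul_nonneg hpi.le hy2, by nlinarith⟩ (Complex.ofReal_injective e2)
  ext i
  fin_cases i
  · exact mul_left_cancel₀ (by positivity) h0
  · exact mul_left_cancel₀ (by positivity) h1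
  · exact mul_left_cancel₀ hpi.ne' h2

/-- The retraction of `ℝ³` onto the closed cell. -/
noncomputable def clamp (hL1 : 0 < p.L1) (hL2 : 0 < p.L2) (x : Pt) :
    Set.Icc (0 : Pt) (corner p) :=
  ⟨(x ⊔ 0) ⊓ corner p, le_inf le_sup_right (corner_nonneg hL1 hL2), inf_le_right⟩

lemma continuous_clamp (hL1 : 0 < p.L1) (hL2 : 0 < p.L2) :
    Continuous (clamp (p := p) hL1 hL2) :=
  Continuous.subtype_mk (continuous_pi fun i =>
    ((continuous_apply i).max continuous_const).min continuous_const) _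

lemma clamp_of_mem (hL1 : 0 < p.L1) (hL2 : 0 < p.L2) {x : Pt} (hx : x ∈ Set.Icc 0 (corner p)) :
    (clamp hL1 hL2 x : Pt) = x := by
  simp only [clamp]
  rw [sup_eq_left.2 hx.1, inf_eq_left.2 hx.2]

/-- The image of the closed cell under `wrap`: a compact space homeomorphic to
`S¹ × S¹ × [-1, 1]`. -/
abbrev Wrapped (p : Params) := Set.range (fun x : Set.Icc (0 : Pt) (corner p) => wrap p x)

instance : CompactSpace (Wrapped p) :=
  isCompact_iff_compactSpace.1
    (isCompact_range ((continuous_wrap p).comp continuous_subtype_val))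

/-- The coordinate functions on the image of `wrap`. -/
def coordFun (p : Params) (i : Fin 3) : C(Wrapped p, ℂ) :=
  ⟨fun y => y.1 i, (continuous_apply i).comp continuous_subtype_val⟩

/-- The quotient map from the closed cell. -/
noncomputable def wrapMap (p : Params) : C(Set.Icc (0 : Pt) (corner p), Wrapped p) :=
  ⟨Set.rangeFactorization _,
    ((continuous_wrap p).comp continuous_subtype_val).subtype_mk _⟩

lemma isQuotientMap_wrapMap (p : Params) : IsQuotientMap (wrapMap p) :=
  IsQuotientMap.of_surjective_continuous Set.rangeFactorization_surjective (wrapMap p).continuous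

lemma wrapMap_clamp (hL1 : 0 < p.L1) (hL2 : 0 < p.L2) {x : Pt} (hx : x ∈ cell p) :
    (wrapMap p (clamp hL1 hL2 x)).1 = wrap p x := by
  change wrap p (clamp hL1 hL2 x : Pt) = _
  rw [clamp_of_mem hL1 hL2 (cell_subset_Icc p hx)]

/-- The star algebra of polynomials in the coordinate functions. -/
noncomputable def coordAlgebra (p : Params) : StarSubalgebra ℂ C(Wrapped p, ℂ) :=
  StarAlgebra.adjoin ℂ (Set.range (coordFun p))

lemma coordAlgebra_dense (p : Params) : (coordAlgebra p).topologicalClosure = ⊤ := by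
  apply ContinuousMap.starSubalgebra_topologicalClosure_eq_top_of_separatesPoints
  intro y z hyz
  obtain ⟨i, hi⟩ : ∃ i, y.1 i ≠ z.1 i := by
    by_contra! h
    exact hyz (Subtype.ext (funext h))
  exact ⟨coordFun p i, ⟨coordFun p i, StarAlgebra.subset_adjoin ℂ _ ⟨i, rfl⟩, rfl⟩, hi⟩

lemma star_trigCos (m n l : ℤ) (x : Pt) :
    star (trigCos p m n l x) = trigCos p (-m) (-n) l x := by
  have harg : ((-m : ℤ) : ℝ) * (1 / p.L1) * x 0 + ((-n : ℤ) : ℝ) * (1 / p.L2) * x 1 =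
      -(m * (1 / p.L1) * x 0 + n * (1 / p.L2) * x 1) := by
    push_cast; ring
  simp only [trigCos, sep, cosP, harg, expP]
  rw [star_mul', Complex.star_def, Complex.conj_ofReal, ← Complex.exp_conj,
    map_mul, Complex.conj_ofReal, Complex.conj_I, Complex.ofReal_neg, neg_mul_comm]

/-- Multiplication by a polynomial in the coordinate functions preserves `FourierZero`, because
multiplication by a trigonometric function only shifts the Fourier coefficients. -/
lemma FourierZero.mul_coordAlgebra (hL1 : 0 < p.L1) (hL2 : 0 < p.L2) {g : C(Wrapped p, ℂ)}
    (hg : g ∈ coordAlgebra p) :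
    (∀ f, FourierZero p f → FourierZero p fun x => f x * g (wrapMap p (clamp hL1 hL2 x))) ∧
      ∀ f, FourierZero p f → FourierZero p fun x => f x * star g (wrapMap p (clamp hL1 hL2 x)) := by
  induction hg using StarAlgebra.adjoin_induction with
  | mem g hg =>
    obtain ⟨i, rfl⟩ := hg
    obtain ⟨a, b, c, habc⟩ : ∃ a b c : ℤ, ∀ x, wrap p x i = trigCos p a b c x := by
      fin_cases i
      exacts [⟨1, 0, 0, fun _ => rfl⟩, ⟨0, 1, 0, fun _ => rfl⟩, ⟨0, 0, 1, fun _ => rfl⟩]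
    have hval : ∀ x ∈ cell p, coordFun p i (wrapMap p (clamp hL1 hL2 x)) = trigCos p a b c x := by
      intro x hx
      rw [← habc, ← wrapMap_clamp hL1 hL2 hx]
      rfl
    refine ⟨fun f hf => (hf.mul_trigCos a b c).congr fun x hx => by rw [hval x hx],
      fun f hf => (hf.mul_trigCos (-a) (-b) c).congr fun x hx => ?_⟩
    rw [ContinuousMap.star_apply, hval x hx, star_trigCos]
  | algebraMap r =>
    refine ⟨fun f hf => hf.mul_const r, fun f hf => ?_⟩
    exact hf.mul_const (star r)
  | add g h _ _ ihg ihh =>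
    refine ⟨fun f hf => ((ihg.1 f hf).add (ihh.1 f hf)).congr fun x _ => ?_,
      fun f hf => ((ihg.2 f hf).add (ihh.2 f hf)).congr fun x _ => ?_⟩
    · simp [mul_add]
    · simp [mul_add]
  | mul g h _ _ ihg ihh =>
    refine ⟨fun f hf => (ihh.1 _ (ihg.1 f hf)).congr fun x _ => ?_,
      fun f hf => (ihh.2 _ (ihg.2 f hf)).congr fun x _ => ?_⟩
    · rw [ContinuousMap.mul_apply, mul_assoc]
    · simp only [ContinuousMap.star_apply, ContinuousMap.mul_apply, star_mul']
      rw [mul_assoc]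
  | star g _ ih => exact ⟨ih.2, fun f hf => by simpa using ih.1 f hf⟩

/-- A function with vanishing coefficients is orthogonal to all continuous functions that vanish
on the boundary of the cell. -/
lemma FourierZero.integral_mul_eq_zero (hL1 : 0 < p.L1) (hL2 : 0 < p.L2) {f : Pt → ℂ}
    (hf : FourierZero p f) {φ : Pt → ℂ} (hφ : Continuous φ) (h0 : ∀ x, x ∉ cell p → φ x = 0) :
    ∫ x, f x * φ x ∂(cellVol p) = 0 := by
  let φ' : C(Set.Icc (0 : Pt) (corner p), ℂ) := ⟨fun x => φ x, hφ.comp continuous_subtype_val⟩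
  have hfac : Function.FactorsThrough φ' (wrapMap p) := by
    intro x y hxy
    have hxy' : wrap p x = wrap p y := congrArg Subtype.val hxy
    change φ x = φ y
    by_cases hx : x.1 ∈ cell p
    · rw [wrap_injOn hL1 hL2 hx y.2 hxy']
    · by_cases hy : y.1 ∈ cell p
      · rw [wrap_injOn hL1 hL2 hy x.2 hxy'.symm]
      · rw [h0 _ hx, h0 _ hy]
  set ψ : C(Wrapped p, ℂ) := (isQuotientMap_wrapMap p).lift φ' hfac with hψ
  have hψφ : ∀ x ∈ cell p, ψ (wrapMap p (clamp hL1 hL2 x)) = φ x := by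
    intro x hx
    have := congrArg (fun g => g (clamp hL1 hL2 x))
      ((isQuotientMap_wrapMap p).lift_comp φ' hfac)
    refine this.trans ?_
    change φ (clamp hL1 hL2 x : Pt) = φ x
    rw [clamp_of_mem hL1 hL2 (cell_subset_Icc p hx)]
  have hmem : ψ ∈ closure (coordAlgebra p : Set C(Wrapped p, ℂ)) := by
    have : ψ ∈ (coordAlgebra p).topologicalClosure := by rw [coordAlgebra_dense]; trivial
    exact this
  set I : ℝ := ∫ x, ‖f x‖ ∂(cellVol p) with hI
  have hI0 : 0 ≤ I := integral_nonneg fun _ => norm_nonneg _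
  refine norm_le_zero_iff.1 (le_of_forall_pos_le_add fun ε hε => ?_)
  rw [zero_add]
  obtain ⟨g, hg, hdist⟩ := Metric.mem_closure_iff.1 hmem (ε / (I + 1)) (by positivity)
  have hgcont : Continuous fun x : Pt => g (wrapMap p (clamp hL1 hL2 x)) :=
    g.continuous.comp ((wrapMap p).continuous.comp (continuous_clamp hL1 hL2))
  have hg0 : ∫ x, f x * g (wrapMap p (clamp hL1 hL2 x)) ∂(cellVol p) = 0 := by
    have h := ((FourierZero.mul_coordAlgebra hL1 hL2 hg).1 f hf).2 0 0 0
    refine Eq.trans (integral_congr_ae (Eventually.of_forall fun x => ?_)) h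
    simp [trigCos, sep, cosP, expP]
  calc ‖∫ x, f x * φ x ∂(cellVol p)‖
      = ‖∫ x, f x * (φ x - g (wrapMap p (clamp hL1 hL2 x))) ∂(cellVol p)‖ := by
        simp only [mul_sub]
        rw [integral_sub (integrable_mul_continuous hf.1 hφ)
          (integrable_mul_continuous hf.1 hgcont), hg0, sub_zero]
    _ ≤ ∫ x, ‖f x‖ * (ε / (I + 1)) ∂(cellVol p) := by
        refine norm_integral_le_of_norm_le (hf.1.norm.mul_const _) ?_
        filter_upwards [ae_mem_cell p] with x hx
        rw [norm_mul, ← hψφ x hx]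
        gcongr
        rw [← dist_eq_norm]
        exact (ContinuousMap.dist_apply_le_dist _).trans hdist.le
    _ = I * (ε / (I + 1)) := by rw [integral_mul_const]
    _ ≤ (I + 1) * (ε / (I + 1)) := by gcongr; linarith
    _ = ε := by field_simp

/-- A function with vanishing coefficients vanishes, since it is orthogonal to all test functions
supported in the cell. -/
lemma FourierZero.ae_eq_zero (hL1 : 0 < p.L1) (hL2 : 0 < p.L2) {f : Pt → ℂ}
    (hf : FourierZero p f) : f =ᵐ[cellVol p] 0 := by
  have hint : IntegrableOn f (cell p) := hf.1
  have h := (isOpen_cell p).ae_eq_zero_of_integral_contDiff_smul_eq_zero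
    hint.locallyIntegrableOn (fun g hg _ hsupp => by
      have hz : ∀ x, x ∉ cell p → g x = 0 := fun x hx =>
        image_eq_zero_of_notMem_tsupport fun h => hx (hsupp h)
      rw [← setIntegral_eq_integral_of_forall_compl_eq_zero (s := cell p)
        (fun x hx => by rw [hz x hx, zero_smul])]
      have := hf.integral_mul_eq_zero hL1 hL2 (φ := fun x => (g x : ℂ))
        (Complex.continuous_ofReal.comp hg.continuous) (fun x hx => by simp [hz x hx])
      refine Eq.trans (integral_congr_ae (Eventually.of_forall fun x => ?_)) this
      simp [mul_comm])
  exact (ae_restrict_iff' (isOpen_cell p).measurableSet).2 h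

/-- Completeness of the cosine system. -/
lemma ae_eq_zero_of_trigCos (hL1 : 0 < p.L1) (hL2 : 0 < p.L2) {f : Pt → ℂ}
    (hf : MemLp f 2 (cellVol p))
    (h : ∀ m n l : ℤ, ∫ x, f x * trigCos p m n l x ∂(cellVol p) = 0) : f =ᵐ[cellVol p] 0 :=
  FourierZero.ae_eq_zero hL1 hL2 ⟨hf.integrable (by norm_num), h⟩

/-- Completeness of the sine system: multiplication by `sin (π x₃)` reduces it to the
cosine system. -/
lemma ae_eq_zero_of_trigSin (hL1 : 0 < p.L1) (hL2 : 0 < p.L2) {f : Pt → ℂ}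
    (hf : MemLp f 2 (cellVol p))
    (h : ∀ m n l : ℤ, ∫ x, f x * trigSin p m n l x ∂(cellVol p) = 0) : f =ᵐ[cellVol p] 0 := by
  have hint : Integrable f (cellVol p) := hf.integrable (by norm_num)
  have hsin : Continuous fun x : Pt => sinP Real.pi (x 2) :=
    (contDiff_sinP Real.pi).continuous.comp (continuous_apply 2)
  have hcont : ∀ m n l, Continuous (trigSin p m n l) := fun m n l =>
    (contDiff_sep contDiff_expP (contDiff_sinP _)).continuous
  have hz : FourierZero p fun x => f x * sinP Real.pi (x 2) := by
    refine ⟨integrable_mul_continuous hint hsin, fun m n l => ?_⟩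
    have e : ∀ x, f x * sinP Real.pi (x 2) * trigCos p m n l x =
        (1 / 2) * (f x * trigSin p m n (l + 1) x) - (1 / 2) * (f x * trigSin p m n (l - 1) x) :=
      fun x => by rw [mul_assoc, sinP_mul_trigCos]; ring
    simp only [e]
    rw [integral_sub, integral_const_mul, integral_const_mul, h, h, mul_zero, sub_zero]
    · exact (integrable_mul_continuous hint (hcont ..)).const_mul _
    · exact (integrable_mul_continuous hint (hcont ..)).const_mul _
  filter_upwards [hz.ae_eq_zero hL1 hL2, ae_mem_cell p] with x hx hmem
  refine (mul_eq_zero.1 hx).resolve_right (Complex.ofReal_ne_zero.2 (Real.sin_pos_of_pos_of_lt_pi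
    (mul_pos Real.pi_pos hmem.2.2.1) ?_).ne')
  nlinarith [Real.pi_pos, hmem.2.2.2]

end

/-! ### Fourier coefficients of weak solutions -/

section

variable {p : Params}

/-- The pairing of `f` with a test function on the period cell. -/
noncomputable def coef (p : Params) (φ f : Pt → ℂ) : ℂ := ∫ x, f x * φ x ∂(cellVol p)

section linear

variable {φ f g : Pt → ℂ}

lemma coef_congr (h : ∀ᵐ x ∂(cellVol p), f x = g x) : coef p φ f = coef p φ g :=
  integral_congr_ae (h.mono fun x hx => by simp only [hx])

lemma coef_add (hφ : Continuous φ) (hf : MemLp f 2 (cellVol p)) (hg : MemLp g 2 (cellVol p)) :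
    coef p φ (fun x => f x + g x) = coef p φ f + coef p φ g := by
  simp only [coef, add_mul]
  exact integral_add (integrable_mul_continuous (hf.integrable (by norm_num)) hφ)
    (integrable_mul_continuous (hg.integrable (by norm_num)) hφ)

lemma coef_sub (hφ : Continuous φ) (hf : MemLp f 2 (cellVol p)) (hg : MemLp g 2 (cellVol p)) :
    coef p φ (fun x => f x - g x) = coef p φ f - coef p φ g := by
  simp only [coef, sub_mul]
  exact integral_sub (integrable_mul_continuous (hf.integrable (by norm_num)) hφ)
    (integrable_mul_continuous (hg.integrable (by norm_num)) hφ)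

lemma coef_add_add {k : Pt → ℂ} (hφ : Continuous φ) (hf : MemLp f 2 (cellVol p))
    (hg : MemLp g 2 (cellVol p)) (hk : MemLp k 2 (cellVol p)) :
    coef p φ (fun x => f x + g x + k x) = coef p φ f + coef p φ g + coef p φ k := by
  have hfg : MemLp (fun x => f x + g x) 2 (cellVol p) := hf.add hg
  rw [coef_add hφ hfg hk, coef_add hφ hf hg]

lemma coef_const_mul (a : ℂ) : coef p φ (fun x => a * f x) = a * coef p φ f := by
  simp only [coef, mul_assoc]
  exact integral_const_mul a _

lemma coef_neg : coef p φ (fun x => -f x) = -coef p φ f := by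
  simp only [coef, neg_mul]
  exact integral_neg _

lemma coef_zero : coef p φ (fun _ => 0) = 0 := by simp [coef]

lemma coef_test_const_mul (a : ℂ) : coef p (fun x => a * φ x) f = a * coef p φ f := by
  simp only [coef, ← integral_const_mul]
  congr 1
  ext x
  ring

end linear

lemma memLp_lap (f : H2Fun p) : MemLp f.lap 2 (cellVol p) :=
  memLp_finsetSum _ fun i _ => f.hess_memLp i i

lemma H2Fun.coef_lap (f : H2Fun p) {φ : Pt → ℂ} (hφ : Continuous φ) :
    coef p φ f.lap = coef p φ (f.hess 0 0) + coef p φ (f.hess 1 1) + coef p φ (f.hess 2 2) := by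
  rw [← coef_add_add hφ (f.hess_memLp 0 0) (f.hess_memLp 1 1) (f.hess_memLp 2 2)]
  unfold H2Fun.lap
  simp only [Fin.sum_univ_three]

/-- Coefficients of a horizontal weak derivative. -/
lemma HasWeakPartial.coef_eq {i : Fin 3} {f g φ : Pt → ℂ} {c : ℂ} (h : HasWeakPartial p i f g)
    (hφ : IsTest p φ) (hi : i ≠ 2) (hc : partialD i φ = fun x => c * φ x) :
    coef p φ g = -c * coef p φ f := by
  have := h φ hφ (fun h2 => absurd h2 hi)
  rw [hc] at this
  have h1 : coef p (fun x => c * φ x) f = -coef p φ g := this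
  rw [coef_test_const_mul] at h1
  linear_combination h1

/-- Coefficients of a vertical weak derivative, with respect to a test function that vanishes on the
walls. -/
lemma HasWeakPartial.coef_two_eq {f g φ ψ : Pt → ℂ} {c : ℂ} (h : HasWeakPartial p 2 f g)
    (hφ : IsTest p φ) (hw : ∀ x : Pt, x 2 = 0 ∨ x 2 = 1 → φ x = 0)
    (hc : partialD 2 φ = fun x => c * ψ x) :
    coef p φ g = -c * coef p ψ f := by
  have := h φ hφ (fun _ => hw)
  rw [hc] at this
  have h1 : coef p (fun x => c * ψ x) f = -coef p φ g := this
  rw [coef_test_const_mul] at h1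
  linear_combination h1

/-- Coefficients of the vertical derivative of a function that vanishes on the walls. -/
lemma ZeroTrace.coef_eq {f g φ ψ : Pt → ℂ} {c : ℂ} (h : ZeroTrace p f g)
    (hφ : IsTest p φ) (hc : partialD 2 φ = fun x => c * ψ x) :
    coef p φ g = -c * coef p ψ f := by
  have := h φ hφ
  rw [hc] at this
  have h1 : coef p (fun x => c * ψ x) f = -coef p φ g := this
  rw [coef_test_const_mul] at h1
  linear_combination h1

lemma differentiable_expP : Differentiable ℝ expP := contDiff_expP.differentiable (by simp)

lemma partialD_zero_exp {V : ℝ → ℂ} (hV : Differentiable ℝ V) (κ₁ κ₂ : ℝ) :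
    partialD 0 (sep κ₁ κ₂ expP V) = fun x => κ₁ * Complex.I * sep κ₁ κ₂ expP V x := by
  rw [partialD_sep_zero hasDerivAt_expP hV]
  ext x; simp only [sep]; ring

lemma partialD_one_exp {V : ℝ → ℂ} (hV : Differentiable ℝ V) (κ₁ κ₂ : ℝ) :
    partialD 1 (sep κ₁ κ₂ expP V) = fun x => κ₂ * Complex.I * sep κ₁ κ₂ expP V x := by
  rw [partialD_sep_one hasDerivAt_expP hV]
  ext x; simp only [sep]; ring

lemma sinP_int_wall (l : ℤ) {t : ℝ} (ht : t = 0 ∨ t = 1) : sinP (l * Real.pi) t = 0 := by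
  rcases ht with rfl | rfl
  · simp [sinP]
  · rw [sinP, mul_one, Real.sin_int_mul_pi, Complex.ofReal_zero]

lemma trigSin_wall (m n l : ℤ) (x : Pt) (hx : x 2 = 0 ∨ x 2 = 1) : trigSin p m n l x = 0 := by
  rw [trigSin, sep, sinP_int_wall l hx, mul_zero]

/-- The Laplacian multiplies the sine coefficients of a function with Dirichlet condition by
`-r²`. -/
lemma H2Fun.coef_lap_sin (hL1 : 0 < p.L1) (hL2 : 0 < p.L2) (f : H2Fun p) (hf : f.Dirichlet)
    (m n l : ℤ) {κ₁ κ₂ ν : ℝ} (h1 : κ₁ = m * (1 / p.L1)) (h2 : κ₂ = n * (1 / p.L2))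
    (h3 : ν = l * Real.pi) :
    coef p (trigSin p m n l) f.lap =
      -(κ₁ ^ 2 + κ₂ ^ 2 + ν ^ 2) * coef p (trigSin p m n l) f.toFun := by
  have hc := isTest_trigCos hL1 hL2 m n l
  have hs := isTest_trigSin hL1 hL2 m n l
  have d0 : partialD 0 (trigSin p m n l) = fun x => κ₁ * Complex.I * trigSin p m n l x := by
    rw [h1]; exact partialD_zero_exp (differentiable_sinP _) _ _
  have d1 : partialD 1 (trigSin p m n l) = fun x => κ₂ * Complex.I * trigSin p m n l x := by
    rw [h2]; exact partialD_one_exp (differentiable_sinP _) _ _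
  have d2 : partialD 2 (trigSin p m n l) = fun x => ν * trigCos p m n l x := by
    rw [h3]; exact partialD_two_sin _ _ _ differentiable_expP
  have d2' : partialD 2 (trigCos p m n l) = fun x => -ν * trigSin p m n l x := by
    rw [h3]; exact partialD_two_cos _ _ _ differentiable_expP
  have e0 := (f.hess_weak 0 0).coef_eq hs (by decide) d0
  have e0' := (f.grad_weak 0).coef_eq hs (by decide) d0
  have e1 := (f.hess_weak 1 1).coef_eq hs (by decide) d1
  have e1' := (f.grad_weak 1).coef_eq hs (by decide) d1
  have e2 := (f.hess_weak 2 2).coef_two_eq hs (trigSin_wall m n l) d2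
  have e2' := ZeroTrace.coef_eq hf hc d2'
  have hcont := hs.1.continuous
  rw [f.coef_lap hcont, e0, e0', e1, e1', e2, e2']
  linear_combination (κ₁ ^ 2 + κ₂ ^ 2) * coef p (trigSin p m n l) f.toFun * Complex.I_sq

/-- The Laplacian multiplies the cosine coefficients of a function with Neumann condition by
`-r²`. -/
lemma H2Fun.coef_lap_cos (hL1 : 0 < p.L1) (hL2 : 0 < p.L2) (f : H2Fun p) (hf : f.Neumann)
    (m n l : ℤ) {κ₁ κ₂ ν : ℝ} (h1 : κ₁ = m * (1 / p.L1)) (h2 : κ₂ = n * (1 / p.L2))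
    (h3 : ν = l * Real.pi) :
    coef p (trigCos p m n l) f.lap =
      -(κ₁ ^ 2 + κ₂ ^ 2 + ν ^ 2) * coef p (trigCos p m n l) f.toFun := by
  have hc := isTest_trigCos hL1 hL2 m n l
  have hs := isTest_trigSin hL1 hL2 m n l
  have d0 : partialD 0 (trigCos p m n l) = fun x => κ₁ * Complex.I * trigCos p m n l x := by
    rw [h1]; exact partialD_zero_exp (differentiable_cosP _) _ _
  have d1 : partialD 1 (trigCos p m n l) = fun x => κ₂ * Complex.I * trigCos p m n l x := by
    rw [h2]; exact partialD_one_exp (differentiable_cosP _) _ _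
  have d2 : partialD 2 (trigSin p m n l) = fun x => ν * trigCos p m n l x := by
    rw [h3]; exact partialD_two_sin _ _ _ differentiable_expP
  have d2' : partialD 2 (trigCos p m n l) = fun x => -ν * trigSin p m n l x := by
    rw [h3]; exact partialD_two_cos _ _ _ differentiable_expP
  have e0 := (f.hess_weak 0 0).coef_eq hc (by decide) d0
  have e0' := (f.grad_weak 0).coef_eq hc (by decide) d0
  have e1 := (f.hess_weak 1 1).coef_eq hc (by decide) d1
  have e1' := (f.grad_weak 1).coef_eq hc (by decide) d1
  have e2 := ZeroTrace.coef_eq hf hc d2'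
  have e2' := (f.grad_weak 2).coef_two_eq hs (trigSin_wall m n l) d2
  have hcont := hc.1.continuous
  rw [f.coef_lap hcont, e0, e0', e1, e1', e2, e2']
  linear_combination (κ₁ ^ 2 + κ₂ ^ 2) * coef p (trigCos p m n l) f.toFun * Complex.I_sq

/-- The divergence constraint in terms of Fourier coefficients. -/
lemma DivFree.coef_eq (hL1 : 0 < p.L1) (hL2 : 0 < p.L2) {v : Fin 3 → H2Fun p} (hv : DivFree v)
    (hb : (v 2).Dirichlet) (m n l : ℤ) {κ₁ κ₂ ν : ℝ} (h1 : κ₁ = m * (1 / p.L1))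
    (h2 : κ₂ = n * (1 / p.L2)) (h3 : ν = l * Real.pi) :
    -(κ₁ * Complex.I) * coef p (trigCos p m n l) (v 0).toFun +
      -(κ₂ * Complex.I) * coef p (trigCos p m n l) (v 1).toFun +
      ν * coef p (trigSin p m n l) (v 2).toFun = 0 := by
  have hc := isTest_trigCos hL1 hL2 m n l
  have d0 : partialD 0 (trigCos p m n l) = fun x => κ₁ * Complex.I * trigCos p m n l x := by
    rw [h1]; exact partialD_zero_exp (differentiable_cosP _) _ _
  have d1 : partialD 1 (trigCos p m n l) = fun x => κ₂ * Complex.I * trigCos p m n l x := by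
    rw [h2]; exact partialD_one_exp (differentiable_cosP _) _ _
  have d2' : partialD 2 (trigCos p m n l) = fun x => -ν * trigSin p m n l x := by
    rw [h3]; exact partialD_two_cos _ _ _ differentiable_expP
  have hcont := hc.1.continuous
  have h := coef_congr (φ := trigCos p m n l) hv
  simp only [Fin.sum_univ_three] at h
  rw [coef_zero, coef_add_add hcont ((v 0).grad_memLp 0) ((v 1).grad_memLp 1) ((v 2).grad_memLp 2),
    ((v 0).grad_weak 0).coef_eq hc (by decide) d0, ((v 1).grad_weak 1).coef_eq hc (by decide) d1,
    ZeroTrace.coef_eq hb hc d2'] at h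
  linear_combination h

/-- One component of the momentum equation in terms of coefficients. -/
lemma coef_momentum {φ lap gp F G B u : Pt → ℂ} {Ra sT Q β : ℂ} (hφ : Continuous φ)
    (h : ∀ᵐ x ∂(cellVol p), lap x - gp x + Ra * F x + sT * G x + Q * B x = β * u x)
    (hlap : MemLp lap 2 (cellVol p)) (hgp : MemLp gp 2 (cellVol p)) (hF : MemLp F 2 (cellVol p))
    (hG : MemLp G 2 (cellVol p)) (hB : MemLp B 2 (cellVol p)) :
    coef p φ lap - coef p φ gp + Ra * coef p φ F + sT * coef p φ G + Q * coef p φ B =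
      β * coef p φ u := by
  have e := coef_congr (φ := φ) h
  have h1 : MemLp (fun x => lap x - gp x) 2 (cellVol p) := hlap.sub hgp
  have h2 : MemLp (fun x => lap x - gp x + Ra * F x) 2 (cellVol p) := h1.add (hF.const_mul Ra)
  rw [coef_const_mul, coef_add_add hφ h2 (hG.const_mul sT) (hB.const_mul Q),
    coef_add hφ h1 (hF.const_mul Ra), coef_sub hφ hlap hgp, coef_const_mul, coef_const_mul,
    coef_const_mul] at e
  exact e

/-- The Fourier coefficients of an eigenfunction satisfy the mode equations. Here `q` is
the coefficient of the pressure, and `b₀, b₁, b₂` are those of the magnetic field. -/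
lemma mode_equations (hPr : 0 < p.Pr) (hL1 : 0 < p.L1) (hL2 : 0 < p.L2) {Ra : ℝ} {β : ℂ}
    {Ψ : State p} (hΨ : IsEigenvector p Ra β Ψ) (m n l : ℤ) {κ₁ κ₂ ν : ℝ}
    (h1 : κ₁ = m * (1 / p.L1)) (h2 : κ₂ = n * (1 / p.L2)) (h3 : ν = l * Real.pi)
    {c₀ c₁ w t : ℂ} (hc₀ : c₀ = coef p (trigCos p m n l) (Ψ.u 0).toFun)
    (hc₁ : c₁ = coef p (trigCos p m n l) (Ψ.u 1).toFun)
    (hw : w = coef p (trigSin p m n l) (Ψ.u 2).toFun)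
    (ht : t = coef p (trigSin p m n l) Ψ.θ.toFun) :
    ∃ q b₀ b₁ b₂ : ℂ,
      -(κ₁ ^ 2 + κ₂ ^ 2 + ν ^ 2) * b₀ = κ₂ * Complex.I * c₀ ∧
      -(κ₁ ^ 2 + κ₂ ^ 2 + ν ^ 2) * b₁ = κ₂ * Complex.I * c₁ ∧
      -(κ₁ ^ 2 + κ₂ ^ 2 + ν ^ 2) * b₂ = κ₂ * Complex.I * w ∧
      -(κ₁ ^ 2 + κ₂ ^ 2 + ν ^ 2) * c₀ + κ₁ * Complex.I * q + (√p.Ta : ℝ) * c₁ -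
        p.Q * (κ₂ * Complex.I * b₀) = β * c₀ ∧
      -(κ₁ ^ 2 + κ₂ ^ 2 + ν ^ 2) * c₁ + κ₂ * Complex.I * q - (√p.Ta : ℝ) * c₀ -
        p.Q * (κ₂ * Complex.I * b₁) = β * c₁ ∧
      -(κ₁ ^ 2 + κ₂ ^ 2 + ν ^ 2) * w + ν * q + Ra * t - p.Q * (κ₂ * Complex.I * b₂) = β * w ∧
      κ₁ * Complex.I * c₀ + κ₂ * Complex.I * c₁ = ν * w ∧
      -(κ₁ ^ 2 + κ₂ ^ 2 + ν ^ 2) * t + w = p.Pr * β * t := by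
  obtain ⟨-, b, π, hbb, -, hind, hmom, hheat⟩ := hΨ
  have hc := isTest_trigCos hL1 hL2 m n l
  have hs := isTest_trigSin hL1 hL2 m n l
  have hcc := hc.1.continuous
  have hsc := hs.1.continuous
  have d0 : partialD 0 (trigCos p m n l) = fun x => κ₁ * Complex.I * trigCos p m n l x := by
    rw [h1]; exact partialD_zero_exp (differentiable_cosP _) _ _
  have d1 : partialD 1 (trigCos p m n l) = fun x => κ₂ * Complex.I * trigCos p m n l x := by
    rw [h2]; exact partialD_one_exp (differentiable_cosP _) _ _
  have d1' : partialD 1 (trigSin p m n l) = fun x => κ₂ * Complex.I * trigSin p m n l x := by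
    rw [h2]; exact partialD_one_exp (differentiable_sinP _) _ _
  have d2 : partialD 2 (trigSin p m n l) = fun x => ν * trigCos p m n l x := by
    rw [h3]; exact partialD_two_sin _ _ _ differentiable_expP
  have lapc := fun (f : H2Fun p) hf => f.coef_lap_cos hL1 hL2 hf m n l h1 h2 h3
  have laps := fun (f : H2Fun p) hf => f.coef_lap_sin hL1 hL2 hf m n l h1 h2 h3
  have gradc := fun f : H2Fun p => (f.grad_weak 1).coef_eq hc (by decide) d1
  have grads := fun f : H2Fun p => (f.grad_weak 1).coef_eq hs (by decide) d1'
  have i0 := coef_congr (φ := trigCos p m n l) (hind 0)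
  have i1 := coef_congr (φ := trigCos p m n l) (hind 1)
  have i2 := coef_congr (φ := trigSin p m n l) (hind 2)
  rw [coef_neg, lapc _ hbb.1, gradc, ← hc₀] at i0
  rw [coef_neg, lapc _ hbb.2.1, gradc, ← hc₁] at i1
  rw [coef_neg, laps _ hbb.2.2, grads, ← hw] at i2
  have zero : MemLp (fun _ : Pt => (0 : ℂ)) 2 (cellVol p) := MemLp.zero'
  have m0 := coef_momentum hcc (hmom 0) (memLp_lap _) (π.grad_memLp 0) zero (Ψ.u 1).memLp
    ((b 0).grad_memLp 1)
  have m1 := coef_momentum hcc (hmom 1) (memLp_lap _) (π.grad_memLp 1) zero (Ψ.u 0).memLp.neg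
    ((b 1).grad_memLp 1)
  have m2 := coef_momentum hsc (hmom 2) (memLp_lap _) (π.grad_memLp 2) Ψ.θ.memLp zero
    ((b 2).grad_memLp 1)
  have z0 : coef p (trigCos p m n l) (thetaE3 Ψ.θ 0) = 0 := coef_zero
  have z1 : coef p (trigCos p m n l) (thetaE3 Ψ.θ 1) = 0 := coef_zero
  have z2 : coef p (trigSin p m n l) (thetaE3 Ψ.θ 2) = t := ht.symm
  have x0 : coef p (trigCos p m n l) (crossE3 Ψ.u 0) = c₁ := hc₁.symm
  have x1 : coef p (trigCos p m n l) (crossE3 Ψ.u 1) = -c₀ := by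
    rw [hc₀, ← coef_neg]; rfl
  have x2 : coef p (trigSin p m n l) (crossE3 Ψ.u 2) = 0 := coef_zero
  rw [lapc _ Ψ.bdry_u.1, (π.grad_weak 0).coef_eq hc (by decide) d0, z0, x0, gradc, ← hc₀] at m0
  rw [lapc _ Ψ.bdry_u.2.1, (π.grad_weak 1).coef_eq hc (by decide) d1, z1, x1, gradc, ← hc₁] at m1
  rw [laps _ Ψ.bdry_u.2.2, (π.grad_weak 2).coef_two_eq hs (trigSin_wall m n l) d2, z2, x2, grads,
    ← hw] at m2
  have hdiv := DivFree.coef_eq hL1 hL2 Ψ.divFree Ψ.bdry_u.2.2 m n l h1 h2 h3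
  rw [← hc₀, ← hc₁, ← hw] at hdiv
  have hP : (p.Pr : ℂ) ≠ 0 := Complex.ofReal_ne_zero.2 hPr.ne'
  have hheat' : ∀ᵐ x ∂(cellVol p), Ψ.θ.lap x + (Ψ.u 2).toFun x = p.Pr * β * Ψ.θ.toFun x := by
    filter_upwards [hheat] with x hx
    field_simp at hx
    linear_combination hx
  have hh := coef_congr (φ := trigSin p m n l) hheat'
  rw [coef_const_mul, coef_add hsc (memLp_lap _) (Ψ.u 2).memLp, laps _ Ψ.bdry_θ, ← ht, ← hw] at hh
  refine ⟨coef p (trigCos p m n l) π.toFun, coef p (trigCos p m n l) (b 0).toFun,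
    coef p (trigCos p m n l) (b 1).toFun, coef p (trigSin p m n l) (b 2).toFun, ?_, ?_, ?_, ?_, ?_,
    ?_, ?_, ?_⟩
  · linear_combination i0
  · linear_combination i1
  · linear_combination i2
  · linear_combination m0
  · linear_combination m1
  · linear_combination m2
  · linear_combination -hdiv
  · linear_combination hh

end

/-! ### Classification of the eigenvalues -/

section

variable {p : Params}

/-- The rotation by `π` about the vertical axis through the centre of the period cell. -/
noncomputable def cellRotate (p : Params) (x : Pt) : Pt :=
  ![2 * Real.pi * p.L1 - x 0, 2 * Real.pi * p.L2 - x 1, x 2]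

lemma measurePreserving_cellRotate (p : Params) :
    MeasurePreserving (cellRotate p) volume volume := by
  have h : cellRotate p = fun x i =>
      (![fun t => 2 * Real.pi * p.L1 - t, fun t => 2 * Real.pi * p.L2 - t, fun t => t] :
        Fin 3 → ℝ → ℝ) i (x i) := by
    ext x i
    fin_cases i <;> rfl
  rw [h]
  refine volume_preserving_pi fun i => ?_
  fin_cases i
  · exact Measure.measurePreserving_sub_left volume _
  · exact Measure.measurePreserving_sub_left volume _
  · exact MeasurePreserving.id volume

lemma measurableEmbedding_cellRotate (p : Params) : MeasurableEmbedding (cellRotate p) := by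
  have hinv : Function.Involutive (cellRotate p) := by
    intro x
    ext i
    fin_cases i <;> simp [cellRotate]
  have hcont : Continuous (cellRotate p) := by
    refine continuous_pi fun i => ?_
    fin_cases i
    · exact continuous_const.sub (continuous_apply 0)
    · exact continuous_const.sub (continuous_apply 1)
    · exact continuous_apply 2
  exact (Homeomorph.mk hinv.toPerm hcont hcont).measurableEmbedding

/-- A periodic function that is odd under the horizontal reflection has mean zero. -/
lemma integral_eq_zero_of_odd {f : Pt → ℂ} (hf : HPeriodic p f)
    (hodd : ∀ x, f (hreflect x) = -f x) : ∫ x, f x ∂(cellVol p) = 0 := by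
  have hval : ∀ x, f (cellRotate p x) = -f x := by
    intro x
    rw [← hodd, ← hf 1 1 (hreflect x)]
    congr 1
    ext i
    fin_cases i <;> simp [cellRotate, hreflect] <;> ring
  have hpre : cellRotate p ⁻¹' cell p = cell p := by
    ext x
    simp only [cell, cellRotate, Set.mem_preimage, Set.mem_ofPred_eq, Matrix.cons_val_zero,
      Matrix.cons_val_one, Matrix.cons_val, Set.mem_Ioo]
    constructor <;> rintro ⟨⟨h1, h2⟩, ⟨h3, h4⟩, h5⟩ <;>
      exact ⟨⟨by linarith, by linarith⟩, ⟨by linarith, by linarith⟩, h5⟩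
  have h := (measurePreserving_cellRotate p).setIntegral_preimage_emb
    (measurableEmbedding_cellRotate p) f (cell p)
  rw [hpre] at h
  simp only [hval] at h
  rw [integral_neg] at h
  unfold cellVol
  exact self_eq_neg.1 h.symm

/-- The characteristic equation of the mode `J`. -/
def IsCharRoot (p : Params) (Ra : ℝ) (J : Idx) (z : ℂ) : Prop :=
  (a3 p J : ℂ) * z ^ 3 + (a2 p J : ℂ) * z ^ 2 + (a1 p Ra J : ℂ) * z + (a0 p Ra J : ℂ) = 0

lemma isCharRoot_neg {Ra : ℝ} {m n : ℤ} {l : ℕ} {z : ℂ} (h : IsCharRoot p Ra (m, n, l) z) :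
    IsCharRoot p Ra (-m, -n, l) z := by
  simpa [IsCharRoot, a3, a2, a1, a0, rSq, alphaSq, vertSq, magK] using h

/-- Elimination of the magnetic field from the Lorentz force. -/
lemma lorentz_eq {r κ b c : ℂ} (hr : r ≠ 0) (h : -r * b = κ * Complex.I * c) :
    κ * Complex.I * b = κ ^ 2 / r * c := by
  field_simp
  linear_combination -(κ * Complex.I) * h - κ ^ 2 * c * Complex.I_sq

/-- Modes with horizontal and vertical dependence: a nonzero coefficient forces the characteristic
equation, since the determinant of the system matrix has to vanish. -/
lemma coef_eq_zero_of_not_charRoot (hTa : 0 ≤ p.Ta) {J : Idx}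
    (hr : rSq p J ≠ 0) {Ra : ℝ} {β c₀ c₁ w t q b₀ b₁ b₂ : ℂ} (hβ : ¬ IsCharRoot p Ra J β)
    {κ₁ κ₂ ν r : ℂ} (h1 : κ₁ = (wave p J 0 : ℝ)) (h2 : κ₂ = (wave p J 1 : ℝ))
    (h3 : ν = (J.2.2 * Real.pi : ℝ)) (h4 : r = (rSq p J : ℝ))
    (eb0 : -r * b₀ = κ₂ * Complex.I * c₀) (eb1 : -r * b₁ = κ₂ * Complex.I * c₁)
    (eb2 : -r * b₂ = κ₂ * Complex.I * w)
    (e0 : -r * c₀ + κ₁ * Complex.I * q + (√p.Ta : ℝ) * c₁ - p.Q * (κ₂ * Complex.I * b₀) = β * c₀)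
    (e1 : -r * c₁ + κ₂ * Complex.I * q - (√p.Ta : ℝ) * c₀ - p.Q * (κ₂ * Complex.I * b₁) = β * c₁)
    (e2 : -r * w + ν * q + Ra * t - p.Q * (κ₂ * Complex.I * b₂) = β * w)
    (ediv : κ₁ * Complex.I * c₀ + κ₂ * Complex.I * c₁ = ν * w)
    (et : -r * t + w = p.Pr * β * t) : c₀ = 0 ∧ c₁ = 0 ∧ w = 0 ∧ t = 0 := by
  have hr' : r ≠ 0 := by rw [h4]; exact Complex.ofReal_ne_zero.2 hr
  have hg : ((dampV p J : ℝ) : ℂ) = r + p.Q * κ₂ ^ 2 / r := by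
    rw [dampV, magK_eq_wave, h4, h2]
    rw [h4] at hr'
    push_cast; field_simp
  have hI := Complex.I_sq
  rw [lorentz_eq hr' eb0] at e0
  rw [lorentz_eq hr' eb1] at e1
  rw [lorentz_eq hr' eb2] at e2
  have hdet : (matrixOf p Ra J β).det ≠ 0 := fun h => hβ (by
    rw [IsCharRoot, charPoly_eq_det hTa hr, h, mul_zero])
  have hv : ![-Complex.I * c₀, -Complex.I * c₁, w, q, t] = 0 := by
    refine Matrix.eq_zero_of_mulVec_eq_zero hdet ?_
    rw [matrixOf, modeMatrix_mulVec_eq_zero_iff, hg, ← h1, ← h2, ← h3, ← h4]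
    simp only [Matrix.cons_val_zero, Matrix.cons_val_one, Matrix.cons_val]
    refine ⟨?_, ?_, ?_, ?_, ?_⟩
    · linear_combination -Complex.I * e0 + κ₁ * q * hI
    · linear_combination -Complex.I * e1 + κ₂ * q * hI
    · linear_combination e2
    · linear_combination -ediv
    · linear_combination et
  refine ⟨?_, ?_, congrFun hv 2, congrFun hv 4⟩
  · have := congrFun hv 0
    simpa using this
  · have := congrFun hv 1
    simpa using this

/-- Modes without vertical dependence. -/
lemma coef_eq_zero_of_horizontal {T Q β c₀ c₁ q b₀ b₁ κ₁ κ₂ r : ℂ} (hr0 : r ≠ 0)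
    (hr : r = κ₁ ^ 2 + κ₂ ^ 2) (hβ : β ≠ -((Q * κ₂ ^ 2 + r ^ 2) / r))
    (eb0 : -r * b₀ = κ₂ * Complex.I * c₀) (eb1 : -r * b₁ = κ₂ * Complex.I * c₁)
    (e0 : -r * c₀ + κ₁ * Complex.I * q + T * c₁ - Q * (κ₂ * Complex.I * b₀) = β * c₀)
    (e1 : -r * c₁ + κ₂ * Complex.I * q - T * c₀ - Q * (κ₂ * Complex.I * b₁) = β * c₁)
    (ediv : κ₁ * c₀ + κ₂ * c₁ = 0) : c₀ = 0 ∧ c₁ = 0 := by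
  rw [lorentz_eq hr0 eb0] at e0
  rw [lorentz_eq hr0 eb1] at e1
  have hg : β + (Q * κ₂ ^ 2 + r ^ 2) / r ≠ 0 := fun h => hβ (eq_neg_of_add_eq_zero_left h)
  -- eliminating the pressure leaves the vertical vorticity `κ₂ c₀ - κ₁ c₁`
  have hprod : (β + (Q * κ₂ ^ 2 + r ^ 2) / r) * (κ₂ * c₀ - κ₁ * c₁) = 0 := by
    field_simp
    field_simp at e0 e1
    linear_combination -κ₂ * e0 + κ₁ * e1 + r * T * ediv
  have hvort := (mul_eq_zero.1 hprod).resolve_left hg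
  constructor
  · refine (mul_eq_zero.1 (?_ : r * c₀ = 0)).resolve_left hr0
    rw [hr]; linear_combination κ₁ * ediv + κ₂ * hvort
  · refine (mul_eq_zero.1 (?_ : r * c₁ = 0)).resolve_left hr0
    rw [hr]; linear_combination κ₂ * ediv - κ₁ * hvort

/-- Modes without horizontal dependence. -/
lemma coef_eq_zero_of_vertical {T P β c₀ c₁ w t ν r : ℂ} (hν : ν ≠ 0) (hP : P ≠ 0)
    (h1 : β ≠ -r + Complex.I * T) (h2 : β ≠ -r - Complex.I * T) (h3 : β ≠ -(r / P))
    (e0 : -r * c₀ + T * c₁ = β * c₀) (e1 : -r * c₁ - T * c₀ = β * c₁) (ediv : ν * w = 0)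
    (et : -r * t + w = P * β * t) : c₀ = 0 ∧ c₁ = 0 ∧ w = 0 ∧ t = 0 := by
  have hI := Complex.I_sq
  have hw : w = 0 := (mul_eq_zero.1 ediv).resolve_left hν
  have hne : (β + r - Complex.I * T) * (β + r + Complex.I * T) ≠ 0 := by
    refine mul_ne_zero (fun h => h1 ?_) (fun h => h2 ?_)
    · linear_combination h
    · linear_combination h
  refine ⟨?_, ?_, hw, ?_⟩
  · refine (mul_eq_zero.1 (?_ : _ * c₀ = 0)).resolve_left hne
    linear_combination -(β + r) * e0 - T * e1 - T ^ 2 * c₀ * hI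
  · refine (mul_eq_zero.1 (?_ : _ * c₁ = 0)).resolve_left hne
    linear_combination -(β + r) * e1 + T * e0 - T ^ 2 * c₁ * hI
  · have ht : (β + r / P) * t = 0 := by
      field_simp
      rw [hw] at et
      linear_combination -et
    refine (mul_eq_zero.1 ht).resolve_left fun h => h3 ?_
    linear_combination h

lemma trigCos_neg (p : Params) (m n l : ℤ) : trigCos p m n (-l) = trigCos p m n l := by
  ext x
  simp [trigCos, sep, cosP]

lemma trigSin_neg (p : Params) (m n l : ℤ) : trigSin p m n (-l) = fun x => -1 * trigSin p m n l x := by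
  ext x
  simp [trigSin, sep, sinP]

lemma trigSin_zero (p : Params) (m n : ℤ) : trigSin p m n 0 = fun _ => 0 := by
  ext x
  simp [trigSin, sep, sinP]

lemma coef_trigSin_zero (m n : ℤ) (f : Pt → ℂ) : coef p (trigSin p m n 0) f = 0 := by
  simp [coef, trigSin_zero]

lemma coef_trigCos_zero (f : Pt → ℂ) : coef p (trigCos p 0 0 0) f = ∫ x, f x ∂(cellVol p) := by
  simp [coef, trigCos, sep, cosP, expP]

/-- All Fourier coefficients of an eigenfunction vanish unless the eigenvalue is listed. -/
lemma coef_eq_zero_of_not_listed (hPr : 0 < p.Pr) (hTa : 0 ≤ p.Ta) (hL1 : 0 < p.L1)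
    (hL2 : 0 < p.L2) {Ra : ℝ} {β : ℂ} {Ψ : State p} (hΨ : IsEigenvector p Ra β Ψ)
    (hroot : ∀ J ∈ I1, ¬ IsCharRoot p Ra J β) (hpass : β ∉ passiveValues p) (m n : ℤ) (l : ℕ) :
    coef p (trigCos p m n l) (Ψ.u 0).toFun = 0 ∧ coef p (trigCos p m n l) (Ψ.u 1).toFun = 0 ∧
      coef p (trigSin p m n l) (Ψ.u 2).toFun = 0 ∧ coef p (trigSin p m n l) Ψ.θ.toFun = 0 := by
  obtain ⟨q, b₀, b₁, b₂, eb0, eb1, eb2, e0, e1, e2, ediv, et⟩ :=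
    mode_equations hPr hL1 hL2 hΨ m n l (κ₁ := wave p (m, n, l) 0) (κ₂ := wave p (m, n, l) 1)
      (ν := l * Real.pi) rfl rfl (by simp) rfl rfl rfl rfl
  have hrc : ((wave p (m, n, l) 0 : ℝ) : ℂ) ^ 2 + ((wave p (m, n, l) 1 : ℝ) : ℂ) ^ 2 +
      ((l * Real.pi : ℝ) : ℂ) ^ 2 = (rSq p (m, n, l) : ℝ) := by
    rw [rSq_eq_wave]; push_cast; rfl
  rw [hrc] at eb0 eb1 eb2 e0 e1 e2 et
  have hP : (p.Pr : ℂ) ≠ 0 := Complex.ofReal_ne_zero.2 hPr.ne'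
  by_cases hmn : (m, n) = (0, 0)
  · obtain ⟨rfl, rfl⟩ := Prod.mk.inj hmn
    rcases Nat.eq_zero_or_pos l with rfl | hl
    · refine ⟨?_, ?_, coef_trigSin_zero .., coef_trigSin_zero ..⟩
      · exact (coef_trigCos_zero _).trans (integral_eq_zero_of_odd (Ψ.u 0).periodic Ψ.odd_u0)
      · exact (coef_trigCos_zero _).trans (integral_eq_zero_of_odd (Ψ.u 1).periodic Ψ.odd_u1)
    · have hr : ((rSq p (0, 0, l) : ℝ) : ℂ) = (l : ℂ) ^ 2 * (Real.pi : ℂ) ^ 2 := by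
        simp [rSq, alphaSq, vertSq]
      have k0 : wave p (0, 0, l) 0 = 0 := by simp [wave]
      have k1 : wave p (0, 0, l) 1 = 0 := by simp [wave]
      rw [k1, hr, Complex.ofReal_zero] at e1
      rw [k0, k1, hr, Complex.ofReal_zero] at e0
      rw [k0, k1, Complex.ofReal_zero] at ediv
      rw [hr] at et
      have hl' : (0 : ℝ) < l := by exact_mod_cast hl
      refine coef_eq_zero_of_vertical (T := (√p.Ta : ℝ)) (P := p.Pr) (β := β)
        (r := (l : ℂ) ^ 2 * (Real.pi : ℂ) ^ 2) (ν := (l * Real.pi : ℝ))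
        (Complex.ofReal_ne_zero.2 (by positivity)) hP
        (fun h => hpass (Or.inr ⟨l, hl, Or.inl h⟩))
        (fun h => hpass (Or.inr ⟨l, hl, Or.inr (Or.inl h)⟩))
        (fun h => hpass (Or.inr ⟨l, hl, Or.inr (Or.inr h)⟩)) ?_ ?_ ?_ et
      · linear_combination e0
      · linear_combination e1
      · linear_combination -ediv
  · -- replace `(m, n)` by `(-m, -n)` if necessary, to reach the index set `j ≥ 0`
    have hsign : ∃ j k : ℤ, 0 ≤ j ∧ (j, k) ≠ (0, 0) ∧ ((j, k) = (m, n) ∨ (j, k) = (-m, -n)) := by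
      rcases le_total 0 m with h | h
      · exact ⟨m, n, h, hmn, Or.inl rfl⟩
      · refine ⟨-m, -n, by omega, fun h' => hmn ?_, Or.inr rfl⟩
        obtain ⟨ha, hb⟩ := Prod.mk.inj h'
        rw [neg_eq_zero.1 ha, neg_eq_zero.1 hb]
    obtain ⟨j, k, hj, hjk, hor⟩ := hsign
    have hApos : 0 < alphaSq p (m, n, l) := alphaSq_pos hL1 hL2 hmn
    have hrpos : 0 < rSq p (m, n, l) := add_pos_of_pos_of_nonneg hApos (vertSq_nonneg _)
    have hr0 : ((rSq p (m, n, l) : ℝ) : ℂ) ≠ 0 := Complex.ofReal_ne_zero.2 hrpos.ne'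
    rcases Nat.eq_zero_or_pos l with rfl | hl
    · have hr : rSq p (m, n, 0) = alphaSq p (m, n, 0) := by simp [rSq, vertSq]
      have hβ : β ≠ -(((p.Q : ℂ) * ((wave p (m, n, 0) 1 : ℝ) : ℂ) ^ 2 +
          ((rSq p (m, n, 0) : ℝ) : ℂ) ^ 2) / ((rSq p (m, n, 0) : ℝ) : ℂ)) := by
        intro h
        refine hpass (Or.inl ⟨j, k, hj, hjk, ?_⟩)
        have hA : alphaSq p (j, k, 0) = alphaSq p (m, n, 0) := by
          rcases hor with h | h <;> obtain ⟨rfl, rfl⟩ := Prod.mk.inj h <;> simp [alphaSq]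
        have hM : magK p (j, k, 0) = magK p (m, n, 0) := by
          rcases hor with h | h <;> obtain ⟨rfl, rfl⟩ := Prod.mk.inj h <;> simp [magK]
        rw [h, hA, hM, magK_eq_wave, hr]
        push_cast
        rfl
      obtain ⟨z0, z1⟩ := coef_eq_zero_of_horizontal hr0 (by rw [← hrc]; simp) hβ eb0 eb1 e0 e1 (by
        have h0 : ((0 : ℕ) * Real.pi : ℝ) = 0 := by simp
        rw [h0, Complex.ofReal_zero, zero_mul] at ediv
        refine (mul_eq_zero.1 (?_ : Complex.I * _ = 0)).resolve_left Complex.I_ne_zero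
        linear_combination ediv)
      exact ⟨z0, z1, coef_trigSin_zero .., coef_trigSin_zero ..⟩
    · refine coef_eq_zero_of_not_charRoot hTa hrpos.ne' (J := (m, n, l)) (Ra := Ra) (β := β)
        (fun h => ?_) rfl rfl rfl rfl eb0 eb1 eb2 e0 e1 e2 ediv et
      refine hroot (j, k, l) ⟨hj, hjk, hl⟩ ?_
      rcases hor with h' | h' <;> obtain ⟨rfl, rfl⟩ := Prod.mk.inj h'
      · exact h
      · exact isCharRoot_neg h

/-- Every eigenvalue is a root of a characteristic equation or a passive value. -/
lemma charRoot_or_passive_of_isEigenvalue (hPr : 0 < p.Pr) (hTa : 0 ≤ p.Ta) (hL1 : 0 < p.L1)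
    (hL2 : 0 < p.L2) {Ra : ℝ} {β : ℂ} (h : IsEigenvalue p Ra β) :
    (∃ J ∈ I1, IsCharRoot p Ra J β) ∨ β ∈ passiveValues p := by
  by_contra! hcon
  obtain ⟨hroot, hpass⟩ := hcon
  obtain ⟨Ψ, hΨ⟩ := h
  have hz := coef_eq_zero_of_not_listed hPr hTa hL1 hL2 hΨ hroot hpass
  have hcos : ∀ f : Pt → ℂ, MemLp f 2 (cellVol p) →
      (∀ (m n : ℤ) (l : ℕ), coef p (trigCos p m n l) f = 0) → f =ᵐ[cellVol p] 0 := by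
    intro f hf h0
    refine ae_eq_zero_of_trigCos hL1 hL2 hf fun m n l => ?_
    rcases l.natAbs_eq with hl | hl
    · rw [hl]; exact h0 m n _
    · rw [hl, trigCos_neg]; exact h0 m n _
  have hsin : ∀ f : Pt → ℂ, MemLp f 2 (cellVol p) →
      (∀ (m n : ℤ) (l : ℕ), coef p (trigSin p m n l) f = 0) → f =ᵐ[cellVol p] 0 := by
    intro f hf h0
    refine ae_eq_zero_of_trigSin hL1 hL2 hf fun m n l => ?_
    rcases l.natAbs_eq with hl | hl
    · rw [hl]; exact h0 m n _
    · rw [hl, trigSin_neg]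
      exact (coef_test_const_mul (-1)).trans (by rw [h0, mul_zero])
  refine hΨ.1 ⟨fun i => ?_, hsin _ Ψ.θ.memLp fun m n l => (hz m n l).2.2.2⟩
  fin_cases i
  · exact hcos _ (Ψ.u 0).memLp fun m n l => (hz m n l).1
  · exact hcos _ (Ψ.u 1).memLp fun m n l => (hz m n l).2.1
  · exact hsin _ (Ψ.u 2).memLp fun m n l => (hz m n l).2.2.1

lemma IsOrderedRoots.isCharRoot {Ra : ℝ} {J : Idx} {β : Fin 3 → ℂ} (h : IsOrderedRoots p Ra J β)
    (s : Fin 3) : IsCharRoot p Ra J (β s) := by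
  rw [IsCharRoot, h.1]
  fin_cases s <;> simp

lemma IsOrderedRoots.exists_eq (hPr : 0 < p.Pr) {Ra : ℝ} {J : Idx} (hr : 0 < rSq p J)
    {β : Fin 3 → ℂ} (h : IsOrderedRoots p Ra J β) {z : ℂ} (hz : IsCharRoot p Ra J z) :
    ∃ s, z = β s := by
  have ha3 : (a3 p J : ℂ) ≠ 0 := Complex.ofReal_ne_zero.2 (by unfold a3; positivity)
  rw [IsCharRoot, h.1] at hz
  rcases mul_eq_zero.1 ((mul_eq_zero.1 hz).resolve_left ha3) with h' | h'
  · rcases mul_eq_zero.1 h' with h' | h'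
    · exact ⟨0, sub_eq_zero.1 h'⟩
    · exact ⟨1, sub_eq_zero.1 h'⟩
  · exact ⟨2, sub_eq_zero.1 h'⟩

end

end RMC

theorem lemma2p1 (p : Params) (hPr : 0 < p.Pr) (hTa : 0 ≤ p.Ta) (hQ : 0 ≤ p.Q)
    (hL1 : 0 < p.L1) (hL2 : 0 < p.L2)
    (β : ℝ → Idx → Fin 3 → ℂ)
    (hβ : ∀ Ra : ℝ, ∀ J ∈ I1, IsOrderedRoots p Ra J (β Ra J)) :
    -- both minima are attained
    IsLeast (fRa p '' I1) (Rac1 p) ∧ IsLeast (gRa p '' I1) (Rac2 p) ∧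
    -- the numbers `β Ra J s` are eigenvalues of `L`; the other eigenvalues are passive and stable
    (∀ Ra : ℝ, ∀ J ∈ I1, ∀ s, IsEigenvalue p Ra (β Ra J s)) ∧
    (∀ (Ra : ℝ) (z : ℂ), IsEigenvalue p Ra z →
      (∃ J ∈ I1, ∃ s, z = β Ra J s) ∨ z ∈ passiveValues p) ∧
    (∀ z ∈ passiveValues p, z.re < 0) ∧
    -- (1) a real eigenvalue becomes critical first
    (Rac1 p < Rac2 p →
      (∀ J ∈ critX p,
        (∀ Ra : ℝ, Ra < Rac1 p → (β Ra J 0).re < 0) ∧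
        (∃ δ > 0, ∀ Ra : ℝ, Rac1 p - δ < Ra → Ra < Rac1 p → (β Ra J 0).im = 0) ∧
        β (Rac1 p) J 0 = 0 ∧
        (∀ Ra : ℝ, Rac1 p < Ra → (β Ra J 0).im = 0 ∧ 0 < (β Ra J 0).re)) ∧
      (∀ J ∈ I1, ∀ s : Fin 3, ¬ (J ∈ critX p ∧ s = 0) → (β (Rac1 p) J s).re < 0)) ∧
    -- (2) a pair of complex conjugate eigenvalues becomes critical first
    (Rac2 p < Rac1 p →
      (∀ J ∈ critX p,
        (∃ δ > 0, ∀ Ra : ℝ, 0 ≤ Ra → Ra < Rac2 p + δ →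
          β Ra J 1 = (starRingEnd ℂ) (β Ra J 0) ∧ (β Ra J 0).im ≠ 0) ∧
        (∀ Ra : ℝ, Ra < Rac2 p → (β Ra J 0).re < 0 ∧ (β Ra J 1).re < 0) ∧
        ((β (Rac2 p) J 0).re = 0 ∧ (β (Rac2 p) J 1).re = 0) ∧
        (∀ Ra : ℝ, Rac2 p < Ra → 0 < (β Ra J 0).re) ∧
        (∀ Ra : ℝ, Rac2 p < Ra → Ra < Rac1 p → 0 < (β Ra J 1).re) ∧
        (∃ σ' > 0, HasDerivAt (fun Ra : ℝ => (β Ra J 0).re) σ' (Rac2 p))) ∧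
      (∀ J ∈ I1, ∀ s : Fin 3, ¬ (J ∈ critX p ∧ (s = 0 ∨ s = 1)) →
        (β (Rac2 p) J s).re < 0)) := by
  refine ⟨isLeast_Rac1 hTa hQ hL1 hL2, isLeast_Rac2 hPr hTa hQ hL1 hL2, fun Ra J hJ s => ?_,
    fun Ra z hz => ?_, fun z hz => passiveValues_re_neg hPr hQ hL1 hL2 hz,
    stability_real hPr hTa hQ hL1 hL2 hβ, stability_complex hPr hTa hQ hL1 hL2 hβ⟩
  · have hR := rSq_pos hL1 hL2 hJ
    have h := (hβ Ra J hJ).isCharRoot s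
    rw [IsCharRoot, charPoly_eq_det hTa hR.ne'] at h
    exact isEigenvalue_of_det_eq_zero hPr hL1 hL2 hJ
      ((mul_eq_zero.1 h).resolve_left (Complex.ofReal_ne_zero.2 hR.ne'))
  · rcases charRoot_or_passive_of_isEigenvalue hPr hTa hL1 hL2 hz with ⟨J, hJ, hc⟩ | h
    · obtain ⟨s, hs⟩ := (hβ Ra J hJ).exists_eq hPr (rSq_pos hL1 hL2 hJ) hc
      exact Or.inl ⟨J, hJ, s, hs⟩
    · exact Or.inr h
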